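/- Let $\Sigma$ be a finite alphabet. For $d\in\mathbb N$, a finite monoid $M$, a morphism $\mu:\Sigma^*\to M$ and a function $\pi:M^{d+1}\to\mathbb Z$, let $$\pi^\dagger(w)=\sum_{w=u_1\cdots u_{d+1}}\pi(\mu(u_1),\dots,\mu(u_{d+1}))\qquad(w\in\Sigma^*),$$ the sum being over all factorizations of $w$ into $d+1$ possibly empty words. The functions $\pi^\dagger:\Sigma^*\to\mathbb Z$ (for all $d,M,\mu,\pi$) are the $\mathbb Z$-polyregular functions, and $(d,M,\mu,\pi)$ is called a presentation of $\pi^\dagger$. If $\pi$ can be chosen with values in $\mathbb N$, the function is $\mathbb N$-polyregular ($\mathsf{NPoly}$); if $M$ can be chosen aperiodic (every $x\in M$ satisfies $x^{n+1}=x^n$ for some $n$), it is in $\mathsf{ZSF}$; if both can be achieved by the same presentation, it is in $\mathsf{NSF}$. A function $f$ on $\Sigma^*$ is commutative if $f(w)$ does not change when the letters of $w$ are permuted. A pumping pattern is a map $q:\mathbb N^p\to\Sigma^*$ of the form $q(x_1,\dots,x_p)=\alpha_0u_1^{x_1}\alpha_1\cdots u_p^{x_p}\alpha_p$ with fixed words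 $\alpha_i,u_i\in\Sigma^*$. A function $f:\Sigma^*\to\mathbb Z$ is ultimately polynomial if there is $N_0\in\mathbb N$ such that for every $p\in\mathbb N$ and every pumping pattern $q:\mathbb N^p\to\Sigma^*$ there is $P\in\mathbb Q[X_1,\dots,X_p]$ with $f(q(x))=P(x)$ for all $x\in(\mathbb N_{\ge N_0})^p$. Theorem. Let $f:\Sigma^*\to\mathbb Z$ be a commutative $\mathbb N$-polyregular function. The following are equivalent: (1) $f$ is ultimately polynomial; (2) $f\in\mathsf{ZSF}$; (3) $f\in\mathsf{NSF}$. In particular, a commutative function $f:\Sigma^*\to\mathbb Z$ belongs to $\mathsf{NPoly}\cap\mathsf{ZSF}$ if and only if it belongs to $\mathsf{NSF}$. Furthermore, membership is decidable and the conversions are effective. There are algorithms that take as input a finite alphabet $\Sigma=\{0,\dots,k-1\}$ (given by $k$) and a presentation $(d,M,\mu,\pi)$, with $\pi$ valued in $\mathbb Z$ and given by finite tables, of a function $f$ that is commutative and $\mathbb N$-polyregular, always terminate on such inputs, and do the following: (a) decide whether $f\in\mathsf{NSF}$ (equivalently, whether (1) or (2) holds); (b) if the equivalent conditions hold, output a presentation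 of $f$ whose monoid is aperiodic and whose production function $\pi$ has values in $\mathbb N$; (c) if the equivalent conditions hold, output a threshold $N_0$ and, given in addition any pumping pattern $q:\mathbb N^p\to\Sigma^*$, output a polynomial $P\in\mathbb Q[X_1,\dots,X_p]$ such that $f(q(x))=P(x)$ for all $x\in(\mathbb N_{\ge N_0})^p$, where $N_0$ does not depend on $q$. -/

import Mathlib

/-! ### Words and factorizations

The free monoid `FreeMonoid A` is the set of words over the alphabet `A`. -/

/-- A word has only finitely many factorizations `w = u₁ ⋯ uₙ` (with possibly empty factors). -/
theorem finite_factorizations {A : Type*} (n : ℕ) (w : FreeMonoid A) :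
    {u : Fin n → FreeMonoid A | (List.ofFn u).prod = w}.Finite := by
  have hfin : {v : FreeMonoid A | v.toList <:+: w.toList}.Finite := by
    refine Set.Finite.subset (s := {v : List A | v ∈ w.toList.sublists})
      (List.finite_toSet _) ?_
    intro v hv
    exact List.mem_sublists.2 (List.IsInfix.sublist hv)
  refine Set.Finite.subset
    (Set.Finite.pi (ι := Fin n) (t := fun _ => {v : FreeMonoid A | v.toList <:+: w.toList})
      (fun _ => hfin)) ?_
  intro u hu i _
  have key : ∀ (l : List (FreeMonoid A)) (v : FreeMonoid A), v ∈ l →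
      v.toList <:+: l.prod.toList := by
    intro l
    induction l with
    | nil => intro v hv; simp at hv
    | cons a l ih =>
      intro v hv
      rw [List.prod_cons, FreeMonoid.toList_mul]
      rcases List.mem_cons.1 hv with rfl | hv
      · exact (List.prefix_append _ _).isInfix
      · exact (ih v hv).trans (List.suffix_append _ _).isInfix
  have h := key (List.ofFn u) (u i) (List.mem_ofFn.2 ⟨i, rfl⟩)
  rw [show (List.ofFn u).prod = w from hu] at h
  exact h

/-- The finite set of all factorizations `w = u₁ ⋯ uₙ` of a word into `n` possibly empty words. -/
noncomputable def factorizations {A : Type*} (n : ℕ) (w : FreeMonoid A) :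
    Finset (Fin n → FreeMonoid A) :=
  (finite_factorizations n w).toFinset

/-- A function on words is commutative if it is invariant under permuting the letters of
its input. -/
def IsCommutative {A X : Type*} (f : FreeMonoid A → X) : Prop :=
  ∀ u v : FreeMonoid A, List.Perm u.toList v.toList → f u = f v

/-! ### Polyregular functions -/

/-- The function `w ↦ ∑_{w = u₁ ⋯ u_{d+1}} π (μ u₁, …, μ u_{d+1})`. -/
noncomputable def polySum {A M : Type*} [Monoid M] {d : ℕ} (μ : FreeMonoid A →* M)
    (π : (Fin (d + 1) → M) → ℤ) (w : FreeMonoid A) : ℤ :=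
  ∑ u ∈ factorizations (d + 1) w, π (fun i => μ (u i))

/-- A monoid is aperiodic if every `x` satisfies `x ^ (n + 1) = x ^ n` for some `n`. -/
def IsAperiodic (M : Type*) [Monoid M] : Prop :=
  ∀ x : M, ∃ n : ℕ, x ^ (n + 1) = x ^ n

/-- `ℕ`-polyregular functions: the production function has values in `ℕ`. -/
def IsNPoly {A : Type*} (f : FreeMonoid A → ℤ) : Prop :=
  ∃ (d : ℕ) (M : Type) (_ : Monoid M) (_ : Finite M) (μ : FreeMonoid A →* M)
    (π : (Fin (d + 1) → M) → ℤ), (∀ m, 0 ≤ π m) ∧ f = polySum μ π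

/-- Star-free `ℤ`-polyregular functions: the monoid is aperiodic. -/
def IsZSF {A : Type*} (f : FreeMonoid A → ℤ) : Prop :=
  ∃ (d : ℕ) (M : Type) (_ : Monoid M) (_ : Finite M) (μ : FreeMonoid A →* M)
    (π : (Fin (d + 1) → M) → ℤ), IsAperiodic M ∧ f = polySum μ π

/-- Star-free `ℕ`-polyregular functions: the monoid is aperiodic and the production function
has values in `ℕ`. -/
def IsNSF {A : Type*} (f : FreeMonoid A → ℤ) : Prop :=
  ∃ (d : ℕ) (M : Type) (_ : Monoid M) (_ : Finite M) (μ : FreeMonoid A →* M)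
    (π : (Fin (d + 1) → M) → ℤ), IsAperiodic M ∧ (∀ m, 0 ≤ π m) ∧ f = polySum μ π

/-! ### Pumping patterns and ultimately polynomial functions -/

/-- The data `α₀, …, αₚ` and `u₁, …, uₚ` of a pumping pattern `ℕᵖ → A*`. -/
structure PumpingPattern (A : Type*) (p : ℕ) where
  α : Fin (p + 1) → FreeMonoid A
  u : Fin p → FreeMonoid A

/-- The function `(x₁, …, xₚ) ↦ α₀ u₁^x₁ α₁ ⋯ uₚ^xₚ αₚ`. -/
def PumpingPattern.eval {A : Type*} {p : ℕ} (q : PumpingPattern A p) (x : Fin p → ℕ) :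
    FreeMonoid A :=
  q.α 0 * (List.ofFn fun i : Fin p => q.u i ^ x i * q.α i.succ).prod

/-- `f ∘ q = P` on all tuples whose entries are at least `N₀`. -/
def AgreesFrom {A : Type*} {p : ℕ} (f : FreeMonoid A → ℤ) (q : PumpingPattern A p) (N₀ : ℕ)
    (P : MvPolynomial (Fin p) ℚ) : Prop :=
  ∀ x : Fin p → ℕ, (∀ i, N₀ ≤ x i) →
    (f (q.eval x) : ℚ) = MvPolynomial.eval (fun i => (x i : ℚ)) P

/-- Ultimately polynomial functions. The threshold `N₀` does not depend on the pattern. -/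
def IsUltimatelyPolynomial {A : Type*} (f : FreeMonoid A → ℤ) : Prop :=
  ∃ N₀ : ℕ, ∀ (p : ℕ) (q : PumpingPattern A p),
    ∃ P : MvPolynomial (Fin p) ℚ, AgreesFrom f q N₀ P

/-! ### Finite descriptions, as inputs and outputs of algorithms

Algorithms are partial recursive functions in the sense of `Partrec`. The alphabet is
`Fin k`, and `k` is a part of the input. -/

/-- A finite description of a triple `(M, μ, π)` with `π : M^(deg + 1) → ℤ`: the size of `M`, the
multiplication table, the images of the letters, and the table of `π`. -/
structure PolyCode where
  deg : ℕ
  size : ℕ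
  mulTable : List ℕ
  letters : List ℕ
  prodTable : List ℤ

/-- A description is read as the tuple of its components. -/
def PolyCode.equivProd : PolyCode ≃ ℕ × ℕ × List ℕ × List ℕ × List ℤ where
  toFun c := (c.deg, c.size, c.mulTable, c.letters, c.prodTable)
  invFun t := ⟨t.1, t.2.1, t.2.2.1, t.2.2.2.1, t.2.2.2.2⟩
  left_inv _ := rfl
  right_inv _ := rfl

instance PolyCode.primcodable : Primcodable PolyCode :=
  Primcodable.ofEquiv _ PolyCode.equivProd

/-- `c` describes `(M, μ, π)`, when the elements of `M` are numbered by `e`. The tuple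
`(m₀, …, m_d)` has number `∑ i, e mᵢ * size ^ i` in the table of `π`. -/
structure PolyCode.Describes {k : ℕ} {M : Type} [Monoid M] (c : PolyCode) (e : M ≃ Fin c.size)
    (μ : FreeMonoid (Fin k) →* M) (π : (Fin (c.deg + 1) → M) → ℤ) : Prop where
  mul : ∀ x y : M, c.mulTable[(e x : ℕ) * c.size + (e y : ℕ)]? = some (e (x * y) : ℕ)
  letter : ∀ a : Fin k, c.letters[(a : ℕ)]? = some (e (μ (FreeMonoid.of a)) : ℕ)
  production : ∀ m : Fin (c.deg + 1) → M,
    c.prodTable[(finFunctionFinEquiv (fun i => e (m i)) : ℕ)]? = some (π m)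

/-- `c` is a description of the `ℤ`-polyregular function `f`. -/
def PolyCode.Encodes {k : ℕ} (c : PolyCode) (f : FreeMonoid (Fin k) → ℤ) : Prop :=
  ∃ (M : Type) (_ : Monoid M) (e : M ≃ Fin c.size) (μ : FreeMonoid (Fin k) →* M)
    (π : (Fin (c.deg + 1) → M) → ℤ), c.Describes e μ π ∧ f = polySum μ π

/-- `c` is a description of `f` as a star-free `ℕ`-polyregular function: the monoid
is aperiodic and the production function has values in `ℕ`. -/
def PolyCode.EncodesNSF {k : ℕ} (c : PolyCode) (f : FreeMonoid (Fin k) → ℤ) : Prop :=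
  ∃ (M : Type) (_ : Monoid M) (e : M ≃ Fin c.size) (μ : FreeMonoid (Fin k) →* M)
    (π : (Fin (c.deg + 1) → M) → ℤ),
    c.Describes e μ π ∧ IsAperiodic M ∧ (∀ m, 0 ≤ π m) ∧ f = polySum μ π

/-- A word over `Fin k` as a list of natural numbers. -/
def wordCode {k : ℕ} (w : FreeMonoid (Fin k)) : List ℕ :=
  w.toList.map Fin.val

/-- A pumping pattern over `Fin k` as the word `α₀` followed by the list of
pairs `(uᵢ, αᵢ)`. -/
def PumpingPattern.code {k p : ℕ} (q : PumpingPattern (Fin k) p) :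
    List ℕ × List (List ℕ × List ℕ) :=
  (wordCode (q.α 0), List.ofFn fun i : Fin p => (wordCode (q.u i), wordCode (q.α i.succ)))

/-- The polynomial `∑ (a / b) X₁^e₁ ⋯ Xₚ^eₚ` given by a list of triples `(a, b, [e₁, …, eₚ])`. -/
noncomputable def decodePolynomial (p : ℕ) (l : List (ℤ × ℕ × List ℕ)) :
    MvPolynomial (Fin p) ℚ :=
  (l.map fun t => MvPolynomial.C ((t.1 : ℚ) / (t.2.1 : ℚ)) *
    ∏ i : Fin p, MvPolynomial.X i ^ (t.2.2.getD (i : ℕ) 0)).sum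

/-! For a fixed morphism `μ`, `polySpace R μ d` is the space of functions built from `h ∘ μ` by at
most `d` Cauchy products, over any commutative semiring `R`. It is closed under left translation,
and `exists_pump` shows that pumping a prefix along a progression of step `ω` gives a combination of
binomials `y.choose j` whose coefficients are again in the space. Over `ℚ` and with `ω = 1`, which
is the aperiodic case, iterating this over the pumped words shows that `ZSF` functions are
ultimately polynomial. Since `NSF` is contained in `ZSF`, the substance is the passage from
ultimately polynomial to `NSF`.

Let `T_a` be the translation by a letter `a`; on commutative functions these operators commute.
Ultimate polynomiality gives `T_a ^ T * (T_a - 1) ^ D * f = 0` with `T`, `D` read off a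
presentation. Hence `f` expands, one letter after another, in the functions `[x = r]` for `r < N`
and `(x - N choose r - N)` for `r ≥ N` of the letter counts, with the coefficients `coefOp N a r f`.

The crux is that these coefficients are nonnegative. Over `ℚ≥0`, pumping gives Newton coefficients
with step `ω` that lie in the cone `polySpace ℚ≥0 μ d`. Passing to step `1` and to a base point `N ≥
T + ω * d` multiplies them by nonnegative rationals (`exists_nonneg_coefficients`), because every
difference of `(x / ω choose j)` is nonnegative from `ω * d` on. So `coefOp` preserves the cone
(`isTame_coefOp`); when all letters are used up, a nonnegative integer remains. The products of
basis functions are themselves in `NSF` (`basisProd_mem_polySpace`).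

For the algorithms, a function in a finite-dimensional translation-invariant space is determined by
its values on words shorter than the dimension. This makes equality of presentations and the
vanishing of `(T_a - 1) ^ D` finite tests. The conversion and the polynomials are found by unbounded
search with a decidable check; the theory guarantees that a solution exists. -/

/-! ### Sums over splittings of a word -/

/-- The sum of `G u v` over all splittings `w = u * v`. -/
def splitSum {A R : Type*} [CommSemiring R] (G : FreeMonoid A → FreeMonoid A → R)
    (w : FreeMonoid A) : R :=
  List.rec (motive := fun _ => (FreeMonoid A → FreeMonoid A → R) → R) (fun G => G 1 1)
    (fun a l ih G => G 1 (FreeMonoid.ofList (a :: l)) + ih (fun u v => G (FreeMonoid.of a * u) v))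
    w.toList G

section SplitSum

variable {A R : Type*} [CommSemiring R]

@[simp] theorem splitSum_one (G : FreeMonoid A → FreeMonoid A → R) : splitSum G 1 = G 1 1 := rfl

theorem splitSum_of_mul (G : FreeMonoid A → FreeMonoid A → R) (a : A) (w : FreeMonoid A) :
    splitSum G (FreeMonoid.of a * w) =
      G 1 (FreeMonoid.of a * w) + splitSum (fun u v => G (FreeMonoid.of a * u) v) w := rfl

theorem splitSum_add (G H : FreeMonoid A → FreeMonoid A → R) (w : FreeMonoid A) :
    splitSum (fun u v => G u v + H u v) w = splitSum G w + splitSum H w := by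
  induction w using FreeMonoid.inductionOn' generalizing G H with
  | one => rfl
  | of_mul a w ih => rw [splitSum_of_mul, splitSum_of_mul, splitSum_of_mul, ih]; ring

theorem splitSum_mul_left (c : R) (G : FreeMonoid A → FreeMonoid A → R) (w : FreeMonoid A) :
    splitSum (fun u v => c * G u v) w = c * splitSum G w := by
  induction w using FreeMonoid.inductionOn' generalizing G with
  | one => rfl
  | of_mul a w ih => rw [splitSum_of_mul, splitSum_of_mul, ih]; ring

theorem splitSum_zero (w : FreeMonoid A) :
    splitSum (fun _ _ => (0 : R)) w = 0 := by
  induction w using FreeMonoid.inductionOn' with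
  | one => rfl
  | of_mul a w ih => rw [splitSum_of_mul, ih]; ring

theorem splitSum_sum {ι : Type*} (s : Finset ι) (G : ι → FreeMonoid A → FreeMonoid A → R)
    (w : FreeMonoid A) :
    splitSum (fun u v => ∑ i ∈ s, G i u v) w = ∑ i ∈ s, splitSum (G i) w := by
  classical
  induction s using Finset.induction_on with
  | empty => simpa using splitSum_zero w
  | insert i s hi ih => simp only [Finset.sum_insert hi]; rw [splitSum_add, ih]

theorem splitSum_congr {G H : FreeMonoid A → FreeMonoid A → R} {w : FreeMonoid A}
    (h : ∀ u v, u * v = w → G u v = H u v) : splitSum G w = splitSum H w := by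
  induction w using FreeMonoid.inductionOn' generalizing G H with
  | one => exact h 1 1 rfl
  | of_mul a w ih =>
    rw [splitSum_of_mul, splitSum_of_mul, h 1 _ (one_mul _)]
    congr 1
    exact ih fun u v huv => h _ v (by rw [mul_assoc, huv])

theorem map_splitSum {S : Type*} [CommSemiring S] (φ : R →+* S)
    (G : FreeMonoid A → FreeMonoid A → R) (w : FreeMonoid A) :
    φ (splitSum G w) = splitSum (fun u v => φ (G u v)) w := by
  induction w using FreeMonoid.inductionOn' generalizing G with
  | one => rfl
  | of_mul a w ih => rw [splitSum_of_mul, splitSum_of_mul, map_add, ih]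

/-- Only the splitting with empty left part contributes. -/
theorem splitSum_eq_left {G : FreeMonoid A → FreeMonoid A → R} {w : FreeMonoid A}
    (h : ∀ u v, u ≠ 1 → G u v = 0) : splitSum G w = G 1 w := by
  induction w using FreeMonoid.inductionOn' with
  | one => rfl
  | of_mul a w ih =>
    rw [splitSum_of_mul]
    have : splitSum (fun u v => G (FreeMonoid.of a * u) v) w = splitSum (fun _ _ => (0 : R)) w := by
      refine splitSum_congr fun u v _ => h _ _ ?_
      intro h1
      have := congrArg FreeMonoid.length h1
      simp at this
    rw [this, splitSum_zero, add_zero]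

end SplitSum

/-- The sum `∑_{w = u₁ ⋯ u_{d+1}} π (μ u₁, …, μ u_{d+1})` in any commutative semiring. -/
def pSum {A M R : Type*} [Monoid M] [CommSemiring R] (μ : FreeMonoid A →* M) :
    (d : ℕ) → ((Fin (d + 1) → M) → R) → FreeMonoid A → R
  | 0, π, w => π fun _ => μ w
  | d + 1, π, w => splitSum (fun u v => pSum μ d (fun t => π (Fin.cons (μ u) t)) v) w

section PSum

variable {A M R : Type*} [Monoid M] [CommSemiring R]

theorem map_pSum {S : Type*} [CommSemiring S] (φ : R →+* S) (μ : FreeMonoid A →* M) (d : ℕ)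
    (π : (Fin (d + 1) → M) → R) (w : FreeMonoid A) :
    φ (pSum μ d π w) = pSum μ d (fun m => φ (π m)) w := by
  induction d generalizing w with
  | zero => rfl
  | succ d ih => simp only [pSum, map_splitSum, ih]

theorem pSum_add (μ : FreeMonoid A →* M) (d : ℕ)
    (π ρ : (Fin (d + 1) → M) → R) (w : FreeMonoid A) :
    pSum μ d (fun m => π m + ρ m) w = pSum μ d π w + pSum μ d ρ w := by
  induction d generalizing w with
  | zero => rfl
  | succ d ih => simp only [pSum, ih, splitSum_add]

theorem pSum_mul_left (μ : FreeMonoid A →* M) (d : ℕ) (c : R)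
    (π : (Fin (d + 1) → M) → R) (w : FreeMonoid A) :
    pSum μ d (fun m => c * π m) w = c * pSum μ d π w := by
  induction d generalizing w with
  | zero => rfl
  | succ d ih => simp only [pSum, ih, splitSum_mul_left]

end PSum

/-! ### Factorizations as iterated splittings -/

theorem mem_factorizations {A : Type*} {n : ℕ} {w : FreeMonoid A} {u : Fin n → FreeMonoid A} :
    u ∈ factorizations n w ↔ (List.ofFn u).prod = w := by
  simp [factorizations]

theorem FreeMonoid.eq_one_of_mul_eq_one {A : Type*} {u v : FreeMonoid A} (h : u * v = 1) :
    u = 1 ∧ v = 1 := by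
  have := congrArg FreeMonoid.length h
  rw [FreeMonoid.length_mul, FreeMonoid.length_one, Nat.add_eq_zero_iff] at this
  exact ⟨FreeMonoid.length_eq_zero.1 this.1, FreeMonoid.length_eq_zero.1 this.2⟩

/-- After a letter `a`, the first factor is either empty or starts with `a`; removing that `a`
matches the second kind with the factorizations of the shorter word. This is the recursion that
defines `splitSum`. -/
theorem sum_factorizations_succ {A R : Type*} [CommSemiring R] (n : ℕ)
    (G : FreeMonoid A → (Fin n → FreeMonoid A) → R) (w : FreeMonoid A) :
    ∑ u ∈ factorizations (n + 1) w, G (u 0) (Fin.tail u) =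
      splitSum (fun u v => ∑ t ∈ factorizations n v, G u t) w := by
  classical
  induction w using FreeMonoid.inductionOn' generalizing G with
  | one =>
    rw [splitSum_one]
    refine Finset.sum_bij' (fun u _ => Fin.tail u) (fun t _ => Fin.cons 1 t) ?_ ?_ ?_ ?_ ?_
    · intro u hu
      rw [mem_factorizations, List.ofFn_succ, List.prod_cons] at hu
      rw [mem_factorizations]
      exact (FreeMonoid.eq_one_of_mul_eq_one hu).2
    · intro t ht
      rw [mem_factorizations] at ht ⊢
      rw [List.ofFn_succ, List.prod_cons]; simpa using ht
    · intro u hu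
      rw [mem_factorizations, List.ofFn_succ, List.prod_cons] at hu
      have h0 := (FreeMonoid.eq_one_of_mul_eq_one hu).1
      simp only [← h0, Fin.cons_self_tail]
    · intro t _; simp
    · intro u hu
      rw [mem_factorizations, List.ofFn_succ, List.prod_cons] at hu
      rw [(FreeMonoid.eq_one_of_mul_eq_one hu).1]
  | of_mul a w ih =>
    rw [splitSum_of_mul, ← ih (fun u t => G (FreeMonoid.of a * u) t),
      ← Finset.sum_filter_add_sum_filter_not _ (fun u => u 0 = 1)]
    congr 1
    · refine Finset.sum_bij' (fun u _ => Fin.tail u) (fun t _ => Fin.cons 1 t) ?_ ?_ ?_ ?_ ?_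
      · intro u hu
        rw [Finset.mem_filter, mem_factorizations, List.ofFn_succ, List.prod_cons] at hu
        rw [mem_factorizations, ← hu.1, hu.2, one_mul]; rfl
      · intro t ht
        rw [mem_factorizations] at ht
        rw [Finset.mem_filter, mem_factorizations, List.ofFn_succ, List.prod_cons]; simpa using ht
      · intro u hu
        rw [Finset.mem_filter] at hu
        rw [← hu.2, Fin.cons_self_tail]
      · intro t _; simp
      · intro u hu
        rw [(Finset.mem_filter.1 hu).2]
    · symm
      refine Finset.sum_bij (fun u _ => Fin.cons (FreeMonoid.of a * u 0) (Fin.tail u)) ?_ ?_ ?_ ?_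
      · intro u hu
        rw [mem_factorizations, List.ofFn_succ, List.prod_cons] at hu
        rw [Finset.mem_filter, mem_factorizations, List.ofFn_succ, List.prod_cons]
        refine ⟨by simpa [mul_assoc, Fin.tail] using hu, fun h1 => ?_⟩
        have := congrArg FreeMonoid.length h1
        simp at this
      · intro u _ v _ huv
        have h0 := congrFun huv 0
        have h1 := congrArg Fin.tail huv
        simp only [Fin.cons_zero, Fin.tail_cons] at h0 h1
        rw [← Fin.cons_self_tail u, ← Fin.cons_self_tail v, h1, mul_left_cancel h0]
      · intro u hu
        rw [Finset.mem_filter, mem_factorizations, List.ofFn_succ, List.prod_cons] at hu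
        obtain ⟨hu, hne⟩ := hu
        obtain ⟨u0, hu0⟩ : ∃ u0, u 0 = FreeMonoid.of a * u0 := by
          generalize u 0 = z at hu hne
          cases z using FreeMonoid.casesOn with
          | one => exact absurd rfl hne
          | of_mul b z =>
            refine ⟨z, ?_⟩
            have := congrArg FreeMonoid.toList hu
            simp only [FreeMonoid.toList_mul, FreeMonoid.toList_of, List.cons_append, List.nil_append,
              List.cons.injEq] at this
            rw [this.1]
        refine ⟨Fin.cons u0 (Fin.tail u), ?_, ?_⟩
        · rw [mem_factorizations, List.ofFn_succ, List.prod_cons]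
          rw [hu0, mul_assoc] at hu
          exact mul_left_cancel hu
        · simp [← hu0]
      · intro u _; simp

theorem polySum_eq_pSum {A M : Type*} [Monoid M] {d : ℕ} (μ : FreeMonoid A →* M)
    (π : (Fin (d + 1) → M) → ℤ) (w : FreeMonoid A) : polySum μ π w = pSum μ d π w := by
  induction d generalizing w with
  | zero =>
    unfold polySum
    simp only [pSum]
    rw [Finset.sum_eq_single (fun _ => w)]
    · intro u hu hne
      refine absurd ?_ hne
      rw [mem_factorizations] at hu
      funext i
      rw [Fin.fin_one_eq_zero i]
      simpa [List.ofFn_succ] using hu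
    · intro h
      exact absurd (mem_factorizations.2 (by simp [List.ofFn_succ])) h
  | succ d ih =>
    have h := sum_factorizations_succ (d + 1)
      (fun u t => π (Fin.cons (μ u) (fun i => μ (t i)))) w
    simp only [pSum, ← ih]
    unfold polySum
    rw [← h]
    refine Finset.sum_congr rfl fun u _ => ?_
    congr 1
    funext i
    refine Fin.cases ?_ (fun i => ?_) i <;> simp [Fin.tail]

/-! ### The spaces of polyregular functions with a given morphism -/

/-- The Cauchy product of `h ∘ μ` and `g`. -/
def conv {A M R : Type*} [Monoid M] [CommSemiring R] (μ : FreeMonoid A →* M) (h : M → R)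
    (g : FreeMonoid A → R) (w : FreeMonoid A) : R :=
  splitSum (fun u v => h (μ u) * g v) w

/-- The functions that are polyregular of degree at most `d` with the morphism `μ`. -/
def polySpace {A M : Type*} (R : Type*) [Monoid M] [CommSemiring R] (μ : FreeMonoid A →* M) :
    ℕ → Submodule R (FreeMonoid A → R)
  | 0 => Submodule.span R {f | ∃ h : M → R, f = fun w => h (μ w)}
  | d + 1 => polySpace R μ d ⊔
      Submodule.span R {f | ∃ h : M → R, ∃ g ∈ polySpace R μ d, f = conv μ h g}

section PolySpace

variable {A M R : Type*} [Monoid M] [CommSemiring R] {μ : FreeMonoid A →* M}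

theorem comp_mem_polySpace (h : M → R) : (fun w => h (μ w)) ∈ polySpace R μ 0 :=
  Submodule.subset_span ⟨h, rfl⟩

theorem polySpace_le_succ (d : ℕ) : polySpace R μ d ≤ polySpace R μ (d + 1) := le_sup_left

theorem polySpace_mono : Monotone (polySpace R μ) := monotone_nat_of_le_succ polySpace_le_succ

theorem conv_mem_polySpace (h : M → R) {d : ℕ} {g : FreeMonoid A → R} (hg : g ∈ polySpace R μ d) :
    conv μ h g ∈ polySpace R μ (d + 1) :=
  Submodule.mem_sup_right (Submodule.subset_span ⟨h, g, hg, rfl⟩)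

/-- Induction on the members of `polySpace`. -/
theorem polySpace_induction {P : ℕ → (FreeMonoid A → R) → Prop}
    (zero : ∀ d, P d 0) (add : ∀ d f g, P d f → P d g → P d (f + g))
    (smul : ∀ d (c : R) f, P d f → P d (c • f)) (base : ∀ h : M → R, P 0 fun w => h (μ w))
    (step : ∀ d f, P d f → f ∈ polySpace R μ d → P (d + 1) f)
    (hconv : ∀ d (h : M → R) g, (∀ f ∈ polySpace R μ d, P d f) → g ∈ polySpace R μ d →
      P (d + 1) (conv μ h g)) :
    ∀ d, ∀ f ∈ polySpace R μ d, P d f := by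
  intro d
  induction d with
  | zero =>
    intro f hf
    refine Submodule.span_induction ?_ (zero 0) (fun f g _ _ => add 0 f g)
      (fun c f _ => smul 0 c f) hf
    rintro _ ⟨h, rfl⟩
    exact base h
  | succ d ih =>
    intro f hf
    obtain ⟨f1, hf1, f2, hf2, rfl⟩ := Submodule.mem_sup.1 hf
    refine add _ _ _ (step d f1 (ih f1 hf1) hf1) ?_
    refine Submodule.span_induction ?_ (zero _) (fun f g _ _ => add _ f g)
      (fun c f _ => smul _ c f) hf2
    rintro _ ⟨h, g, hg, rfl⟩
    exact hconv d h g ih hg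

theorem pSum_mem_polySpace [Finite M] (d : ℕ) (π : (Fin (d + 1) → M) → R) :
    pSum μ d π ∈ polySpace R μ d := by
  classical
  cases nonempty_fintype M
  induction d with
  | zero => exact Submodule.subset_span ⟨fun m => π fun _ => m, rfl⟩
  | succ d ih =>
    have : pSum μ (d + 1) π = ∑ m : M, conv μ (Pi.single m 1)
        (pSum μ d fun t => π (Fin.cons m t)) := by
      funext w
      rw [Finset.sum_apply]
      simp only [conv, pSum]
      rw [← splitSum_sum]
      refine splitSum_congr fun u v _ => ?_
      rw [Finset.sum_eq_single (μ u)]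
      · simp
      · intro m _ hm; simp [hm.symm]
      · simp
    rw [this]
    exact Submodule.sum_mem _ fun m _ => conv_mem_polySpace _ (ih _)

theorem conv_of_mul (h : M → R) (g : FreeMonoid A → R) (a : A) (w : FreeMonoid A) :
    conv μ h g (FreeMonoid.of a * w) =
      h 1 * g (FreeMonoid.of a * w) + conv μ (fun m => h (μ (FreeMonoid.of a) * m)) g w := by
  simp only [conv, splitSum_of_mul, map_one, map_mul]

/-- The splittings of `u * w` that cut inside `u` contribute only translates of `g`, hence a
remainder of lower degree. If `h` is invariant under multiplication by `μ u`, the difference of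
`conv μ h g` along `u` thus drops a degree. -/
theorem conv_translate (h : M → R) (d : ℕ) (g : FreeMonoid A → R)
    (hg : ∀ u, (fun w => g (u * w)) ∈ polySpace R μ d) (u : FreeMonoid A) :
    ∃ r ∈ polySpace R μ d, ∀ w,
      conv μ h g (u * w) = conv μ (fun m => h (μ u * m)) g w + r w := by
  induction u using FreeMonoid.inductionOn' generalizing h with
  | one => exact ⟨0, zero_mem _, fun w => by simp⟩
  | of_mul a u ih =>
    obtain ⟨r, hr, hr'⟩ := ih (fun m => h (μ (FreeMonoid.of a) * m))
    refine ⟨(h 1 • fun w => g (FreeMonoid.of a * u * w)) + r,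
      add_mem (Submodule.smul_mem _ _ (hg _)) hr, fun w => ?_⟩
    rw [mul_assoc, conv_of_mul, hr']
    simp only [map_mul, mul_assoc, Pi.add_apply, Pi.smul_apply, smul_eq_mul]
    ring

theorem translate_mem_polySpace {d : ℕ} {f : FreeMonoid A → R} (hf : f ∈ polySpace R μ d)
    (u : FreeMonoid A) : (fun w => f (u * w)) ∈ polySpace R μ d := by
  refine polySpace_induction (μ := μ)
    (P := fun d f => ∀ u, (fun w => f (u * w)) ∈ polySpace R μ d) ?_ ?_ ?_ ?_ ?_ ?_ d f hf u
  · exact fun d u => zero_mem _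
  · exact fun d f g hf hg u => add_mem (hf u) (hg u)
  · exact fun d c f hf u => Submodule.smul_mem _ c (hf u)
  · intro h u
    simp only [map_mul]
    exact comp_mem_polySpace fun m => h (μ u * m)
  · exact fun d f hf _ u => polySpace_le_succ d (hf u)
  · intro d h g ih hg u
    obtain ⟨r, hr, hr'⟩ := conv_translate (μ := μ) h d g (ih g hg) u
    rw [show (fun w => conv μ h g (u * w)) = conv μ (fun m => h (μ u * m)) g + r from funext hr']
    exact add_mem (conv_mem_polySpace _ hg) (polySpace_le_succ d hr)

/-! ### Pumping in polyregular functions -/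

theorem sum_choose_range (y j : ℕ) : ∑ i ∈ Finset.range y, i.choose j = y.choose (j + 1) := by
  induction y with
  | zero => simp
  | succ y ih => rw [Finset.sum_range_succ, ih, Nat.choose_succ_succ, add_comm]

theorem pow_add_mul_eq {m : M} {n ω : ℕ} (h : m ^ (n + ω) = m ^ n) (y : ℕ) :
    m ^ (n + ω * y) = m ^ n := by
  induction y with
  | zero => simp
  | succ y ih => rw [mul_add, mul_one, add_comm (ω * y), ← add_assoc, pow_add, h, ← pow_add, ih]

/-- Pumping a factor whose image has index `n` and period `ω`. -/
theorem exists_pump (u : FreeMonoid A) {n ω : ℕ} (hu : μ u ^ (n + ω) = μ u ^ n) (d : ℕ)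
    (f : FreeMonoid A → R) (hf : f ∈ polySpace R μ d) :
    ∃ g : ℕ → FreeMonoid A → R, (∀ j, g j ∈ polySpace R μ d) ∧ (∀ j, d < j → g j = 0) ∧
      ∀ y w, f (u ^ (n * (d + 1) + ω * y) * w) =
        ∑ j ∈ Finset.range (d + 1), (y.choose j : R) * g j w := by
  refine polySpace_induction (μ := μ) (P := fun d f => ∃ g : ℕ → FreeMonoid A → R,
    (∀ j, g j ∈ polySpace R μ d) ∧ (∀ j, d < j → g j = 0) ∧
      ∀ y w, f (u ^ (n * (d + 1) + ω * y) * w) =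
        ∑ j ∈ Finset.range (d + 1), (y.choose j : R) * g j w) ?_ ?_ ?_ ?_ ?_ ?_ d f hf
  · exact fun d => ⟨fun _ => 0, fun _ => zero_mem _, fun _ _ => rfl, fun y w => by simp⟩
  · rintro d f1 f2 ⟨g1, h1, h1', h1''⟩ ⟨g2, h2, h2', h2''⟩
    refine ⟨g1 + g2, fun j => add_mem (h1 j) (h2 j), fun j hj => ?_, fun y w => ?_⟩
    · simp [h1' j hj, h2' j hj]
    · simp only [Pi.add_apply, h1'', h2'']
      simp only [mul_add, Finset.sum_add_distrib]
  · rintro d c f ⟨g, h, h', h''⟩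
    refine ⟨fun j => c • g j, fun j => Submodule.smul_mem _ _ (h j), fun j hj => ?_, fun y w => ?_⟩
    · simp [h' j hj]
    · simp only [Pi.smul_apply, smul_eq_mul, h'', Finset.mul_sum]
      exact Finset.sum_congr rfl fun _ _ => by ring
  · intro h
    refine ⟨fun j => if j = 0 then fun w => h (μ u ^ n * μ w) else 0, fun j => ?_,
      fun j hj => by simp [hj.ne'], fun y w => ?_⟩
    · dsimp only
      split_ifs
      · exact comp_mem_polySpace fun m => h (μ u ^ n * m)
      · exact zero_mem _
    · simp [pow_add_mul_eq hu]
  · rintro d f ⟨g, h, h', h''⟩ hf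
    refine ⟨fun j w => g j (u ^ n * w), fun j => polySpace_le_succ d
      (translate_mem_polySpace (h j) _), fun j hj => ?_, fun y w => ?_⟩
    · funext w; simp [h' j (by omega)]
    · rw [Finset.sum_range_succ]
      simp only [h' (d + 1) (by omega), Pi.zero_apply, mul_zero, add_zero]
      rw [← h'', ← mul_assoc, ← pow_add]
      congr 3
      ring
  · intro d h g ih hg
    have hg' := fun u => translate_mem_polySpace hg u
    -- A first block `u ^ n` is spent to replace `h` by `h1`, which is invariant under `μ (u ^ ω)`.
    -- One such block for each degree accounts for the offset `n * (d + 1)`.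
    obtain ⟨r, hr, hr'⟩ := conv_translate (μ := μ) h d g hg' (u ^ n)
    set h1 : M → R := fun m => h (μ (u ^ n) * m) with hh1
    obtain ⟨q, hq, hq'⟩ := conv_translate (μ := μ) h1 d g hg' (u ^ ω)
    have hper : (fun m => h1 (μ (u ^ ω) * m)) = h1 := by
      funext m
      simp only [hh1]
      rw [← mul_assoc, map_pow, map_pow, ← pow_add, hu]
    rw [hper] at hq'
    -- Telescoping over `y` blocks `u ^ ω` leaves a sum of values of `q`, which has lower degree. By
    -- induction these are combinations of `i.choose j`, and summing over `i < y` raises `j` to `j +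
    -- 1`.
    have hiter : ∀ y w, conv μ h1 g (u ^ (ω * y) * w) =
        conv μ h1 g w + ∑ i ∈ Finset.range y, q (u ^ (ω * i) * w) := by
      intro y w
      induction y with
      | zero => simp
      | succ y ihy =>
        rw [mul_add, mul_one, add_comm (ω * y), pow_add, mul_assoc, hq', ihy,
          Finset.sum_range_succ, add_assoc]
    obtain ⟨gr, hgr, hgr0, hgr'⟩ := ih r hr
    obtain ⟨gq, hgq, hgq0, hgq'⟩ := ih q hq
    refine ⟨fun j => gr j + if j = 0 then fun w => conv μ h1 g (u ^ (n * (d + 1)) * w)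
      else gq (j - 1), fun j => ?_, fun j hj => ?_, fun y w => ?_⟩
    · refine add_mem (polySpace_le_succ d (hgr j)) ?_
      split_ifs
      · exact translate_mem_polySpace (conv_mem_polySpace h1 hg) _
      · exact polySpace_le_succ d (hgq _)
    · simp only [hgr0 j (by omega), if_neg (show j ≠ 0 by omega), hgq0 (j - 1) (by omega), add_zero]
    · rw [show u ^ (n * (d + 1 + 1) + ω * y) * w =
        u ^ n * (u ^ (n * (d + 1) + ω * y) * w) by
          rw [← mul_assoc, ← pow_add]; congr 2; ring, hr']
      rw [show u ^ (n * (d + 1) + ω * y) * w = u ^ (ω * y) * (u ^ (n * (d + 1)) * w) by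
        rw [← mul_assoc, ← pow_add]; congr 2; ring, hiter]
      have e1 : ∀ i, u ^ (ω * i) * (u ^ (n * (d + 1)) * w) = u ^ (n * (d + 1) + ω * i) * w :=
        fun i => by rw [← mul_assoc, ← pow_add]; congr 2; ring
      simp only [e1, hgr', hgq']
      rw [Finset.sum_comm]
      simp only [← Finset.sum_mul, ← Nat.cast_sum, sum_choose_range]
      rw [Finset.sum_range_succ' _ (d + 1)]
      simp only [Pi.add_apply, if_true, Nat.add_eq_zero_iff, one_ne_zero, and_false, if_false,
        mul_add, Finset.sum_add_distrib, Nat.add_sub_cancel]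
      rw [Finset.sum_range_succ' (fun j => (y.choose j : R) * gr j w) d]
      have : gr (d + 1) = 0 := hgr0 _ (by omega)
      rw [Finset.sum_range_succ (fun j => (y.choose (j + 1) : R) * gr (j + 1) w) d, this]
      simp
      ring

/-- In a finite monoid the powers of every element become periodic. -/
theorem pow_card_add_factorial [Finite M] (m : M) {n : ℕ} (hn : Nat.card M ≤ n) :
    m ^ (n + (Nat.card M).factorial) = m ^ n := by
  cases nonempty_fintype M
  obtain ⟨i, hi, j, hj, hij, h⟩ := Finset.exists_ne_map_eq_of_card_lt_of_maps_to
    (s := Finset.range (Nat.card M + 1)) (t := Finset.univ) (f := fun i => m ^ i)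
    (by simp [Nat.card_eq_fintype_card]) (fun _ _ => Finset.mem_coe.2 (Finset.mem_univ _))
  wlog hlt : i < j generalizing i j
  · exact this j hj i hi hij.symm h.symm (by omega)
  rw [Finset.mem_range] at hi hj
  have key : m ^ (n + (j - i)) = m ^ n := by
    rw [show n + (j - i) = (n - i) + j by omega, pow_add, ← h, ← pow_add]
    congr 1; omega
  obtain ⟨k, hk⟩ := Nat.dvd_factorial (show 0 < j - i by omega) (show j - i ≤ Nat.card M by omega)
  rw [hk, pow_add_mul_eq key]

end PolySpace

/-! ### Functions vanishing on short words -/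

/-- The subspaces `V j` of members vanishing on words shorter than `j` decrease strictly until the
first repetition. From then on the chain is constant, so its members vanish everywhere. Thus it
reaches zero after at most `finrank F W` steps. -/
theorem Submodule.eq_zero_of_short_words {A F : Type*} [Field F]
    (W : Submodule F (FreeMonoid A → F)) [FiniteDimensional F W]
    (hW : ∀ f ∈ W, ∀ a, (fun w => f (FreeMonoid.of a * w)) ∈ W) {f : FreeMonoid A → F}
    (hf : f ∈ W) (h : ∀ w : FreeMonoid A, w.length < Module.finrank F W → f w = 0) : f = 0 := by
  let V : ℕ → Submodule F (FreeMonoid A → F) := fun j =>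
    { carrier := {f | f ∈ W ∧ ∀ w : FreeMonoid A, w.length < j → f w = 0}
      add_mem' := fun {f g} hf hg => ⟨add_mem hf.1 hg.1, fun w hw => by
        simp [hf.2 w hw, hg.2 w hw]⟩
      zero_mem' := ⟨zero_mem _, fun _ _ => rfl⟩
      smul_mem' := fun c f hf => ⟨Submodule.smul_mem _ c hf.1, fun w hw => by simp [hf.2 w hw]⟩ }
  have hmem : ∀ j f, f ∈ V j ↔ f ∈ W ∧ ∀ w : FreeMonoid A, w.length < j → f w = 0 :=
    fun _ _ => Iff.rfl
  have hVW : ∀ j, V j ≤ W := fun j f hf => hf.1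
  have hfin : ∀ j, FiniteDimensional F (V j) := fun j => Submodule.finiteDimensional_of_le (hVW j)
  have hanti : ∀ j, V (j + 1) ≤ V j := fun j f hf => ⟨hf.1, fun w hw => hf.2 w (by omega)⟩
  -- Translation by a letter maps `V (j + 1)` into `V j`, which by assumption gains one more length
  -- of vanishing.
  have hstep : ∀ j, V j = V (j + 1) → V (j + 1) = V (j + 2) := by
    intro j hj
    refine le_antisymm (fun f hf => ⟨hf.1, ?_⟩) (hanti _)
    intro w hw
    cases w using FreeMonoid.casesOn with
    | one => exact hf.2 1 (by simp)
    | of_mul a w =>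
      have : (fun w => f (FreeMonoid.of a * w)) ∈ V j := ⟨hW f hf.1 a, fun v hv => hf.2 _ (by
        simpa [add_comm] using hv)⟩
      rw [hj] at this
      exact this.2 w (by simp at hw; omega)
  have hstab : ∀ j, V j = V (j + 1) → ∀ i, V (j + i) = V j := by
    intro j hj i
    have : ∀ i, V (j + i) = V (j + i + 1) := by
      intro i
      induction i with
      | zero => exact hj
      | succ i ih => exact hstep _ ih
    induction i with
    | zero => rfl
    | succ i ih => rw [← add_assoc, ← this, ih]
  have hbot : ∀ j, V j = V (j + 1) → V j = ⊥ := by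
    intro j hj
    rw [Submodule.eq_bot_iff]
    intro g hg
    funext w
    rw [← hstab j hj (w.length + 1)] at hg
    exact hg.2 w (by omega)
  have hdim : ∀ j, Module.finrank F (V j) + j ≤ Module.finrank F W ∨ V j = ⊥ := by
    intro j
    induction j with
    | zero => exact Or.inl (Submodule.finrank_mono (hVW 0))
    | succ j ih =>
      by_cases hj : V j = V (j + 1)
      · exact Or.inr (hj ▸ hbot j hj)
      · rcases ih with ih | ih
        · left
          have := Submodule.finrank_lt_finrank_of_lt (lt_of_le_of_ne (hanti j) (Ne.symm hj))
          omega
        · exact Or.inr (le_bot_iff.1 (ih ▸ hanti j))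
  have hfV : f ∈ V (Module.finrank F W) := ⟨hf, h⟩
  have : V (Module.finrank F W) = ⊥ := by
    rcases hdim (Module.finrank F W) with h0 | h0
    · exact Submodule.finrank_eq_zero.1 (by omega)
    · exact h0
  rw [this] at hfV
  exact (Submodule.mem_bot F).1 hfV

/-- Indicators of the elements of `M` suffice as left factors. Each degree keeps the old generators
and adds one for every pair of an element of `M` and an old generator, whence the factor `Nat.card M
+ 1`. -/
theorem exists_finset_span_polySpace {A M F : Type*} [Monoid M] [Finite M] [Field F]
    (μ : FreeMonoid A →* M) (d : ℕ) : ∃ S : Finset (FreeMonoid A → F),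
      S.card ≤ Nat.card M * (Nat.card M + 1) ^ d ∧ polySpace F μ d ≤ Submodule.span F S := by
  classical
  cases nonempty_fintype M
  rw [Nat.card_eq_fintype_card]
  induction d with
  | zero =>
    refine ⟨Finset.univ.image fun m w => (Pi.single m 1 : M → F) (μ w), ?_, ?_⟩
    · simpa using Finset.card_image_le (s := Finset.univ) (f := fun (m : M) (w : FreeMonoid A) =>
        (Pi.single m 1 : M → F) (μ w))
    · refine Submodule.span_le.2 ?_
      rintro _ ⟨h, rfl⟩
      have : (fun w => h (μ w)) = ∑ m : M, h m • fun w => (Pi.single m 1 : M → F) (μ w) := by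
        funext w
        simp [Finset.sum_apply, Pi.single_apply]
      rw [this]
      exact Submodule.sum_mem _ fun m _ => Submodule.smul_mem _ _ (Submodule.subset_span (by simp))
  | succ d ih =>
    obtain ⟨S, hS, hS'⟩ := ih
    refine ⟨S ∪ (Finset.univ ×ˢ S).image fun p : M × (FreeMonoid A → F) =>
      conv μ (Pi.single p.1 1) p.2, ?_, ?_⟩
    · refine (Finset.card_union_le _ _).trans ?_
      have h1 := Finset.card_image_le (s := Finset.univ ×ˢ S)
        (f := fun p : M × (FreeMonoid A → F) => conv μ (Pi.single p.1 1) p.2)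
      rw [Finset.card_product, Finset.card_univ] at h1
      calc _ ≤ S.card + Fintype.card M * S.card := by omega
        _ = (Fintype.card M + 1) * S.card := by ring
        _ ≤ (Fintype.card M + 1) * (Fintype.card M * (Fintype.card M + 1) ^ d) := by gcongr
        _ = _ := by ring
    · refine sup_le (hS'.trans (Submodule.span_mono (by simp))) (Submodule.span_le.2 ?_)
      rintro _ ⟨h, g, hg, rfl⟩
      refine Submodule.span_induction (p := fun g _ => conv μ h g ∈ _) ?_ ?_ ?_ ?_ (hS' hg)
      · intro g hg
        have : conv μ h g = ∑ m : M, h m • conv μ (Pi.single m 1) g := by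
          funext w
          simp only [Finset.sum_apply, Pi.smul_apply, smul_eq_mul, conv]
          simp only [← splitSum_mul_left]
          rw [← splitSum_sum]
          refine splitSum_congr fun u v _ => ?_
          simp [Pi.single_apply]
        rw [this]
        refine Submodule.sum_mem _ fun m _ => Submodule.smul_mem _ _ (Submodule.subset_span ?_)
        simp only [Finset.coe_union, Finset.coe_image]
        exact Or.inr ⟨(m, g), by simpa using hg, rfl⟩
      · have : conv μ h (0 : FreeMonoid A → F) = 0 := by
          funext w
          simp only [conv, Pi.zero_apply, mul_zero, splitSum_zero]
        rw [this]
        exact zero_mem _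
      · intro f g _ _ hf hg
        have : conv μ h (f + g) = conv μ h f + conv μ h g := by
          funext w
          simp only [conv, Pi.add_apply, mul_add, splitSum_add]
        rw [this]
        exact add_mem hf hg
      · intro c f _ hf
        have : conv μ h (c • f) = c • conv μ h f := by
          funext w
          simp only [conv, Pi.smul_apply, smul_eq_mul, ← splitSum_mul_left]
          exact splitSum_congr fun u v _ => by ring
        rw [this]
        exact Submodule.smul_mem _ _ hf

theorem finiteDimensional_polySpace {A M F : Type*} [Monoid M] [Finite M] [Field F]
    (μ : FreeMonoid A →* M) (d : ℕ) : FiniteDimensional F (polySpace F μ d) := by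
  obtain ⟨S, -, hS⟩ := exists_finset_span_polySpace (F := F) μ d
  have := FiniteDimensional.span_finset F S
  exact Submodule.finiteDimensional_of_le hS

theorem finrank_polySpace_le {A M F : Type*} [Monoid M] [Finite M] [Field F]
    (μ : FreeMonoid A →* M) (d : ℕ) :
    Module.finrank F (polySpace F μ d) ≤ Nat.card M * (Nat.card M + 1) ^ d := by
  obtain ⟨S, hS, hS'⟩ := exists_finset_span_polySpace (F := F) μ d
  have := FiniteDimensional.span_finset F S
  exact (Submodule.finrank_mono hS').trans ((finrank_span_finset_le_card S).trans hS)

/-- Two polyregular functions that agree on short words are equal. -/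
theorem eq_of_short_words {A M M' F : Type*} [Monoid M] [Finite M] [Monoid M'] [Finite M']
    [Field F] {μ : FreeMonoid A →* M} {μ' : FreeMonoid A →* M'} {d d' : ℕ}
    {f f' : FreeMonoid A → F} (hf : f ∈ polySpace F μ d) (hf' : f' ∈ polySpace F μ' d')
    (h : ∀ w : FreeMonoid A, w.length <
      Nat.card M * (Nat.card M + 1) ^ d + Nat.card M' * (Nat.card M' + 1) ^ d' → f w = f' w) :
    f = f' := by
  have := finiteDimensional_polySpace (F := F) μ d
  have := finiteDimensional_polySpace (F := F) μ' d'
  rw [← sub_eq_zero]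
  refine Submodule.eq_zero_of_short_words (polySpace F μ d ⊔ polySpace F μ' d') ?_
    (sub_mem (Submodule.mem_sup_left hf) (Submodule.mem_sup_right hf')) ?_
  · intro g hg a
    obtain ⟨g1, h1, g2, h2, rfl⟩ := Submodule.mem_sup.1 hg
    exact add_mem (Submodule.mem_sup_left (translate_mem_polySpace h1 _))
      (Submodule.mem_sup_right (translate_mem_polySpace h2 _))
  · intro w hw
    rw [Pi.sub_apply, sub_eq_zero]
    refine h w (hw.trans_le ?_)
    exact (Submodule.finrank_add_le_finrank_add_finrank _ _).trans
      (add_le_add (finrank_polySpace_le μ d) (finrank_polySpace_le μ' d'))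

/-- A polyregular function that vanishes on short words is zero. -/
theorem eq_zero_of_short_words {A M F : Type*} [Monoid M] [Finite M] [Field F]
    {μ : FreeMonoid A →* M} {d : ℕ} {f : FreeMonoid A → F} (hf : f ∈ polySpace F μ d)
    (h : ∀ w : FreeMonoid A, w.length < Nat.card M * (Nat.card M + 1) ^ d → f w = 0) : f = 0 := by
  have := finiteDimensional_polySpace (F := F) μ d
  exact Submodule.eq_zero_of_short_words _ (fun g hg a => translate_mem_polySpace hg _) hf
    fun w hw => h w (hw.trans_le (finrank_polySpace_le μ d))

/-! ### Star-free functions are ultimately polynomial -/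

theorem cast_choose_eq_prod (y j : ℕ) :
    (y.choose j : ℚ) = (∏ i ∈ Finset.range j, ((y : ℚ) - i)) / (j.factorial : ℚ) := by
  have h1 := descPochhammer_eval_eq_descFactorial ℚ y j
  rw [descPochhammer_eval_eq_prod_range, Nat.descFactorial_eq_factorial_mul_choose] at h1
  rw [h1]
  have := Nat.factorial_ne_zero j
  push_cast
  field_simp

theorem PumpingPattern.eval_succ {A : Type*} {p : ℕ} (q : PumpingPattern A (p + 1))
    (x : Fin (p + 1) → ℕ) :
    q.eval x = q.α 0 * (q.u 0 ^ x 0 *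
      (PumpingPattern.mk (fun i => q.α i.succ) (fun i => q.u i.succ)).eval (fun i => x i.succ)) := by
  simp only [PumpingPattern.eval, List.ofFn_succ, List.prod_cons, mul_assoc, Fin.succ_zero_eq_one]

/-- On a polyregular function with an aperiodic monoid, pumping is polynomial. -/
theorem exists_polynomial_of_aperiodic {A M : Type*} [Monoid M] {μ : FreeMonoid A →* M} {n d : ℕ}
    (hM : ∀ m : M, m ^ (n + 1) = m ^ n) (p : ℕ) (f : FreeMonoid A → ℚ)
    (hf : f ∈ polySpace ℚ μ d) (q : PumpingPattern A p) :
    ∃ P : MvPolynomial (Fin p) ℚ, (∀ i, P.degreeOf i ≤ d) ∧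
      ∀ x : Fin p → ℕ, (∀ i, n * (d + 1) ≤ x i) →
        f (q.eval x) = MvPolynomial.eval (fun i => (x i : ℚ)) P := by
  induction p generalizing f with
  | zero => exact ⟨MvPolynomial.C (f (q.α 0)), fun i => i.elim0, fun x _ => by
      simp [PumpingPattern.eval]⟩
  | succ p ih =>
    obtain ⟨g, hg, -, hg'⟩ := exists_pump (q.u 0) (n := n) (ω := 1) (hM _) d _
      (translate_mem_polySpace hf (q.α 0))
    choose P hP hP' using fun j => ih (g j) (hg j) ⟨fun i => q.α i.succ, fun i => q.u i.succ⟩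
    -- `B j` is the binomial of `X 0 - n * (d + 1)` over `j`, since `exists_pump` counts the blocks
    -- beyond the offset. The degree bound in each variable is recorded because the interpolation on
    -- a grid depends on it.
    let B : ℕ → MvPolynomial (Fin (p + 1)) ℚ := fun j => MvPolynomial.C (1 / (j.factorial : ℚ)) *
      ∏ i ∈ Finset.range j, (MvPolynomial.X 0 - MvPolynomial.C (((n * (d + 1) + i : ℕ) : ℚ)))
    have hB : ∀ j i, (B j).degreeOf i ≤ if i = 0 then j else 0 := by
      intro j i
      refine (MvPolynomial.degreeOf_mul_le _ _ _).trans ?_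
      rw [MvPolynomial.degreeOf_C, zero_add]
      refine (MvPolynomial.degreeOf_prod_le _ _ _).trans ?_
      refine (Finset.sum_le_card_nsmul _ _ (if i = 0 then 1 else 0) fun l _ => ?_).trans ?_
      · refine (MvPolynomial.degreeOf_sub_le _ _ _).trans ?_
        rw [MvPolynomial.degreeOf_C, MvPolynomial.degreeOf_X]
        simp
      · simp
    refine ⟨∑ j ∈ Finset.range (d + 1), B j * MvPolynomial.rename Fin.succ (P j), fun i => ?_,
      fun x hx => ?_⟩
    · refine (MvPolynomial.degreeOf_sum_le _ _ _).trans (Finset.sup_le fun j hj => ?_)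
      refine (MvPolynomial.degreeOf_mul_le _ _ _).trans ?_
      have h1 := hB j i
      rw [Finset.mem_range] at hj
      induction i using Fin.cases with
      | zero =>
        have : (MvPolynomial.rename Fin.succ (P j)).degreeOf (0 : Fin (p + 1)) = 0 := by
          rw [MvPolynomial.degreeOf_eq_sup, ← Nat.le_zero]
          refine Finset.sup_le fun m hm => Nat.le_zero.2 ?_
          obtain ⟨u, rfl, -⟩ := MvPolynomial.coeff_rename_ne_zero _ _ _ (MvPolynomial.mem_support_iff.1 hm)
          rw [Finsupp.mapDomain_of_notMem_range]
          simp
        simp only [if_true] at h1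
        omega
      | succ i =>
        rw [if_neg (Fin.succ_ne_zero i)] at h1
        rw [MvPolynomial.degreeOf_rename_of_injective (Fin.succ_injective p)]
        have := hP j i
        omega
    · obtain ⟨y, hy⟩ := Nat.exists_eq_add_of_le (hx 0)
      rw [q.eval_succ, hy]
      have := hg' y (PumpingPattern.eval ⟨fun i => q.α i.succ, fun i => q.u i.succ⟩
        fun i => x i.succ)
      rw [one_mul] at this
      rw [this, map_sum]
      refine Finset.sum_congr rfl fun j _ => ?_
      rw [map_mul, MvPolynomial.eval_rename, hP' j _ (fun i => hx i.succ)]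
      congr 1
      rw [cast_choose_eq_prod]
      simp only [B, map_mul, map_prod, map_sub, MvPolynomial.eval_C, MvPolynomial.eval_X, hy]
      rw [div_eq_mul_inv, mul_comm, one_div]
      congr 1
      refine Finset.prod_congr rfl fun i _ => ?_
      push_cast
      ring

theorem exists_aperiodic_index {M : Type*} [Monoid M] [Finite M] (hM : IsAperiodic M) :
    ∃ n, ∀ m : M, m ^ (n + 1) = m ^ n := by
  cases nonempty_fintype M
  choose n hn using hM
  refine ⟨Finset.univ.sup n, fun m => ?_⟩
  obtain ⟨k, hk⟩ := Nat.exists_eq_add_of_le (Finset.le_sup (f := n) (Finset.mem_univ m))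
  rw [hk, add_right_comm, pow_add, hn, ← pow_add]

theorem cast_polySum_mem_polySpace {A M : Type*} [Monoid M] [Finite M] {d : ℕ}
    (μ : FreeMonoid A →* M) (π : (Fin (d + 1) → M) → ℤ) :
    (fun w => (polySum μ π w : ℚ)) ∈ polySpace ℚ μ d := by
  have : (fun w => (polySum μ π w : ℚ)) = pSum μ d fun m => (π m : ℚ) := by
    funext w
    rw [polySum_eq_pSum]
    exact map_pSum (Int.castRingHom ℚ) μ d π w
  rw [this]
  exact pSum_mem_polySpace d _

theorem IsZSF.isUltimatelyPolynomial {A : Type*} {f : FreeMonoid A → ℤ} (hf : IsZSF f) :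
    IsUltimatelyPolynomial f := by
  obtain ⟨d, M, _, _, μ, π, hM, rfl⟩ := hf
  obtain ⟨n, hn⟩ := exists_aperiodic_index hM
  refine ⟨n * (d + 1), fun p q => ?_⟩
  obtain ⟨P, -, hP⟩ := exists_polynomial_of_aperiodic hn p _ (cast_polySum_mem_polySpace μ π) q
  exact ⟨P, hP⟩

/-! ### Finite differences -/

theorem fwdDiff_iter_eq_zero_of_le {G : Type*} [AddCommGroup G] {h : ℕ → G} {T D : ℕ}
    (hh : ∀ x, T ≤ x → (fwdDiff 1)^[D] h x = 0) {k : ℕ} (hk : D ≤ k) :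
    ∀ x, T ≤ x → (fwdDiff 1)^[k] h x = 0 := by
  obtain ⟨i, rfl⟩ := Nat.exists_eq_add_of_le' hk
  clear hk
  induction i with
  | zero => simpa using hh
  | succ i ih =>
    intro x hx
    rw [add_right_comm, Function.iterate_succ_apply', fwdDiff, ih x hx, ih (x + 1) (by omega),
      sub_zero]

/-- Newton's forward formula at `T`. The ranges `x + 1` and `D` are interchangeable: beyond the
first the binomials vanish, beyond the second the differences do. -/
theorem eq_sum_choose_fwdDiff {h : ℕ → ℚ} {T D : ℕ}
    (hh : ∀ x, T ≤ x → (fwdDiff 1)^[D] h x = 0) (x : ℕ) :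
    h (T + x) = ∑ k ∈ Finset.range D, (x.choose k : ℚ) * (fwdDiff 1)^[k] h T := by
  have h1 := shift_eq_sum_fwdDiff_iter 1 h x T
  rw [smul_eq_mul, mul_one] at h1
  rw [h1]
  simp only [nsmul_eq_mul]
  rw [Finset.sum_subset (Finset.range_subset_range.2 (le_max_left (x + 1) D)),
    Finset.sum_subset (Finset.range_subset_range.2 (le_max_right (x + 1) D))]
  · intro k _ hk
    rw [fwdDiff_iter_eq_zero_of_le hh (by simpa using hk) T le_rfl, mul_zero]
  · intro k _ hk
    rw [Nat.choose_eq_zero_of_lt (by simp at hk; omega), Nat.cast_zero, zero_mul]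

/-! ### Binomial and Newton polynomials -/

/-- The polynomial `X (X - 1) ⋯ (X - j + 1) / j!`. -/
noncomputable def binomialPoly (j : ℕ) : Polynomial ℚ :=
  Polynomial.C (1 / (j.factorial : ℚ)) *
    ∏ i ∈ Finset.range j, (Polynomial.X - Polynomial.C (i : ℚ))

theorem eval_binomialPoly (j y : ℕ) : (binomialPoly j).eval (y : ℚ) = y.choose j := by
  rw [cast_choose_eq_prod, binomialPoly]
  simp only [Polynomial.eval_mul, Polynomial.eval_C, Polynomial.eval_prod, Polynomial.eval_sub,
    Polynomial.eval_X]
  ring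

theorem natDegree_binomialPoly_le (j : ℕ) : (binomialPoly j).natDegree ≤ j := by
  refine (Polynomial.natDegree_C_mul_le _ _).trans ?_
  rw [Polynomial.natDegree_prod_of_monic _ _ fun i _ => Polynomial.monic_X_sub_C _]
  simp only [Polynomial.natDegree_X_sub_C, Finset.sum_const, Finset.card_range, smul_eq_mul,
    mul_one, le_refl]

/-- The polynomial `∑_{j ≤ d} γ_j (X choose j)`. -/
noncomputable def newtonPoly (d : ℕ) (γ : ℕ → ℚ) : Polynomial ℚ :=
  ∑ j ∈ Finset.range (d + 1), Polynomial.C (γ j) * binomialPoly j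

theorem eval_newtonPoly (d : ℕ) (γ : ℕ → ℚ) (y : ℚ) : (newtonPoly d γ).eval y =
    ∑ j ∈ Finset.range (d + 1), γ j * (binomialPoly j).eval y := by
  simp [newtonPoly, Polynomial.eval_finsetSum]

theorem natDegree_newtonPoly_le (d : ℕ) (γ : ℕ → ℚ) : (newtonPoly d γ).natDegree ≤ d := by
  refine Polynomial.natDegree_sum_le_of_forall_le _ _ fun j hj => ?_
  refine (Polynomial.natDegree_C_mul_le _ _).trans ((natDegree_binomialPoly_le j).trans ?_)
  rw [Finset.mem_range] at hj
  omega

theorem Polynomial.eq_of_eval_nat {p q : Polynomial ℚ} (N : ℕ)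
    (h : ∀ y : ℕ, N ≤ y → p.eval (y : ℚ) = q.eval (y : ℚ)) : p = q := by
  refine Polynomial.eq_of_infinite_eval_eq p q ?_
  refine Set.Infinite.mono (s := (fun y : ℕ => (y : ℚ)) '' Set.Ici N) ?_ ?_
  · rintro _ ⟨y, hy, rfl⟩
    exact h y hy
  · exact (Set.Ici_infinite N).image Nat.cast_injective.injOn

/-- A sequence that is polynomial of degree at most `d` on residue classes and ultimately
polynomial is annihilated by the `(d + 1)`-th difference. -/
theorem fwdDiff_iter_eq_zero_of_quasiPolynomial {h : ℕ → ℚ} {T ω d N : ℕ} (hω : 0 < ω)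
    (h1 : ∀ x, ∃ γ : ℕ → ℚ, ∀ y, h (T + x + ω * y) =
      ∑ j ∈ Finset.range (d + 1), (y.choose j : ℚ) * γ j)
    {p : Polynomial ℚ} (h2 : ∀ x, N ≤ x → h x = p.eval (x : ℚ)) :
    ∀ x, T ≤ x → (fwdDiff 1)^[d + 1] h x = 0 := by
  have hω' : (ω : ℚ) ≠ 0 := by exact_mod_cast hω.ne'
  have key : ∀ x, p.natDegree ≤ d ∧ h (T + x) = p.eval ((T + x : ℕ) : ℚ) := by
    intro x
    obtain ⟨γ, hγ⟩ := h1 x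
    -- Both sides agree at all large `y` in the residue class of `T + x`, hence identically.
    -- Comparing degrees bounds the degree of `p`; evaluating at `y = 0` shows that `p` is already
    -- correct at `T + x`, although it was given only from `N` on.
    have hp : p.comp (Polynomial.C (ω : ℚ) * Polynomial.X + Polynomial.C ((T + x : ℕ) : ℚ)) =
        newtonPoly d γ := by
      refine Polynomial.eq_of_eval_nat N fun y hy => ?_
      have h3 := h2 (T + x + ω * y) (by nlinarith)
      rw [hγ] at h3
      rw [eval_newtonPoly]
      simp only [eval_binomialPoly, Polynomial.eval_comp, Polynomial.eval_add, Polynomial.eval_mul,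
        Polynomial.eval_C, Polynomial.eval_X]
      rw [show (ω : ℚ) * y + ((T + x : ℕ) : ℚ) = ((T + x + ω * y : ℕ) : ℚ) by push_cast; ring, ← h3]
      exact Finset.sum_congr rfl fun _ _ => mul_comm _ _
    constructor
    · have h4 := congrArg Polynomial.natDegree hp
      rw [Polynomial.natDegree_comp, Polynomial.natDegree_linear hω', mul_one] at h4
      exact h4 ▸ natDegree_newtonPoly_le d γ
    · have h5 := congrArg (Polynomial.eval 0) hp
      have h6 := hγ 0
      rw [eval_newtonPoly] at h5
      simp only [← Nat.cast_zero (R := ℚ), eval_binomialPoly] at h5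
      simp only [Polynomial.eval_comp, Polynomial.eval_add, Polynomial.eval_mul,
        Polynomial.eval_C, Polynomial.eval_X, Nat.cast_zero, mul_zero, zero_add] at h5
      rw [mul_zero, add_zero] at h6
      rw [h6, h5]
      exact Finset.sum_congr rfl fun _ _ => mul_comm _ _
  intro x hx
  obtain ⟨x, rfl⟩ := Nat.exists_eq_add_of_le hx
  rw [fwdDiff_iter_eq_sum_shift]
  have h7 := congrFun (Polynomial.fwdDiff_iter_eq_zero_of_degree_lt (P := p) (n := d + 1)
    (Nat.lt_succ_of_le (key 0).1)) ((T + x : ℕ) : ℚ)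
  rw [fwdDiff_iter_eq_sum_shift] at h7
  rw [Pi.zero_apply] at h7
  rw [← h7]
  refine Finset.sum_congr rfl fun k _ => ?_
  have := (key (x + k)).2
  rw [← add_assoc] at this
  simp only [smul_eq_mul, mul_one, nsmul_eq_mul] at this ⊢
  rw [this]
  push_cast
  rfl

/-! ### Sequences with nonnegative differences -/

/-- All iterated differences of `g` are nonnegative from `m` on. -/
def IsAbsMonotone (m : ℕ) (g : ℕ → ℚ) : Prop := ∀ i x, m ≤ x → 0 ≤ (fwdDiff 1)^[i] g x

theorem IsAbsMonotone.fwdDiff {m : ℕ} {g : ℕ → ℚ} (hg : IsAbsMonotone m g) :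
    IsAbsMonotone m (fwdDiff 1 g) := fun i x hx => by
  rw [← Function.iterate_succ_apply]
  exact hg (i + 1) x hx

/-- In the discrete Leibniz rule `Δ(fg) = Δf * g + f * Δg + Δf * Δg` all three terms are products of
the same kind, so induction on the order of the difference applies. -/
theorem IsAbsMonotone.mul {m : ℕ} {f g : ℕ → ℚ} (hf : IsAbsMonotone m f) (hg : IsAbsMonotone m g) :
    IsAbsMonotone m (f * g) := by
  intro i
  induction i generalizing f g with
  | zero => exact fun x hx => mul_nonneg (hf 0 x hx) (hg 0 x hx)
  | succ i ih =>
    intro x hx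
    rw [Function.iterate_succ_apply]
    have : _root_.fwdDiff 1 (f * g) = _root_.fwdDiff 1 f * g + f * _root_.fwdDiff 1 g +
        _root_.fwdDiff 1 f * _root_.fwdDiff 1 g := fwdDiff_smul 1 f g
    rw [this, fwdDiff_iter_add, fwdDiff_iter_add]
    exact add_nonneg (add_nonneg (ih hf.fwdDiff hg x hx) (ih hf hg.fwdDiff x hx))
      (ih hf.fwdDiff hg.fwdDiff x hx)

theorem isAbsMonotone_linear {m : ℕ} {a b : ℚ} (ha : 0 ≤ a) (hb : 0 ≤ a * m + b) :
    IsAbsMonotone m (fun x => a * x + b) := by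
  have h1 : fwdDiff 1 (fun x : ℕ => a * x + b) = fun _ => a := by
    funext x
    simp [fwdDiff]
    ring
  have h2 : ∀ i, (fwdDiff 1)^[i] (fun _ : ℕ => (0 : ℚ)) = fun _ => 0 := by
    intro i
    induction i with
    | zero => rfl
    | succ i ih => rw [Function.iterate_succ_apply', ih, fwdDiff_const]
  intro i x hx
  match i with
  | 0 =>
    have : (m : ℚ) ≤ x := by exact_mod_cast hx
    simp only [Function.iterate_zero, id]
    nlinarith
  | 1 => simpa [h1] using ha
  | i + 2 => rw [Function.iterate_succ_apply, Function.iterate_succ_apply, h1, fwdDiff_const, h2]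

/-- The binomial is a positive constant times the factors `x / ω - i` with `i < j ≤ d`. Each has
positive slope and is nonnegative at `ω * d`. This is where the margin `ω * d` in the base point
comes from. -/
theorem isAbsMonotone_binomialPoly {ω d j : ℕ} (hω : 0 < ω) (hj : j ≤ d) :
    IsAbsMonotone (ω * d) (fun x => (binomialPoly j).eval ((x : ℚ) / ω)) := by
  have hω' : (0 : ℚ) < ω := by exact_mod_cast hω
  have h1 : ∀ l ≤ j, IsAbsMonotone (ω * d)
      (∏ i ∈ Finset.range l, fun x : ℕ => (1 / (ω : ℚ)) * x + -(i : ℚ)) := by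
    intro l
    induction l with
    | zero =>
      intro _
      have := isAbsMonotone_linear (m := ω * d) (a := 0) (b := 1) le_rfl (by norm_num)
      simpa [Pi.one_def] using this
    | succ l ih =>
      intro hl
      rw [Finset.prod_range_succ]
      refine (ih (by omega)).mul (isAbsMonotone_linear (by positivity) ?_)
      have : (l : ℚ) ≤ d := by exact_mod_cast (by omega : l ≤ d)
      push_cast
      rw [← mul_assoc, one_div_mul_cancel hω'.ne']
      linarith
  have h2 := (isAbsMonotone_linear (m := ω * d) (a := 0) (b := 1 / (j.factorial : ℚ)) le_rfl
    (by simp)).mul (h1 j le_rfl)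
  refine cast ?_ h2
  congr 1
  funext x
  simp only [binomialPoly, Polynomial.eval_mul, Polynomial.eval_C, Polynomial.eval_prod,
    Polynomial.eval_sub, Polynomial.eval_X, Pi.mul_apply, Finset.prod_apply]
  simp only [zero_mul, zero_add]
  congr 1
  refine Finset.prod_congr rfl fun i _ => ?_
  ring

/-- If `h` is polynomial from `T` on, then its differences at a large point `N` are nonnegative
combinations of the coefficients of its Newton expansion with step `ω`. -/
theorem exists_nonneg_coefficients {T ω d N : ℕ} (hω : 0 < ω) (hN : T + ω * d ≤ N) (i : ℕ) :
    ∃ κ : ℕ → ℚ, (∀ j ≤ d, 0 ≤ κ j) ∧ ∀ (h : ℕ → ℚ) (γ : ℕ → ℚ) (D : ℕ),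
      (∀ x, T ≤ x → (fwdDiff 1)^[D] h x = 0) →
      (∀ y, h (T + ω * y) = ∑ j ∈ Finset.range (d + 1), (y.choose j : ℚ) * γ j) →
      (fwdDiff 1)^[i] h N = ∑ j ∈ Finset.range (d + 1), κ j * γ j := by
  have hω' : (ω : ℚ) ≠ 0 := by exact_mod_cast hω.ne'
  refine ⟨fun j => (fwdDiff 1)^[i] (fun x : ℕ => (binomialPoly j).eval ((x : ℚ) / ω)) (N - T),
    fun j hj => isAbsMonotone_binomialPoly hω hj i _ (by omega), fun h γ D h1 h2 => ?_⟩
  -- The Newton expansions at `T` with steps `1` and `ω` describe the same polynomial up to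
  -- rescaling the variable, as they agree at the points `ω * y`. The guard `k < D` makes the term
  -- left by `D - 1` vanish when `D = 0`.
  have hpoly : newtonPoly (D - 1) (fun k => if k < D then (fwdDiff 1)^[k] h T else 0) =
      (newtonPoly d γ).comp (Polynomial.C (1 / (ω : ℚ)) * Polynomial.X) := by
    have : ((newtonPoly (D - 1) (fun k => if k < D then (fwdDiff 1)^[k] h T else 0)).comp
        (Polynomial.C (ω : ℚ) * Polynomial.X)) = newtonPoly d γ := by
      refine Polynomial.eq_of_eval_nat 0 fun y _ => ?_
      rw [Polynomial.eval_comp]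
      simp only [Polynomial.eval_mul, Polynomial.eval_C, Polynomial.eval_X]
      rw [eval_newtonPoly, eval_newtonPoly, ← Nat.cast_mul]
      simp only [eval_binomialPoly]
      have h3 := eq_sum_choose_fwdDiff h1 (ω * y)
      rw [h2] at h3
      rw [Finset.sum_congr rfl fun j _ => mul_comm (γ j) _, h3]
      rcases Nat.eq_zero_or_pos D with rfl | hD
      · simp
      · rw [Nat.sub_add_cancel hD]
        refine Finset.sum_congr rfl fun k hk => ?_
        rw [if_pos (Finset.mem_range.1 hk), mul_comm]
    rw [← this, Polynomial.comp_assoc]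
    conv_lhs => rw [← Polynomial.comp_X (p := newtonPoly _ _)]
    congr 1
    rw [Polynomial.mul_comp, Polynomial.C_comp, Polynomial.X_comp, ← mul_assoc, ← Polynomial.C_mul,
      mul_one_div_cancel hω', Polynomial.C_1, one_mul]
  have hval : (fun x => h (x + T)) = ∑ j ∈ Finset.range (d + 1),
      γ j • fun x : ℕ => (binomialPoly j).eval ((x : ℚ) / ω) := by
    funext x
    have h4 := congrArg (Polynomial.eval (x : ℚ)) hpoly
    rw [Polynomial.eval_comp] at h4
    simp only [Polynomial.eval_mul, Polynomial.eval_C, Polynomial.eval_X] at h4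
    rw [eval_newtonPoly, eval_newtonPoly] at h4
    simp only [eval_binomialPoly] at h4
    rw [add_comm x T, eq_sum_choose_fwdDiff h1 x, Finset.sum_apply]
    simp only [Pi.smul_apply, smul_eq_mul]
    rw [div_eq_mul_one_div, mul_comm (x : ℚ), ← h4]
    rcases Nat.eq_zero_or_pos D with rfl | hD
    · simp
    · rw [Nat.sub_add_cancel hD]
      refine Finset.sum_congr rfl fun k hk => ?_
      rw [if_pos (Finset.mem_range.1 hk), mul_comm]
  have h5 := fwdDiff_iter_comp_add 1 h T i (N - T)
  rw [Nat.sub_add_cancel (by omega)] at h5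
  rw [← h5, hval, fwdDiff_iter_finsetSum, Finset.sum_apply]
  refine Finset.sum_congr rfl fun j _ => ?_
  rw [fwdDiff_iter_const_smul, Pi.smul_apply, smul_eq_mul, mul_comm]

/-! ### Nonnegativity of the coefficients of commutative `ℕ`-polyregular functions -/

theorem IsCommutative.eq_of_perm {A X : Type*} {f : FreeMonoid A → X} (hf : IsCommutative f)
    {u v : FreeMonoid A} (h : u.toList.Perm v.toList) : f u = f v := hf u v h

/-- In this form commutativity says that left translations commute on `f`. -/
theorem IsCommutative.mul_left_comm {A X : Type*} {f : FreeMonoid A → X} (hf : IsCommutative f)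
    (u v w : FreeMonoid A) : f (u * (v * w)) = f (v * (u * w)) := by
  refine hf.eq_of_perm ?_
  simp only [FreeMonoid.toList_mul, ← List.append_assoc]
  exact List.perm_append_comm.append_right _

/-- The sequence `x ↦ f (a ^ x * w)`. -/
def pumpSeq {A X : Type*} (f : FreeMonoid A → X) (a w : FreeMonoid A) (x : ℕ) : X := f (a ^ x * w)

/-- Pumping a letter is polynomial of degree less than `D` from `T` on. -/
def LetterPolynomial {A : Type*} (T D : ℕ) (f : FreeMonoid A → ℤ) : Prop :=
  ∀ a w x, T ≤ x → (fwdDiff 1)^[D] (pumpSeq f (FreeMonoid.of a) w) x = 0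

/-- The operator `T_a ^ r` for `r < N` and `T_a ^ N * (T_a - 1) ^ (r - N)` for `r ≥ N`, where
`T_a` is the translation by the letter `a`. -/
def coefOp {A : Type*} (N : ℕ) (a : A) (r : ℕ) (f : FreeMonoid A → ℤ) (w : FreeMonoid A) : ℤ :=
  if r < N then f (FreeMonoid.of a ^ r * w)
  else (fwdDiff 1)^[r - N] (pumpSeq f (FreeMonoid.of a) w) N

/-- The functions to which the coefficient operators will be applied. -/
structure IsTame {A M : Type*} [Monoid M] (μ : FreeMonoid A →* M) (d T D : ℕ)
    (f : FreeMonoid A → ℤ) : Prop where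
  comm : IsCommutative f
  cone : ∃ g ∈ polySpace ℚ≥0 μ d, ∀ w, (f w : ℚ) = g w
  poly : LetterPolynomial T D f

theorem cast_fwdDiff_iter (h : ℕ → ℤ) (i x : ℕ) :
    (((fwdDiff 1)^[i] h x : ℤ) : ℚ) = (fwdDiff 1)^[i] (fun x => (h x : ℚ)) x := by
  rw [fwdDiff_iter_eq_sum_shift, fwdDiff_iter_eq_sum_shift]
  push_cast
  simp

/-- Differences do not preserve a cone in general. Here they do because pumping `a` is polynomial
from `T` on and `N` is large enough for `exists_nonneg_coefficients`. Keeping all three properties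
of `IsTame` allows the next letter to be treated in the same way. -/
theorem isTame_coefOp {A M : Type*} [Monoid M] {μ : FreeMonoid A →* M} {d T D n ω N : ℕ}
    (hω : 0 < ω) (hM : ∀ m : M, m ^ (n + ω) = m ^ n) (hT : n * (d + 1) = T) (hN : T + ω * d ≤ N)
    {f : FreeMonoid A → ℤ} (hf : IsTame μ d T D f) (a : A) (r : ℕ) :
    IsTame μ d T D (coefOp N a r f) := by
  obtain ⟨g, hg, hfg⟩ := hf.cone
  by_cases hr : r < N
  · have : coefOp N a r f = fun w => f (FreeMonoid.of a ^ r * w) := by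
      funext w; rw [coefOp, if_pos hr]
    rw [this]
    refine ⟨fun u v huv => ?_, ⟨_, translate_mem_polySpace hg _, fun w => hfg _⟩,
      fun b w x hx => ?_⟩
    · refine hf.comm.eq_of_perm ?_
      simp only [FreeMonoid.toList_mul]
      exact huv.append_left _
    · have : pumpSeq (fun w => f (FreeMonoid.of a ^ r * w)) (FreeMonoid.of b) w =
          pumpSeq f (FreeMonoid.of b) (FreeMonoid.of a ^ r * w) := by
        funext y; exact hf.comm.mul_left_comm _ _ _
      rw [this]
      exact hf.poly b _ x hx
  · have : coefOp N a r f =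
        fun w => (fwdDiff 1)^[r - N] (pumpSeq f (FreeMonoid.of a) w) N := by
      funext w; rw [coefOp, if_neg hr]
    rw [this]
    refine ⟨fun u v huv => ?_, ?_, fun b w x hx => ?_⟩
    · have : pumpSeq f (FreeMonoid.of a) u = pumpSeq f (FreeMonoid.of a) v := by
        funext x
        refine hf.comm.eq_of_perm ?_
        simp only [FreeMonoid.toList_mul]
        exact huv.append_left _
      simp only [this]
    · obtain ⟨κ, hκ, hκ'⟩ := exists_nonneg_coefficients hω hN (r - N)
      obtain ⟨γ, hγ, -, hγ'⟩ := exists_pump (FreeMonoid.of a) (hM _) d g hg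
      refine ⟨∑ j ∈ Finset.range (d + 1), (κ j).toNNRat • γ j,
        Submodule.sum_mem _ fun j _ => Submodule.smul_mem _ _ (hγ j), fun w => ?_⟩
      rw [cast_fwdDiff_iter, hκ' _ (fun j => (γ j w : ℚ)) D, Finset.sum_apply, NNRat.cast_sum]
      · refine Finset.sum_congr rfl fun j hj => ?_
        rw [Finset.mem_range] at hj
        simp [Rat.coe_toNNRat _ (hκ j (by omega))]
      · intro x hx
        rw [← cast_fwdDiff_iter, hf.poly a w x hx, Int.cast_zero]
      · intro y
        rw [pumpSeq, hfg, ← hT, hγ', NNRat.cast_sum]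
        exact Finset.sum_congr rfl fun j _ => by simp
    -- Expanding the difference in `a` gives a signed sum of translates. Pumping `b` commutes with
    -- each translation, so every summand is annihilated by the `D`-th difference in `b`.
    · have : pumpSeq (fun w => (fwdDiff 1)^[r - N] (pumpSeq f (FreeMonoid.of a) w) N)
          (FreeMonoid.of b) w = ∑ k ∈ Finset.range (r - N + 1),
            ((-1 : ℤ) ^ (r - N - k) * ((r - N).choose k)) •
              pumpSeq f (FreeMonoid.of b) (FreeMonoid.of a ^ (N + k • 1) * w) := by
        funext y
        rw [Finset.sum_apply]
        simp only [pumpSeq, fwdDiff_iter_eq_sum_shift, Pi.smul_apply]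
        refine Finset.sum_congr rfl fun k _ => ?_
        rw [hf.comm.mul_left_comm]
      rw [this, fwdDiff_iter_finsetSum, Finset.sum_apply]
      refine Finset.sum_eq_zero fun k _ => ?_
      rw [fwdDiff_iter_const_smul, Pi.smul_apply, hf.poly b _ x hx, smul_zero]

/-- The function `x ↦ [x = r]` for `r < N`, and `x ↦ (x - N choose r - N)` for `r ≥ N`. -/
def basisFun (N : ℕ) : ℕ → ℕ → ℕ
  | r, 0 => if r = 0 then 1 else 0
  | r, x + 1 => (if N ≤ r then basisFun N r x else 0) +
      (if r = 0 then 0 else basisFun N (r - 1) x)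

/-- The expansion of a sequence by its first `N` values followed by Newton's formula at `N`. Only
the terms with `r < N + D` survive. -/
theorem sum_basisFun_coefOp {A : Type*} {N D : ℕ} (a : A) (x : ℕ) (f : FreeMonoid A → ℤ)
    (hf : LetterPolynomial N D f) (w : FreeMonoid A) :
    f (FreeMonoid.of a ^ x * w) =
      ∑ r ∈ Finset.range (N + D), (basisFun N r x : ℤ) * coefOp N a r f w := by
  have hzero : ∀ f : FreeMonoid A → ℤ, LetterPolynomial N D f → ∀ r, N + D ≤ r → ∀ w,
      coefOp N a r f w = 0 := by
    intro f hf r hr w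
    rw [coefOp, if_neg (by omega)]
    exact fwdDiff_iter_eq_zero_of_le (fun x hx => hf a w x hx) (by omega) N le_rfl
  -- Quantifying over all sequences lets the induction on `x` pass to the shifted sequence.
  suffices h : ∀ (s : ℕ → ℤ), (∀ y, N ≤ y → (fwdDiff 1)^[D] s y = 0) → s x =
      ∑ r ∈ Finset.range (N + D), (basisFun N r x : ℤ) *
        (if r < N then s r else (fwdDiff 1)^[r - N] s N) from
    h (pumpSeq f (FreeMonoid.of a) w) (hf a w)
  clear hzero hf f w
  induction x with
  | zero =>
    intro s hs
    rcases Nat.eq_zero_or_pos (N + D) with h0 | h0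
    · obtain ⟨rfl, rfl⟩ : N = 0 ∧ D = 0 := by omega
      simpa using hs 0 le_rfl
    · rw [Finset.sum_eq_single_of_mem 0 (Finset.mem_range.2 h0) fun r _ hr => by
        simp [basisFun, hr]]
      simp only [basisFun, if_true, Nat.cast_one, one_mul]
      split_ifs with hN
      · rfl
      · obtain rfl : N = 0 := by omega
        rfl
  | succ x ih =>
    intro s hs
    have hs' : ∀ y, N ≤ y → (fwdDiff 1)^[D] (fun x => s (x + 1)) y = 0 := fun y hy => by
      rw [fwdDiff_iter_comp_add]; exact hs _ (by omega)
    have e := ih (fun x => s (x + 1)) hs'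
    rw [e]
    obtain ⟨c, hc⟩ : ∃ c : ℕ → ℤ, c = fun r => if r < N then s r else (fwdDiff 1)^[r - N] s N :=
      ⟨_, rfl⟩
    have hc' : ∀ r, (if r < N then s r else (fwdDiff 1)^[r - N] s N) = c r := fun r => by rw [hc]
    have hc0 : c (N + D) = 0 := by
      simp only [hc, if_neg (show ¬ N + D < N by omega), Nat.add_sub_cancel_left]
      exact hs N le_rfl
    -- The shift acts on the coefficients by `c (r + 1)`, plus `c r` in the Newton range, because
    -- there it is `1 + Δ`. The recursion of `basisFun` is the transpose of this action.
    have hc1 : ∀ r, (if r < N then s (r + 1) else (fwdDiff 1)^[r - N] (fun x => s (x + 1)) N) =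
        c (r + 1) + if N ≤ r then c r else 0 := by
      intro r
      simp only [hc]
      by_cases hr : r < N
      · rw [if_pos hr, if_neg (by omega : ¬ N ≤ r), add_zero]
        split_ifs with h1
        · rfl
        · obtain rfl : N = r + 1 := by omega
          simp
      · rw [if_neg hr, if_neg (by omega), if_pos (by omega), if_neg hr, fwdDiff_iter_comp_add,
          show r + 1 - N = (r - N) + 1 by omega, Function.iterate_succ_apply', fwdDiff]
        ring
    have h2 : ∑ r ∈ Finset.range (N + D), ((if r = 0 then 0 else basisFun N (r - 1) x : ℕ) : ℤ) * c r
        = ∑ r ∈ Finset.range (N + D), (basisFun N r x : ℤ) * c (r + 1) := by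
      have h3 := Finset.sum_range_succ' (fun r =>
        ((if r = 0 then 0 else basisFun N (r - 1) x : ℕ) : ℤ) * c r) (N + D)
      rw [Finset.sum_range_succ, hc0] at h3
      simpa using h3
    simp only [hc1, hc', basisFun, Nat.cast_add, add_mul, mul_add, Finset.sum_add_distrib, h2]
    rw [add_comm]
    congr 1
    refine Finset.sum_congr rfl fun r _ => ?_
    split_ifs <;> simp

/-- The product of the basis functions `s a` of the number of letters `a`, for `a ∈ S`. -/
def basisProd {A : Type*} [DecidableEq A] (N : ℕ) (S : Finset A) (s : A → ℕ) (w : FreeMonoid A) :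
    ℕ :=
  ∏ a ∈ S, basisFun N (s a) (w.toList.count a)

/-- One letter is eliminated at a time: `f` is expanded in the number of letters `a`, and its
coefficients, again tame, are treated on the remaining alphabet. -/
theorem exists_eq_combination_basisProd {A M : Type*} [DecidableEq A] [Monoid M]
    {μ : FreeMonoid A →* M} {d T D n ω N : ℕ}
    (hω : 0 < ω) (hM : ∀ m : M, m ^ (n + ω) = m ^ n) (hT : n * (d + 1) = T) (hN : T + ω * d ≤ N)
    (S : Finset A) (f : FreeMonoid A → ℤ) (hf : IsTame μ d T D f) :
    ∃ G ∈ Submodule.span ℕ (Set.range (basisProd N S)),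
      ∀ w : FreeMonoid A, (∀ a ∈ w.toList, a ∈ S) → f w = (G w : ℤ) := by
  induction S using Finset.induction_on generalizing f with
  | empty =>
    obtain ⟨g, -, hfg⟩ := hf.cone
    -- With no letter left only the empty word matters. Membership in the cone makes this final
    -- coefficient nonnegative, and it is an integer because `coefOp` has integer values.
    have h0 : 0 ≤ f 1 := by
      have : (0 : ℚ) ≤ f 1 := by rw [hfg]; exact NNRat.cast_nonneg _
      exact_mod_cast this
    refine ⟨(f 1).toNat • basisProd N ∅ fun _ => 0,
      Submodule.smul_mem _ _ (Submodule.subset_span ⟨_, rfl⟩), fun w hw => ?_⟩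
    have hw1 : w = 1 := by
      have : w.toList = [] := List.eq_nil_iff_forall_not_mem.2 fun a ha => by simpa using hw a ha
      exact this
    rw [hw1]
    simp [basisProd, h0]
  | insert a S ha ih =>
    choose G hG hG' using fun r => ih (coefOp N a r f) (isTame_coefOp hω hM hT hN hf a r)
    refine ⟨∑ r ∈ Finset.range (N + D), fun w => basisFun N r (w.toList.count a) * G r w,
      Submodule.sum_mem _ fun r _ => ?_, fun w hw => ?_⟩
    · refine Submodule.span_induction (p := fun G _ =>
        (fun w => basisFun N r (w.toList.count a) * G w) ∈
          Submodule.span ℕ (Set.range (basisProd N (insert a S)))) ?_ ?_ ?_ ?_ (hG r)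
      · rintro _ ⟨s, rfl⟩
        refine Submodule.subset_span ⟨Function.update s a r, ?_⟩
        funext w
        rw [basisProd, Finset.prod_insert ha, Function.update_self, basisProd]
        congr 1
        refine Finset.prod_congr rfl fun b hb => ?_
        rw [Function.update_of_ne (by rintro rfl; exact ha hb)]
      · simp only [Pi.zero_apply, mul_zero]
        exact zero_mem _
      · intro g h _ _ hg hh
        simp only [Pi.add_apply, mul_add]
        exact add_mem hg hh
      · intro c g _ hg
        have := Submodule.smul_mem _ c hg
        refine cast ?_ this
        congr 1
        funext w
        simp only [Pi.smul_apply, smul_eq_mul]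
        ring
    · set w' : FreeMonoid A := FreeMonoid.ofList (w.toList.filter (· ≠ a)) with hw'
      have hcount : ∀ b ∈ S, w'.toList.count b = w.toList.count b := by
        intro b hb
        rw [hw', FreeMonoid.toList_ofList]
        refine List.count_filter ?_
        have : b ≠ a := by rintro rfl; exact ha hb
        simpa using this
      -- The functions for `S` do not see the letter `a`, so deleting its occurrences does not
      -- affect them.
      have hGw : ∀ G ∈ Submodule.span ℕ (Set.range (basisProd N S)), G w' = G w := by
        intro G hG
        refine Submodule.span_induction ?_ rfl ?_ ?_ hG
        · rintro _ ⟨s, rfl⟩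
          exact Finset.prod_congr rfl fun b hb => by rw [hcount b hb]
        · intro g h _ _ hg hh
          simp [hg, hh]
        · intro c g _ hg
          simp [hg]
      have hperm : f w = f (FreeMonoid.of a ^ w.toList.count a * w') := by
        refine hf.comm.eq_of_perm ?_
        have e1 : (FreeMonoid.of a ^ w.toList.count a).toList =
            w.toList.filter (· = a) := by
          rw [List.filter_eq]
          generalize w.toList.count a = x
          induction x with
          | zero => rfl
          | succ x ihx => rw [pow_succ', FreeMonoid.toList_of_mul, ihx, List.replicate_succ]
        rw [FreeMonoid.toList_mul, e1, hw', FreeMonoid.toList_ofList]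
        have := (List.filter_append_perm (fun b => decide (b = a)) w.toList).symm
        simpa using this
      have hpoly : LetterPolynomial N D f := fun b w x hx => hf.poly b w x (by omega)
      rw [hperm, sum_basisFun_coefOp a _ f hpoly w', Finset.sum_apply, Nat.cast_sum]
      refine Finset.sum_congr rfl fun r _ => ?_
      rw [hG' r w', hGw _ (hG r), Nat.cast_mul]
      intro b hb
      rw [hw', FreeMonoid.toList_ofList, List.mem_filter] at hb
      have := hw b hb.1
      rw [Finset.mem_insert] at this
      refine this.resolve_left ?_
      simpa using hb.2

/-! ### The products of basis functions are star-free -/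

/-- The monoid `{0, 1, 2}` with the addition truncated at `2`, written multiplicatively. -/
inductive TruncatedCount : Type
  | zero
  | one
  | two

namespace TruncatedCount

instance : Finite TruncatedCount :=
  Finite.of_surjective (fun i : Fin 3 => match i with | 0 => zero | 1 => one | 2 => two) fun x => by
    cases x
    · exact ⟨0, rfl⟩
    · exact ⟨1, rfl⟩
    · exact ⟨2, rfl⟩

instance : Monoid TruncatedCount where
  one := zero
  mul
    | zero, x => x
    | x, zero => x
    | _, _ => two
  one_mul x := rfl
  mul_one x := by cases x <;> rfl
  mul_assoc x y z := by cases x <;> cases y <;> cases z <;> rfl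

theorem pow_three (x : TruncatedCount) : x ^ (2 + 1) = x ^ 2 := by
  rw [pow_succ, pow_two]
  cases x <;> rfl

theorem mul_eq_one_iff (x y : TruncatedCount) : x * y = 1 ↔ x = 1 ∧ y = 1 := by
  change x * y = zero ↔ x = zero ∧ y = zero
  cases x <;> cases y <;> simp [HMul.hMul, Mul.mul]

theorem one_mul_eq_one_iff (x : TruncatedCount) : one * x = one ↔ x = 1 := by
  change one * x = one ↔ x = zero
  cases x <;> simp [HMul.hMul, Mul.mul]

theorem one_mul_ne (x : TruncatedCount) : one * x ≠ 1 := by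
  change one * x ≠ zero
  cases x <;> simp [HMul.hMul, Mul.mul]

end TruncatedCount

/-- The morphism that counts every letter up to `2`. -/
noncomputable def truncatedCounts {A ι : Type*} [DecidableEq ι] (e : A ≃ ι) :
    FreeMonoid A →* (ι → TruncatedCount) :=
  FreeMonoid.lift fun a => Pi.mulSingle (e a) TruncatedCount.one

section TruncatedCounts

variable {A ι : Type*} [DecidableEq ι] (e : A ≃ ι)

theorem truncatedCounts_of (a : A) :
    truncatedCounts e (FreeMonoid.of a) = Pi.mulSingle (e a) TruncatedCount.one := by
  simp [truncatedCounts]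

theorem mulSingle_mul_apply_self (i : ι) (m : ι → TruncatedCount) :
    ((Pi.mulSingle i TruncatedCount.one : ι → TruncatedCount) * m) i =
      TruncatedCount.one * m i := by
  simp

theorem truncatedCounts_eq_one {u : FreeMonoid A} (h : truncatedCounts e u = 1) : u = 1 := by
  cases u using FreeMonoid.casesOn with
  | one => rfl
  | of_mul a u =>
    rw [map_mul, truncatedCounts_of] at h
    have := congrFun h (e a)
    rw [mulSingle_mul_apply_self] at this
    exact absurd this (TruncatedCount.one_mul_ne _)

/-- Truncation at `2` suffices for this: the image of a single letter is recognised exactly, as a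
second letter always changes it. -/
theorem mulSingle_mul_eq_mulSingle_iff (i j : ι) (m : ι → TruncatedCount) :
    (Pi.mulSingle i TruncatedCount.one : ι → TruncatedCount) * m =
      Pi.mulSingle j TruncatedCount.one ↔ i = j ∧ m = 1 := by
  constructor
  · intro h
    have hij : i = j := by
      by_contra hij
      have := congrFun h i
      rw [mulSingle_mul_apply_self, Pi.mulSingle_eq_of_ne hij] at this
      exact TruncatedCount.one_mul_ne _ this
    subst hij
    refine ⟨rfl, funext fun l => ?_⟩
    have := congrFun h l
    by_cases hl : l = i
    · subst hl
      rw [mulSingle_mul_apply_self, Pi.mulSingle_eq_same, TruncatedCount.one_mul_eq_one_iff] at this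
      exact this
    · rw [Pi.mul_apply, Pi.mulSingle_eq_of_ne hl, one_mul] at this
      exact this
  · rintro ⟨rfl, rfl⟩
    rw [mul_one]

theorem basisProd_one [Fintype A] [DecidableEq A] (N : ℕ) (s : A → ℕ) :
    basisProd N Finset.univ s 1 = if s = 0 then 1 else 0 := by
  unfold basisProd
  simp only [FreeMonoid.toList_one, List.count_nil, basisFun, Finset.prod_boole]
  simp [funext_iff]

/-- Only the factor of the letter `b` changes, and it follows the Pascal recursion of `basisFun`. -/
theorem basisProd_of_mul [Fintype A] [DecidableEq A] (N : ℕ) (s : A → ℕ) (b : A)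
    (w : FreeMonoid A) :
    basisProd N Finset.univ s (FreeMonoid.of b * w) =
      (if N ≤ s b then basisProd N Finset.univ s w else 0) +
        (if s b = 0 then 0 else basisProd N Finset.univ (Function.update s b (s b - 1)) w) := by
  have h1 : ∀ s : A → ℕ, ∀ w, basisProd N Finset.univ s w = basisFun N (s b) (w.toList.count b) *
      ∏ a ∈ Finset.univ.erase b, basisFun N (s a) (w.toList.count a) := fun s w =>
    (Finset.mul_prod_erase _ _ (Finset.mem_univ b)).symm
  have h2 : ∏ a ∈ Finset.univ.erase b, basisFun N (s a) ((FreeMonoid.of b * w).toList.count a) =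
      ∏ a ∈ Finset.univ.erase b, basisFun N (s a) (w.toList.count a) := by
    refine Finset.prod_congr rfl fun a ha => ?_
    rw [FreeMonoid.toList_of_mul, List.count_cons_of_ne (Finset.ne_of_mem_erase ha).symm]
  have h3 : ∏ a ∈ Finset.univ.erase b,
      basisFun N (Function.update s b (s b - 1) a) (w.toList.count a) =
      ∏ a ∈ Finset.univ.erase b, basisFun N (s a) (w.toList.count a) := by
    refine Finset.prod_congr rfl fun a ha => ?_
    rw [Function.update_of_ne (Finset.ne_of_mem_erase ha)]
  rw [h1 s, h1 s, h1 (Function.update _ _ _), h2, h3, Function.update_self,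
    FreeMonoid.toList_of_mul, List.count_cons_self]
  rw [basisFun, add_mul, ite_mul, ite_mul, zero_mul]

/-- Unfolding the recursion along the word, letters `b` with `N ≤ s b` may be skipped, until some
letter `c` with `s c ≠ 0` is used and lowers `s c` by one. This writes the function by Cauchy
products with indicators of `{b | N ≤ s b}*` and of a letter, by induction on `∑ a, s a`. -/
theorem basisProd_mem_polySpace [Fintype A] [DecidableEq A] (N : ℕ) (s : A → ℕ) :
    ∃ d, basisProd N Finset.univ s ∈ polySpace ℕ (truncatedCounts e) d := by
  classical
  obtain ⟨n, hn⟩ : ∃ n, ∑ a, s a = n := ⟨_, rfl⟩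
  induction n generalizing s with
  | zero =>
    refine ⟨0, ?_⟩
    have hs : s = 0 := by
      funext a
      exact (Finset.sum_eq_zero_iff.1 hn) a (Finset.mem_univ a)
    subst hs
    -- For `N = 0` this is the empty product of binomials, constantly `1`; for `N > 0` it requires
    -- every letter count to be `0`.
    have : basisProd N Finset.univ (0 : A → ℕ) = fun w =>
        if N = 0 ∨ truncatedCounts e w = 1 then 1 else 0 := by
      funext w
      induction w using FreeMonoid.inductionOn' with
      | one => simp [basisProd_one]
      | of_mul b w ih =>
        rw [basisProd_of_mul, ih]
        have : truncatedCounts e (FreeMonoid.of b * w) ≠ 1 := fun h => by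
          have := congrArg FreeMonoid.length (truncatedCounts_eq_one e h)
          simp at this
        rcases Nat.eq_zero_or_pos N with rfl | hN
        · simp
        · rw [if_neg (not_or.2 ⟨hN.ne', this⟩)]
          simp [hN.ne']
    rw [this]
    exact comp_mem_polySpace fun m => if N = 0 ∨ m = 1 then 1 else 0
  | succ n ih =>
    have hdec : ∀ b, s b ≠ 0 → ∑ a, Function.update s b (s b - 1) a = n := by
      intro b hb
      rw [← Finset.add_sum_erase _ _ (Finset.mem_univ b)] at hn ⊢
      rw [Function.update_self, Finset.sum_congr rfl fun a ha =>
        Function.update_of_ne (Finset.ne_of_mem_erase ha) _ _]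
      omega
    have hD : ∀ b, ∃ D, s b ≠ 0 → basisProd N Finset.univ (Function.update s b (s b - 1)) ∈
        polySpace ℕ (truncatedCounts e) D := by
      intro b
      by_cases hb : s b = 0
      · exact ⟨0, fun h => absurd hb h⟩
      · obtain ⟨D, hD⟩ := ih _ (hdec b hb)
        exact ⟨D, fun _ => hD⟩
    choose D hD using hD
    -- the indicator functions of `{a | N ≤ s a}*` and of a letter
    let star : (ι → TruncatedCount) → ℕ := fun m => if ∀ a, s a < N → m (e a) = 1 then 1 else 0
    let letter : A → (ι → TruncatedCount) → ℕ := fun c m =>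
      if m = Pi.mulSingle (e c) TruncatedCount.one then 1 else 0
    have hstar1 : star 1 = 1 := if_pos fun _ _ => rfl
    have hstar : ∀ b, (fun m => star (truncatedCounts e (FreeMonoid.of b) * m)) =
        fun m => (if N ≤ s b then 1 else 0) * star m := by
      intro b
      funext m
      simp only [star, truncatedCounts_of, Pi.mul_apply, TruncatedCount.mul_eq_one_iff]
      by_cases hb : N ≤ s b
      · rw [if_pos hb, one_mul]
        refine if_congr (forall₂_congr fun a ha => and_iff_right ?_) rfl rfl
        refine Pi.mulSingle_eq_of_ne (fun hab => ?_) _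
        rw [e.injective hab] at ha
        omega
      · rw [if_neg hb, zero_mul, if_neg fun h1 => ?_]
        have := (h1 b (by omega)).1
        rw [Pi.mulSingle_eq_same] at this
        exact TruncatedCount.one_mul_ne 1 (by rw [mul_one, this])
    have hletter1 : ∀ c, letter c 1 = 0 := by
      intro c
      refine if_neg fun h => ?_
      have := congrFun h (e c)
      rw [Pi.mulSingle_eq_same, Pi.one_apply] at this
      exact TruncatedCount.one_mul_ne 1 (by rw [mul_one, ← this])
    have hletter : ∀ c (g : FreeMonoid A → ℕ) b w,
        conv (truncatedCounts e) (letter c) g (FreeMonoid.of b * w) = if b = c then g w else 0 := by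
      intro c g b w
      rw [conv_of_mul, hletter1, zero_mul, zero_add, conv, splitSum_eq_left]
      · simp only [letter, truncatedCounts_of, mulSingle_mul_eq_mulSingle_iff, map_one]
        simp [e.injective.eq_iff]
      · intro u v hu
        have : truncatedCounts e u ≠ 1 := fun h => hu (truncatedCounts_eq_one e h)
        simp only [letter, truncatedCounts_of, mulSingle_mul_eq_mulSingle_iff, this]
        simp
    have hconv : ∀ g b w, conv (truncatedCounts e) star g (FreeMonoid.of b * w) =
        g (FreeMonoid.of b * w) + if N ≤ s b then conv (truncatedCounts e) star g w else 0 := by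
      intro g b w
      rw [conv_of_mul, hstar, hstar1, one_mul]
      congr 1
      simp only [conv, mul_assoc, splitSum_mul_left]
      split_ifs <;> simp
    have hs0 : s ≠ 0 := by rintro rfl; simp at hn
    -- Both sides satisfy the same recursion on the first letter: it is either the letter `c`, when
    -- the starred factor is empty, or the first letter of the starred factor.
    have key : basisProd N Finset.univ s = ∑ c with s c ≠ 0, conv (truncatedCounts e) star
        (conv (truncatedCounts e) (letter c)
          (basisProd N Finset.univ (Function.update s c (s c - 1)))) := by
      funext w
      rw [Finset.sum_apply]
      induction w using FreeMonoid.inductionOn' with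
      | one =>
        rw [basisProd_one, if_neg hs0]
        symm
        refine Finset.sum_eq_zero fun c _ => ?_
        simp [conv, hletter1]
      | of_mul b w ihw =>
        simp only [hconv, hletter, Finset.sum_add_distrib]
        rw [basisProd_of_mul, ihw, add_comm]
        congr 1
        · simp only [Finset.sum_ite_eq, Finset.mem_filter, Finset.mem_univ, true_and]
          split_ifs <;> simp_all
        · split_ifs <;> simp
    refine ⟨Finset.univ.sup D + 2, ?_⟩
    rw [key]
    refine Submodule.sum_mem _ fun c hc => ?_
    refine conv_mem_polySpace _ (conv_mem_polySpace _ ?_)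
    exact polySpace_mono (Finset.le_sup (Finset.mem_univ c)) (hD c (Finset.mem_filter.1 hc).2)

end TruncatedCounts

/-- If the morphism detects the empty word, then the members of `polySpace` are given by
production functions. -/
theorem exists_eq_pSum {A M R : Type*} [Monoid M] [CommSemiring R] {μ : FreeMonoid A →* M}
    (hμ : ∀ u, μ u = 1 → u = 1) (d : ℕ) (f : FreeMonoid A → R) (hf : f ∈ polySpace R μ d) :
    ∃ π : (Fin (d + 1) → M) → R, f = pSum μ d π := by
  classical
  refine polySpace_induction (μ := μ) (P := fun d f => ∃ π : (Fin (d + 1) → M) → R, f = pSum μ d π)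
    ?_ ?_ ?_ ?_ ?_ ?_ d f hf
  · intro d
    -- Zero is written as a product so that `pSum_mul_left` can pull it out of the sum.
    refine ⟨fun _ => 0 * 0, funext fun w => ?_⟩
    rw [pSum_mul_left, zero_mul, Pi.zero_apply]
  · rintro d _ _ ⟨π, rfl⟩ ⟨ρ, rfl⟩
    exact ⟨fun m => π m + ρ m, funext fun w => (pSum_add μ d π ρ w).symm⟩
  · rintro d c _ ⟨π, rfl⟩
    exact ⟨fun m => c * π m, funext fun w => (pSum_mul_left μ d c π w).symm⟩
  · intro h
    exact ⟨fun m => h (m 0), rfl⟩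
  · rintro d _ ⟨π, rfl⟩ -
    -- The degree is raised by one additional first factor that is forced to be empty; this requires
    -- that `μ` detects the empty word.
    refine ⟨fun m => (if m 0 = 1 then 1 else 0) * π (Fin.tail m), funext fun w => ?_⟩
    simp only [pSum, Fin.cons_zero, Fin.tail_cons, pSum_mul_left]
    rw [splitSum_eq_left, map_one, if_pos rfl, one_mul]
    intro u v hu
    rw [if_neg fun h => hu (hμ u h), zero_mul]
  · intro d h g ih hg
    obtain ⟨π, rfl⟩ := ih g hg
    refine ⟨fun m => h (m 0) * π (Fin.tail m), funext fun w => ?_⟩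
    simp only [pSum, Fin.cons_zero, Fin.tail_cons, pSum_mul_left, conv]

theorem isNSF_of_mem_polySpace {A : Type*} {k : ℕ} (e : A ≃ Fin k)
    {d : ℕ} {f : FreeMonoid A → ℤ} {g : FreeMonoid A → ℕ}
    (hg : g ∈ polySpace ℕ (truncatedCounts e) d) (hfg : ∀ w, f w = (g w : ℤ)) : IsNSF f := by
  obtain ⟨π, rfl⟩ := exists_eq_pSum (fun _ => truncatedCounts_eq_one e) d g hg
  refine ⟨d, Fin k → TruncatedCount, inferInstance, inferInstance, truncatedCounts e,
    fun m => (π m : ℤ), fun x => ⟨2, funext fun i => TruncatedCount.pow_three (x i)⟩,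
    fun m => Int.natCast_nonneg _, funext fun w => ?_⟩
  rw [hfg, polySum_eq_pSum]
  exact map_pSum (Nat.castRingHom ℤ) _ d π w

/-! ### The equivalence -/

/-- A commutative `ℕ`-polyregular function in which pumping a letter is polynomial is star-free. -/
theorem isNSF_of_letterPolynomial {A : Type*} [Finite A] {f : FreeMonoid A → ℤ}
    (hc : IsCommutative f) (hf : IsNPoly f) {T D : ℕ} (hp : LetterPolynomial T D f) : IsNSF f := by
  classical
  cases nonempty_fintype A
  obtain ⟨d, M, _, _, μ, π, hπ, rfl⟩ := hf
  -- Large enough both for powers in `M` to be periodic and for `n * (d + 1)` to exceed the given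
  -- threshold.
  set n := Nat.card M + T with hn
  have hT : T ≤ n * (d + 1) := by nlinarith
  have htame : IsTame μ d (n * (d + 1)) D (polySum μ π) := by
    refine ⟨hc, ⟨pSum μ d fun m => ((π m).toNat : ℚ≥0), pSum_mem_polySpace d _, fun w => ?_⟩,
      fun a w x hx => hp a w x (hT.trans hx)⟩
    rw [polySum_eq_pSum]
    have h1 := map_pSum (Int.castRingHom ℚ) μ d π w
    have h2 := map_pSum NNRat.coeHom μ d (fun m => ((π m).toNat : ℚ≥0)) w
    simp only [NNRat.coe_coeHom, eq_intCast] at h1 h2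
    rw [h1, h2]
    congr 1
    funext m
    have := Int.toNat_of_nonneg (hπ m)
    rw [NNRat.cast_natCast]
    exact_mod_cast this.symm
  obtain ⟨G, hG, hG'⟩ := exists_eq_combination_basisProd (Nat.factorial_pos (Nat.card M))
    (fun m => pow_card_add_factorial m (n := n) (by omega)) rfl le_rfl Finset.univ _ htame
  let e := Fintype.equivFin A
  obtain ⟨D', hD'⟩ : ∃ D', G ∈ polySpace ℕ (truncatedCounts e) D' := by
    refine Submodule.span_induction (p := fun G _ => ∃ D', G ∈ polySpace ℕ (truncatedCounts e) D')
      ?_ ⟨0, zero_mem _⟩ ?_ ?_ hG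
    · rintro _ ⟨s, rfl⟩
      exact basisProd_mem_polySpace e _ s
    · rintro g h _ _ ⟨d1, h1⟩ ⟨d2, h2⟩
      exact ⟨max d1 d2, add_mem (polySpace_mono (le_max_left _ _) h1)
        (polySpace_mono (le_max_right _ _) h2)⟩
    · rintro c g _ ⟨d1, h1⟩
      exact ⟨d1, Submodule.smul_mem _ c h1⟩
  exact isNSF_of_mem_polySpace e hD' fun w => hG' w fun a _ => Finset.mem_univ a

/-- In an ultimately polynomial polyregular function, pumping a letter is polynomial, with bounds
read off a presentation. -/
theorem IsUltimatelyPolynomial.letterPolynomial {A M : Type*} [Monoid M] [Finite M] {d : ℕ}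
    {μ : FreeMonoid A →* M} {π : (Fin (d + 1) → M) → ℤ}
    (hf : IsUltimatelyPolynomial (polySum μ π)) :
    LetterPolynomial (Nat.card M * (d + 1)) (d + 1) (polySum μ π) := by
  obtain ⟨N, hN⟩ := hf
  intro a w x hx
  -- The pattern `a ^ x * w` with one variable. Its threshold `N` is unrelated to the presentation;
  -- the quasi-polynomial form removes this dependence.
  obtain ⟨P, hP⟩ := hN 1 ⟨fun i => if i = 0 then 1 else w, fun _ => FreeMonoid.of a⟩
  let p : Polynomial ℚ := MvPolynomial.aeval (fun _ => Polynomial.X) P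
  have hp : ∀ y, N ≤ y → ((pumpSeq (polySum μ π) (FreeMonoid.of a) w y : ℤ) : ℚ) = p.eval (y : ℚ) := by
    intro y hy
    have h1 := hP (fun _ => y) fun _ => hy
    simp only [PumpingPattern.eval, List.ofFn_succ, List.ofFn_zero, List.prod_cons, List.prod_nil,
      if_true, one_mul, mul_one] at h1
    rw [if_neg (Fin.succ_ne_zero 0)] at h1
    rw [pumpSeq, h1]
    have h2 : ∀ Q : MvPolynomial (Fin 1) ℚ,
        ((MvPolynomial.aeval (fun _ => Polynomial.X) Q : Polynomial ℚ)).eval (y : ℚ) =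
        MvPolynomial.eval (fun _ => (y : ℚ)) Q := by
      intro Q
      induction Q using MvPolynomial.induction_on with
      | C c => simp
      | add p q hp hq => simp [hp, hq]
      | mul_X p i hp => simp [hp]
    exact (h2 P).symm
  have h3 := fwdDiff_iter_eq_zero_of_quasiPolynomial (Nat.factorial_pos (Nat.card M))
    (T := Nat.card M * (d + 1)) (d := d) (fun z => ?_) hp x hx
  · rw [← cast_fwdDiff_iter] at h3
    exact_mod_cast h3
  · obtain ⟨g, -, -, hg⟩ := exists_pump (FreeMonoid.of a)
      (pow_card_add_factorial (μ (FreeMonoid.of a)) le_rfl) d _ (cast_polySum_mem_polySpace μ π)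
    refine ⟨fun j => g j (FreeMonoid.of a ^ z * w), fun y => ?_⟩
    rw [← hg, pumpSeq, ← mul_assoc, ← pow_add]
    congr 4
    ring

theorem IsNSF.isZSF {A : Type*} {f : FreeMonoid A → ℤ} (hf : IsNSF f) : IsZSF f := by
  obtain ⟨d, M, i1, i2, μ, π, h1, -, h3⟩ := hf
  exact ⟨d, M, i1, i2, μ, π, h1, h3⟩

theorem IsNSF.isNPoly {A : Type*} {f : FreeMonoid A → ℤ} (hf : IsNSF f) : IsNPoly f := by
  obtain ⟨d, M, i1, i2, μ, π, -, h2, h3⟩ := hf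
  exact ⟨d, M, i1, i2, μ, π, h2, h3⟩

theorem IsUltimatelyPolynomial.isNSF {A : Type*} [Finite A] {f : FreeMonoid A → ℤ}
    (h : IsUltimatelyPolynomial f) (hc : IsCommutative f) (hf : IsNPoly f) : IsNSF f := by
  obtain ⟨d, M, _, _, μ, π, -, rfl⟩ := id hf
  exact isNSF_of_letterPolynomial hc hf h.letterPolynomial

theorem tfae_of_isCommutative {A : Type*} [Finite A] {f : FreeMonoid A → ℤ}
    (hc : IsCommutative f) (hf : IsNPoly f) :
    [IsUltimatelyPolynomial f, IsZSF f, IsNSF f].TFAE := by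
  tfae_have 1 → 3 := fun h => h.isNSF hc hf
  tfae_have 3 → 2 := fun h => h.isZSF
  tfae_have 2 → 1 := fun h => h.isUltimatelyPolynomial
  tfae_finish

/-! ### Primitive recursive functions on lists and integers -/

section PrimrecLemmas

variable {α β σ : Type*} [Primcodable α] [Primcodable β] [Primcodable σ]

theorem Primrec.list_all' {l : α → List β} {p : α → β → Bool} (hl : Primrec l)
    (hp : Primrec fun q : α × β => p q.1 q.2) : Primrec fun a => (l a).all (p a) :=
  (Primrec.list_foldr hl (Primrec.const true) (h := fun a q => p a q.1 && q.2)
    (Primrec.and.comp (hp.comp (Primrec.pair Primrec.fst (Primrec.fst.comp Primrec.snd)))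
      (Primrec.snd.comp Primrec.snd))).of_eq fun a => by
    induction l a <;> simp_all

theorem Primrec.list_range_all {n : α → ℕ} {p : α → ℕ → Bool} (hn : Primrec n)
    (hp : Primrec fun q : α × ℕ => p q.1 q.2) : Primrec fun a => (List.range (n a)).all (p a) :=
  Primrec.list_all' (Primrec.list_range.comp hn) hp

theorem Primrec.list_replicate' {n : α → ℕ} {x : α → β} (hn : Primrec n) (hx : Primrec x) :
    Primrec fun a => List.replicate (n a) (x a) :=
  (Primrec.list_map (Primrec.list_range.comp hn) (g := fun a _ => x a)
    (hx.comp Primrec.fst)).of_eq fun a => by simp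

theorem Primrec.nat_pow' {f g : α → ℕ} (hf : Primrec f) (hg : Primrec g) :
    Primrec fun a => f a ^ g a :=
  (Primrec₂.unpaired'.1 Nat.Primrec.pow).comp hf hg

theorem Primrec.nat_prod_map {l : α → List β} {f : α → β → ℕ} (hl : Primrec l)
    (hf : Primrec fun q : α × β => f q.1 q.2) : Primrec fun a => ((l a).map (f a)).prod :=
  (Primrec.list_foldr hl (Primrec.const 1) (h := fun a q => f a q.1 * q.2)
    (Primrec.nat_mul.comp (hf.comp (Primrec.pair Primrec.fst (Primrec.fst.comp Primrec.snd)))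
      (Primrec.snd.comp Primrec.snd))).of_eq fun a => by
    induction l a <;> simp_all

/-- Integers are encoded by `n ↦ 2 * n` and `-n - 1 ↦ 2 * n + 1`, so the parity of the code is the
sign. -/
theorem Primrec.int_toNat : Primrec Int.toNat :=
  (Primrec.ite (c := fun z : ℤ => Encodable.encode z % 2 = 0)
    (Primrec.eq.comp (Primrec.nat_mod.comp Primrec.encode (Primrec.const 2)) (Primrec.const 0))
    (Primrec.nat_div.comp Primrec.encode (Primrec.const 2)) (Primrec.const 0)).of_eq fun z => by
    rcases z with n | n
    · rw [show Encodable.encode (Int.ofNat n) = 2 * n from rfl]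
      simp
    · rw [show Encodable.encode (Int.negSucc n) = 2 * n + 1 from rfl]
      simp [Nat.add_mod]

theorem Primrec.int_neg_toNat : Primrec fun z : ℤ => (-z).toNat :=
  (Primrec.ite (c := fun z : ℤ => Encodable.encode z % 2 = 0)
    (Primrec.eq.comp (Primrec.nat_mod.comp Primrec.encode (Primrec.const 2)) (Primrec.const 0))
    (Primrec.const 0)
    (Primrec.succ.comp (Primrec.nat_div.comp Primrec.encode (Primrec.const 2)))).of_eq fun z => by
    rcases z with n | n
    · rw [show Encodable.encode (Int.ofNat n) = 2 * n from rfl]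
      simp
    · rw [show Encodable.encode (Int.negSucc n) = 2 * n + 1 from rfl]
      simp only [Nat.mul_add_mod, Nat.mod_eq_of_lt (show 1 < 2 by omega), one_ne_zero, if_false]
      rw [Int.neg_negSucc, show (2 * n + 1) / 2 = n by omega]
      rfl

/-- Addition, subtraction and multiplication by a natural number all reduce to this through positive
and negative parts. -/
theorem Primrec.int_natSub {f g : α → ℕ} (hf : Primrec f) (hg : Primrec g) :
    Primrec fun a => (f a : ℤ) - g a := by
  refine Primrec.encode_iff.1 ((Primrec.ite (c := fun a => g a ≤ f a) (Primrec.nat_le.comp hg hf)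
    (Primrec.nat_mul.comp (Primrec.const 2) (Primrec.nat_sub.comp hf hg))
    (Primrec.succ.comp (Primrec.nat_mul.comp (Primrec.const 2)
      (Primrec.pred.comp (Primrec.nat_sub.comp hg hf))))).of_eq fun a => ?_)
  split_ifs with h
  · rw [show (f a : ℤ) - g a = Int.ofNat (f a - g a) by
      rw [Int.ofNat_eq_natCast]; omega]
    rfl
  · rw [show (f a : ℤ) - g a = Int.negSucc (g a - f a - 1) by
      rw [Int.negSucc_eq]; omega]
    rfl

theorem Primrec.int_sub' {f g : α → ℤ} (hf : Primrec f) (hg : Primrec g) :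
    Primrec fun a => f a - g a :=
  (Primrec.int_natSub
    (Primrec.nat_add.comp (Primrec.int_toNat.comp hf) (Primrec.int_neg_toNat.comp hg))
    (Primrec.nat_add.comp (Primrec.int_neg_toNat.comp hf) (Primrec.int_toNat.comp hg))).of_eq
    fun a => by push_cast; omega

theorem Primrec.int_add' {f g : α → ℤ} (hf : Primrec f) (hg : Primrec g) :
    Primrec fun a => f a + g a :=
  (Primrec.int_natSub
    (Primrec.nat_add.comp (Primrec.int_toNat.comp hf) (Primrec.int_toNat.comp hg))
    (Primrec.nat_add.comp (Primrec.int_neg_toNat.comp hf) (Primrec.int_neg_toNat.comp hg))).of_eq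
    fun a => by push_cast; omega

theorem Primrec.int_natCast_mul' {f : α → ℕ} {g : α → ℤ} (hf : Primrec f) (hg : Primrec g) :
    Primrec fun a => (f a : ℤ) * g a :=
  (Primrec.int_natSub
    (Primrec.nat_mul.comp hf (Primrec.int_toNat.comp hg))
    (Primrec.nat_mul.comp hf (Primrec.int_neg_toNat.comp hg))).of_eq fun a => by
    rw [Nat.cast_mul, Nat.cast_mul, ← mul_sub]
    congr 1
    omega

theorem Primrec.int_sum_map {l : α → List β} {f : α → β → ℤ} (hl : Primrec l)
    (hf : Primrec fun q : α × β => f q.1 q.2) : Primrec fun a => ((l a).map (f a)).sum :=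
  (Primrec.list_foldr hl (Primrec.const 0) (h := fun a q => f a q.1 + q.2)
    (Primrec.int_add' (hf.comp (Primrec.pair Primrec.fst (Primrec.fst.comp Primrec.snd)))
      (Primrec.snd.comp Primrec.snd))).of_eq fun a => by
    induction l a <;> simp_all

theorem Primrec.decide_eq {γ : Type*} [Primcodable γ] [DecidableEq γ] {f g : α → γ}
    (hf : Primrec f) (hg : Primrec g) : Primrec fun a => decide (f a = g a) :=
  (Primrec.eq.comp hf hg).decide

theorem Primrec.decide_lt {f g : α → ℕ} (hf : Primrec f) (hg : Primrec g) :
    Primrec fun a => decide (f a < g a) :=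
  (Primrec.nat_lt.comp hf hg).decide

theorem Primrec.decide_le {f g : α → ℕ} (hf : Primrec f) (hg : Primrec g) :
    Primrec fun a => decide (f a ≤ g a) :=
  (Primrec.nat_le.comp hf hg).decide

theorem Primrec.list_getD' {l : α → List β} {i : α → ℕ} (d : β) (hl : Primrec l)
    (hi : Primrec i) : Primrec fun a => (l a).getD (i a) d :=
  (Primrec.list_getD d).comp hl hi

end PrimrecLemmas

/-! ### Evaluating descriptions -/

namespace PolyCode

/-- The product of the elements with numbers `i` and `j`. -/
def mulIdx (c : PolyCode) (i j : ℕ) : ℕ := c.mulTable.getD (i * c.size + j) 0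

/-- The number of the unit. -/
def unitIdx (c : PolyCode) : ℕ :=
  (List.range c.size).findIdx fun e =>
    (List.range c.size).all fun j => decide (c.mulIdx e j = j)

/-- The number of the image of a word. -/
def image (c : PolyCode) (w : List ℕ) : ℕ :=
  w.foldl (fun m a => c.mulIdx m (c.letters.getD a 0)) c.unitIdx

/-- Replaces a partial factorization, given by the numbers of the images of its factors and the
remaining word, by its extensions by one factor. -/
def extend (c : PolyCode) (L : List (List ℕ × List ℕ)) : List (List ℕ × List ℕ) :=
  L.flatMap fun s => (List.range (s.2.length + 1)).map fun i =>
    (s.1 ++ [c.image (s.2.take i)], s.2.drop i)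

/-- The number of a tuple in the table of the production function. -/
def tupleIdx (c : PolyCode) (l : List ℕ) : ℕ := l.foldr (fun x r => x + c.size * r) 0

/-- The entry in the table of the production function for a factorization, given by the numbers
of the images of all factors but the last and the last factor. -/
def entry (c : PolyCode) (s : List ℕ × List ℕ) : ℤ :=
  c.prodTable.getD (c.tupleIdx (s.1 ++ [c.image s.2])) 0

/-- The value of the described function. -/
def value (c : PolyCode) (w : List ℕ) : ℤ :=
  ((c.extend^[c.deg] [([], w)]).map c.entry).sum

section Primrec

variable {α : Type*} [Primcodable α] {c : α → PolyCode} (hc : Primrec c)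

include hc

theorem primrec_tuple : Primrec fun a => equivProd (c a) :=
  (Primrec.of_equiv (e := equivProd)).comp hc

theorem primrec_deg : Primrec fun a => (c a).deg := Primrec.fst.comp (primrec_tuple hc)

theorem primrec_size : Primrec fun a => (c a).size :=
  Primrec.fst.comp (Primrec.snd.comp (primrec_tuple hc))

theorem primrec_mulTable : Primrec fun a => (c a).mulTable :=
  Primrec.fst.comp (Primrec.snd.comp (Primrec.snd.comp (primrec_tuple hc)))

theorem primrec_letters : Primrec fun a => (c a).letters :=
  Primrec.fst.comp (Primrec.snd.comp (Primrec.snd.comp (Primrec.snd.comp (primrec_tuple hc))))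

theorem primrec_prodTable : Primrec fun a => (c a).prodTable :=
  Primrec.snd.comp (Primrec.snd.comp (Primrec.snd.comp (Primrec.snd.comp (primrec_tuple hc))))

theorem primrec_mulIdx {i j : α → ℕ} (hi : Primrec i) (hj : Primrec j) :
    Primrec fun a => (c a).mulIdx (i a) (j a) :=
  Primrec.list_getD' 0 (primrec_mulTable hc)
    (Primrec.nat_add.comp (Primrec.nat_mul.comp hi (primrec_size hc)) hj)

theorem primrec_unitIdx : Primrec fun a => (c a).unitIdx := by
  refine Primrec.list_findIdx (Primrec.list_range.comp (primrec_size hc)) ?_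
  refine Primrec.list_range_all (primrec_size (hc.comp Primrec.fst)) ?_
  exact Primrec.decide_eq (primrec_mulIdx (hc.comp (Primrec.fst.comp Primrec.fst))
    (Primrec.snd.comp Primrec.fst) Primrec.snd) Primrec.snd

theorem primrec_image {w : α → List ℕ} (hw : Primrec w) : Primrec fun a => (c a).image (w a) :=
  Primrec.list_foldl hw (primrec_unitIdx hc)
    (h := fun a q => (c a).mulIdx q.1 ((c a).letters.getD q.2 0))
    (primrec_mulIdx (hc.comp Primrec.fst) (Primrec.fst.comp Primrec.snd)
      (Primrec.list_getD' 0 (primrec_letters (hc.comp Primrec.fst))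
        (Primrec.snd.comp Primrec.snd)))

theorem primrec_extend {L : α → List (List ℕ × List ℕ)} (hL : Primrec L) :
    Primrec fun a => (c a).extend (L a) := by
  refine Primrec.list_flatMap hL ?_
  refine Primrec.list_map (Primrec.list_range.comp (Primrec.succ.comp
    (Primrec.list_length.comp (Primrec.snd.comp Primrec.snd)))) ?_
  have hs : Primrec fun q : (α × List ℕ × List ℕ) × ℕ => q.1.2 := Primrec.snd.comp Primrec.fst
  refine Primrec.pair (Primrec.list_concat.comp (Primrec.fst.comp hs) ?_)
    (Primrec.list_drop.comp Primrec.snd (Primrec.snd.comp hs))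
  exact primrec_image (hc.comp (Primrec.fst.comp Primrec.fst))
    (Primrec.list_take.comp Primrec.snd (Primrec.snd.comp hs))

theorem primrec_tupleIdx {l : α → List ℕ} (hl : Primrec l) :
    Primrec fun a => (c a).tupleIdx (l a) :=
  Primrec.list_foldr hl (Primrec.const 0) (h := fun a q => q.1 + (c a).size * q.2)
    (Primrec.nat_add.comp (Primrec.fst.comp Primrec.snd)
      (Primrec.nat_mul.comp (primrec_size (hc.comp Primrec.fst)) (Primrec.snd.comp Primrec.snd)))

theorem primrec_value {w : α → List ℕ} (hw : Primrec w) : Primrec fun a => (c a).value (w a) := by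
  refine Primrec.int_sum_map (Primrec.nat_iterate (primrec_deg hc) ?_ ?_) ?_
  · exact Primrec.list_cons.comp (Primrec.pair (Primrec.const []) hw) (Primrec.const [])
  · exact primrec_extend (hc.comp Primrec.fst) Primrec.snd
  · have hc' : Primrec fun q : α × List ℕ × List ℕ => c q.1 := hc.comp Primrec.fst
    refine Primrec.list_getD' 0 (primrec_prodTable hc') (primrec_tupleIdx hc' ?_)
    exact Primrec.list_concat.comp (Primrec.fst.comp Primrec.snd)
      (primrec_image hc' (Primrec.snd.comp Primrec.snd))

end Primrec

end PolyCode

/-! ### Correctness of the evaluation of descriptions -/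

theorem splitSum_eq_sum_range {A R : Type*} [CommSemiring R] (G : FreeMonoid A → FreeMonoid A → R)
    (w : FreeMonoid A) : splitSum G w = ((List.range (w.toList.length + 1)).map fun i =>
      G (FreeMonoid.ofList (w.toList.take i)) (FreeMonoid.ofList (w.toList.drop i))).sum := by
  induction w using FreeMonoid.inductionOn' generalizing G with
  | one => simp [splitSum_one]
  | of_mul a w ih =>
    rw [splitSum_of_mul, ih, FreeMonoid.toList_of_mul, List.length_cons,
      List.range_succ_eq_map (n := w.toList.length + 1), List.map_cons, List.sum_cons, List.map_map]
    rfl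

@[simp] theorem wordCode_one {k : ℕ} : wordCode (1 : FreeMonoid (Fin k)) = [] := rfl

theorem wordCode_of_mul {k : ℕ} (a : Fin k) (w : FreeMonoid (Fin k)) :
    wordCode (FreeMonoid.of a * w) = (a : ℕ) :: wordCode w := rfl

theorem wordCode_mul {k : ℕ} (u v : FreeMonoid (Fin k)) :
    wordCode (u * v) = wordCode u ++ wordCode v := by
  simp [wordCode]

theorem wordCode_take {k : ℕ} (w : FreeMonoid (Fin k)) (i : ℕ) :
    wordCode (FreeMonoid.ofList (w.toList.take i)) = (wordCode w).take i := by
  simp [wordCode, List.map_take]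

theorem wordCode_drop {k : ℕ} (w : FreeMonoid (Fin k)) (i : ℕ) :
    wordCode (FreeMonoid.ofList (w.toList.drop i)) = (wordCode w).drop i := by
  simp [wordCode, List.map_drop]

theorem length_wordCode {k : ℕ} (w : FreeMonoid (Fin k)) : (wordCode w).length = w.length := by
  simp only [wordCode, List.length_map]
  rfl

namespace PolyCode

theorem getD_of_getElem? {α : Type*} {l : List α} {i : ℕ} {x : α} (h : l[i]? = some x) (d : α) :
    l.getD i d = x := by
  rw [List.getD_eq_getElem?_getD, h, Option.getD_some]

theorem extend_append (c : PolyCode) (L L' : List (List ℕ × List ℕ)) :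
    c.extend (L ++ L') = c.extend L ++ c.extend L' := List.flatMap_append

theorem extend_iterate_append (c : PolyCode) (n : ℕ) (L L' : List (List ℕ × List ℕ)) :
    c.extend^[n] (L ++ L') = c.extend^[n] L ++ c.extend^[n] L' := by
  induction n generalizing L L' with
  | zero => rfl
  | succ n ih => simp only [Function.iterate_succ_apply, extend_append, ih]

/-- Partial factorizations are extended independently of each other. -/
theorem sum_extend_iterate (c : PolyCode) (n : ℕ) (g : List ℕ × List ℕ → ℤ)
    (L : List (List ℕ × List ℕ)) : ((c.extend^[n] L).map g).sum =
      (L.map fun x => ((c.extend^[n] [x]).map g).sum).sum := by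
  induction L with
  | nil =>
    have : c.extend^[n] [] = [] := by
      induction n with
      | zero => rfl
      | succ n ih => rw [Function.iterate_succ_apply]; exact ih
    rw [this]
    rfl
  | cons x L ih =>
    rw [← List.singleton_append, extend_iterate_append, List.map_append, List.sum_append, ih]
    simp

theorem tupleIdx_ofFn (c : PolyCode) (n : ℕ) (g : Fin n → Fin c.size) :
    c.tupleIdx (List.ofFn fun i => (g i : ℕ)) = (finFunctionFinEquiv g : ℕ) := by
  rw [finFunctionFinEquiv_apply]
  induction n with
  | zero => rfl
  | succ n ih =>
    rw [List.ofFn_succ, Fin.sum_univ_succ]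
    have := ih fun i => g i.succ
    simp only [tupleIdx, List.foldr_cons] at this ⊢
    rw [this, Finset.mul_sum]
    simp only [Fin.val_zero, pow_zero, mul_one, Fin.val_succ, pow_succ]
    congr 1
    exact Finset.sum_congr rfl fun _ _ => by ring

section Describes

variable {k : ℕ} {M : Type} [Monoid M] {c : PolyCode} {e : M ≃ Fin c.size}
  {μ : FreeMonoid (Fin k) →* M} {π : (Fin (c.deg + 1) → M) → ℤ}

theorem Describes.mulIdx_eq (h : c.Describes e μ π) (x y : M) :
    c.mulIdx (e x) (e y) = e (x * y) := getD_of_getElem? (h.mul x y) 0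

/-- A left unit of a monoid equals `1`, as one sees by multiplying it by `1` on the right. So the
first left unit in the table is the unit. -/
theorem Describes.unitIdx_eq (h : c.Describes e μ π) : c.unitIdx = e 1 := by
  have hlt : (e 1 : ℕ) < (List.range c.size).length := by rw [List.length_range]; exact (e 1).2
  rw [unitIdx, List.findIdx_eq hlt]
  constructor
  · rw [List.getElem_range, List.all_eq_true]
    intro j hj
    rw [List.mem_range] at hj
    obtain ⟨x, hx⟩ := e.surjective ⟨j, hj⟩
    have : (e x : ℕ) = j := by rw [hx]
    rw [← this, h.mulIdx_eq, one_mul, decide_eq_true rfl]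
  · intro j hj
    rw [List.getElem_range, Bool.eq_false_iff]
    intro hall
    rw [List.all_eq_true] at hall
    obtain ⟨x, hx⟩ := e.surjective ⟨j, hj.trans (e 1).2⟩
    have hx' : (e x : ℕ) = j := by rw [hx]
    have h1 := hall (e 1) (List.mem_range.2 (e 1).2)
    rw [← hx', h.mulIdx_eq, mul_one, decide_eq_true_eq] at h1
    omega

theorem Describes.image_eq (h : c.Describes e μ π) (w : FreeMonoid (Fin k)) :
    c.image (wordCode w) = e (μ w) := by
  have key : ∀ m : M, (wordCode w).foldl (fun m a => c.mulIdx m (c.letters.getD a 0)) (e m) =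
      e (m * μ w) := by
    induction w using FreeMonoid.inductionOn' with
    | one => intro m; simp
    | of_mul a w ih =>
      intro m
      rw [wordCode_of_mul, List.foldl_cons, getD_of_getElem? (h.letter a), h.mulIdx_eq, ih,
        map_mul μ, mul_assoc]
  rw [image, h.unitIdx_eq, key, one_mul]

/-- One `extend` is one step of the recursion of `pSum`; the factors already chosen are kept in
`acc`. The last factor is the remaining word, so `n` extensions give `n + 1` factors. -/
theorem Describes.sum_extend (h : c.Describes e μ π) (G : List ℕ → ℤ) (n : ℕ) (acc : List ℕ)
    (w : FreeMonoid (Fin k)) :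
    ((c.extend^[n] [(acc, wordCode w)]).map fun s => G (s.1 ++ [c.image s.2])).sum =
      pSum μ n (fun m => G (acc ++ List.ofFn fun i => (e (m i) : ℕ))) w := by
  induction n generalizing acc w with
  | zero => simp [pSum, h.image_eq, List.ofFn_succ]
  | succ n ih =>
    have h1 : c.extend [(acc, wordCode w)] = (List.range (w.toList.length + 1)).map fun i =>
        (acc ++ [c.image ((wordCode w).take i)], (wordCode w).drop i) := by
      rw [extend, List.flatMap_singleton, length_wordCode]
      rfl
    rw [Function.iterate_succ_apply, sum_extend_iterate, h1, List.map_map, pSum,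
      splitSum_eq_sum_range]
    congr 1
    refine List.map_congr_left fun i _ => ?_
    simp only [Function.comp_apply]
    rw [← wordCode_take, ← wordCode_drop, ih, h.image_eq]
    congr 1
    funext m
    rw [List.ofFn_succ (n := n + 1), List.append_assoc, List.singleton_append]
    rfl

theorem Describes.value_eq (h : c.Describes e μ π) (w : FreeMonoid (Fin k)) :
    c.value (wordCode w) = polySum μ π w := by
  have h1 := h.sum_extend (fun l => c.prodTable.getD (c.tupleIdx l) 0) c.deg [] w
  rw [polySum_eq_pSum]
  refine h1.trans ?_
  congr 1
  funext m
  rw [List.nil_append, tupleIdx_ofFn c _ fun i => e (m i), getD_of_getElem? (h.production m)]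

theorem Encodes.value_eq {f : FreeMonoid (Fin k) → ℤ} (h : c.Encodes f) (w : FreeMonoid (Fin k)) :
    c.value (wordCode w) = f w := by
  obtain ⟨M, _, e, μ, π, hd, rfl⟩ := h
  exact hd.value_eq w

end Describes

end PolyCode

/-! ### Enumerating words -/

/-- The list of all words of length `n` over `{0, …, k - 1}`. -/
def wordsOfLength (k n : ℕ) : List (List ℕ) :=
  (fun L : List (List ℕ) => L.flatMap fun w => (List.range k).map fun a => a :: w)^[n] [[]]

theorem mem_wordsOfLength {k n : ℕ} {w : List ℕ} :
    w ∈ wordsOfLength k n ↔ w.length = n ∧ ∀ a ∈ w, a < k := by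
  induction n generalizing w with
  | zero =>
    simp only [wordsOfLength, Function.iterate_zero, id, List.mem_singleton]
    constructor
    · rintro rfl; simp
    · rintro ⟨h, -⟩; exact List.length_eq_zero_iff.1 h
  | succ n ih =>
    rw [wordsOfLength, Function.iterate_succ_apply']
    change w ∈ (wordsOfLength k n).flatMap _ ↔ _
    simp only [List.mem_flatMap, List.mem_map, List.mem_range, ih]
    constructor
    · rintro ⟨v, ⟨hv, hv'⟩, a, ha, rfl⟩
      simp_all
    · rintro ⟨h, h'⟩
      cases w with
      | nil => simp at h
      | cons a v => exact ⟨v, ⟨by simpa using h, fun b hb => h' b (by simp [hb])⟩, a,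
          h' a (by simp), rfl⟩

/-- The list of all words of length less than `n` over `{0, …, k - 1}`. -/
def shortWords (k n : ℕ) : List (List ℕ) := (List.range n).flatMap (wordsOfLength k)

theorem mem_shortWords {k n : ℕ} {w : List ℕ} :
    w ∈ shortWords k n ↔ w.length < n ∧ ∀ a ∈ w, a < k := by
  simp [shortWords, List.mem_flatMap, mem_wordsOfLength]

theorem forall_mem_shortWords {k n : ℕ} {P : List ℕ → Prop} :
    (∀ w ∈ shortWords k n, P w) ↔
      ∀ w : FreeMonoid (Fin k), w.length < n → P (wordCode w) := by
  constructor
  · intro h w hw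
    refine h _ (mem_shortWords.2 ⟨by rwa [length_wordCode], fun a ha => ?_⟩)
    obtain ⟨b, -, rfl⟩ := List.mem_map.1 ha
    exact b.2
  · intro h w hw
    obtain ⟨h1, h2⟩ := mem_shortWords.1 hw
    have h3 : wordCode (FreeMonoid.ofList (w.pmap Fin.mk h2)) = w := by
      simp [wordCode, List.map_pmap]
    rw [← h3]
    refine h _ ?_
    rwa [← length_wordCode, h3]

section Primrec

variable {α : Type*} [Primcodable α]

theorem primrec_wordsOfLength {k n : α → ℕ} (hk : Primrec k) (hn : Primrec n) :
    Primrec fun a => wordsOfLength (k a) (n a) := by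
  refine Primrec.nat_iterate hn (Primrec.const [[]]) ?_
  refine Primrec.list_flatMap Primrec.snd ?_
  refine Primrec.list_map (Primrec.list_range.comp (hk.comp (Primrec.fst.comp Primrec.fst))) ?_
  exact Primrec.list_cons.comp Primrec.snd (Primrec.snd.comp Primrec.fst)

theorem primrec_shortWords {k n : α → ℕ} (hk : Primrec k) (hn : Primrec n) :
    Primrec fun a => shortWords (k a) (n a) :=
  Primrec.list_flatMap (Primrec.list_range.comp hn)
    (primrec_wordsOfLength (hk.comp Primrec.fst) Primrec.snd)

end Primrec

/-! ### Deciding membership -/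

/-- The list of differences of consecutive members of a list. -/
def listDiff (l : List ℤ) : List ℤ :=
  (List.range (l.length - 1)).map fun i => l.getD (i + 1) 0 - l.getD i 0

theorem listDiff_map_range (h : ℕ → ℤ) (n : ℕ) :
    listDiff ((List.range n).map h) = (List.range (n - 1)).map (fwdDiff 1 h) := by
  simp only [listDiff, List.length_map, List.length_range]
  refine List.map_congr_left fun i hi => ?_
  rw [List.mem_range] at hi
  rw [List.getD_eq_getElem _ _ (by simp; omega), List.getD_eq_getElem _ _ (by simp; omega)]
  simp [fwdDiff]

theorem listDiff_iterate (h : ℕ → ℤ) (n i : ℕ) :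
    listDiff^[i] ((List.range n).map h) = (List.range (n - i)).map ((fwdDiff 1)^[i] h) := by
  induction i generalizing h n with
  | zero => rfl
  | succ i ih =>
    rw [Function.iterate_succ_apply, listDiff_map_range, ih, ← Function.iterate_succ_apply,
      show n - 1 - i = n - (i + 1) by omega]

theorem primrec_listDiff : Primrec listDiff := by
  refine Primrec.list_map (Primrec.list_range.comp (Primrec.pred.comp Primrec.list_length)) ?_
  exact Primrec.int_sub' (Primrec.list_getD' 0 Primrec.fst (Primrec.succ.comp Primrec.snd))
    (Primrec.list_getD' 0 Primrec.fst Primrec.snd)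

/-- Whether pumping a letter is polynomial, tested on short words. -/
def isNSFTest (k : ℕ) (c : PolyCode) : Bool :=
  (List.range k).all fun a => (shortWords k (c.size * (c.size + 1) ^ c.deg)).all fun w =>
    -- From `deg + 2` consecutive values, `deg + 1` rounds of differences leave exactly one entry.
    -- The starting point is the threshold of `IsUltimatelyPolynomial.letterPolynomial`.
    decide (((listDiff^[c.deg + 1] ((List.range (c.deg + 2)).map fun i =>
      c.value (List.replicate (c.size * (c.deg + 1) + i) a ++ w)))).headI = 0)

theorem primrec_isNSFTest : Primrec fun p : ℕ × PolyCode => isNSFTest p.1 p.2 := by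
  refine Primrec.list_range_all Primrec.fst ?_
  have hc : Primrec fun q : (ℕ × PolyCode) × ℕ => q.1.2 := Primrec.snd.comp Primrec.fst
  have hs := PolyCode.primrec_size hc
  have hd := PolyCode.primrec_deg hc
  refine Primrec.list_all' (primrec_shortWords (Primrec.fst.comp Primrec.fst)
    (Primrec.nat_mul.comp hs (Primrec.nat_pow' (Primrec.succ.comp hs) hd))) ?_
  refine Primrec.decide_eq (Primrec.list_headI.comp ?_) (Primrec.const 0)
  have hc' := hc.comp (Primrec.fst (α := (ℕ × PolyCode) × ℕ) (β := List ℕ))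
  refine Primrec.nat_iterate (Primrec.succ.comp (PolyCode.primrec_deg hc')) ?_
    (primrec_listDiff.comp Primrec.snd)
  refine Primrec.list_map (Primrec.list_range.comp (Primrec.succ.comp
    (Primrec.succ.comp (PolyCode.primrec_deg hc')))) ?_
  have hc'' := hc'.comp (Primrec.fst (α := ((ℕ × PolyCode) × ℕ) × List ℕ) (β := ℕ))
  refine PolyCode.primrec_value hc'' (Primrec.list_append.comp (Primrec.list_replicate' ?_ ?_) ?_)
  · exact Primrec.nat_add.comp (Primrec.nat_mul.comp (PolyCode.primrec_size hc'')
      (Primrec.succ.comp (PolyCode.primrec_deg hc''))) Primrec.snd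
  · exact Primrec.snd.comp (Primrec.fst.comp Primrec.fst)
  · exact Primrec.snd.comp Primrec.fst

theorem wordCode_of_pow {k : ℕ} (a : Fin k) (x : ℕ) :
    wordCode (FreeMonoid.of a ^ x) = List.replicate x (a : ℕ) := by
  induction x with
  | zero => rfl
  | succ x ih => rw [pow_succ', wordCode_of_mul, ih, List.replicate_succ]

theorem isNSFTest_eq_true_iff {k : ℕ} {c : PolyCode} {f : FreeMonoid (Fin k) → ℤ}
    (hf : c.Encodes f) : isNSFTest k c = true ↔
      ∀ (a : Fin k) (w : FreeMonoid (Fin k)), w.length < c.size * (c.size + 1) ^ c.deg →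
        (fwdDiff 1)^[c.deg + 1] (pumpSeq f (FreeMonoid.of a) w) (c.size * (c.deg + 1)) = 0 := by
  have key : ∀ (a : Fin k) (w : FreeMonoid (Fin k)),
      ((listDiff^[c.deg + 1] ((List.range (c.deg + 2)).map fun i =>
        c.value (List.replicate (c.size * (c.deg + 1) + i) (a : ℕ) ++ wordCode w)))).headI =
      (fwdDiff 1)^[c.deg + 1] (pumpSeq f (FreeMonoid.of a) w) (c.size * (c.deg + 1)) := by
    intro a w
    have h1 : (fun i => c.value (List.replicate (c.size * (c.deg + 1) + i) (a : ℕ) ++ wordCode w)) =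
        fun i => pumpSeq f (FreeMonoid.of a) w (i + c.size * (c.deg + 1)) := by
      funext i
      rw [← wordCode_of_pow, ← wordCode_mul, hf.value_eq, pumpSeq, add_comm]
    rw [h1, listDiff_iterate, show c.deg + 2 - (c.deg + 1) = 1 by omega]
    simp only [List.range_one, List.map_cons, List.map_nil, List.headI_cons]
    rw [fwdDiff_iter_comp_add, zero_add]
  rw [isNSFTest]
  simp only [List.all_eq_true, List.mem_range, decide_eq_true_eq]
  constructor
  · intro h a w hw
    rw [← key]
    exact forall_mem_shortWords.1 (h a a.2) w hw
  · intro h a ha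
    refine forall_mem_shortWords.2 fun w hw => ?_
    rw [key ⟨a, ha⟩ w]
    exact h ⟨a, ha⟩ w hw

/-- The defect `w ↦ (fwdDiff 1)^[deg + 1] (pumpSeq f a w) T` is a combination of translates of `f`,
so it lies in the same `polySpace` and vanishes once it does so on short words. -/
theorem isNSFTest_eq_true_iff_isNSF {k : ℕ} {c : PolyCode} {f : FreeMonoid (Fin k) → ℤ}
    (hc : IsCommutative f) (hf : IsNPoly f) (he : c.Encodes f) :
    isNSFTest k c = true ↔ IsNSF f := by
  rw [isNSFTest_eq_true_iff he]
  obtain ⟨M, _, e, μ, π, -, rfl⟩ := he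
  have : Finite M := Finite.of_equiv _ e.symm
  have hcard : Nat.card M = c.size := by rw [Nat.card_congr e, Nat.card_fin]
  constructor
  · intro h
    refine isNSF_of_letterPolynomial hc hf (T := c.size * (c.deg + 1)) (D := c.deg + 1) ?_
    intro a w x hx
    set T := c.size * (c.deg + 1)
    have hmem : (fun w => ((((fwdDiff 1)^[c.deg + 1] (pumpSeq (polySum μ π) (FreeMonoid.of a) w) T) :
        ℤ) : ℚ)) ∈ polySpace ℚ μ c.deg := by
      simp only [cast_fwdDiff_iter]
      simp only [fwdDiff_iter_eq_sum_shift]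
      have h1 : (fun w => ∑ x ∈ Finset.range (c.deg + 1 + 1),
          ((-1 : ℤ) ^ (c.deg + 1 - x) * ((c.deg + 1).choose x)) •
            ((pumpSeq (polySum μ π) (FreeMonoid.of a) w (T + x • 1) : ℤ) : ℚ)) =
          ∑ x ∈ Finset.range (c.deg + 1 + 1),
          ((((-1 : ℤ) ^ (c.deg + 1 - x) * ((c.deg + 1).choose x) : ℤ)) : ℚ) •
            fun w => (fun w => ((polySum μ π w : ℤ) : ℚ)) (FreeMonoid.of a ^ (T + x • 1) * w) := by
        funext w
        rw [Finset.sum_apply]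
        refine Finset.sum_congr rfl fun x _ => ?_
        rw [zsmul_eq_mul]
        rfl
      rw [h1]
      exact Submodule.sum_mem _ fun x _ => Submodule.smul_mem _ _
        (translate_mem_polySpace (cast_polySum_mem_polySpace μ π) _)
    have hzero := eq_zero_of_short_words hmem ?_
    -- The defect at `T + y` for `w` is the defect at `T` for `a ^ y * w`, so one starting point is
    -- enough.
    · obtain ⟨y, rfl⟩ := Nat.exists_eq_add_of_le' hx
      have h2 := congrFun hzero (FreeMonoid.of a ^ y * w)
      have h3 : pumpSeq (polySum μ π) (FreeMonoid.of a) (FreeMonoid.of a ^ y * w) =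
          fun x => pumpSeq (polySum μ π) (FreeMonoid.of a) w (x + y) := by
        funext x
        simp only [pumpSeq]
        rw [← mul_assoc, ← pow_add]
      rw [h3] at h2
      simp only [fwdDiff_iter_comp_add, Pi.zero_apply] at h2
      rw [Nat.add_comm y T]
      exact_mod_cast h2
    · intro w hw
      rw [hcard] at hw
      rw [h a w hw, Int.cast_zero]
  · intro h a w _
    have h1 := h.isZSF.isUltimatelyPolynomial.letterPolynomial
    rw [hcard] at h1
    exact h1 a w _ le_rfl

/-! ### Unbounded search -/

/-- The first `b` that passes a test. -/
def search {α β : Type*} [Primcodable β] (check : α → β → Bool) (a : α) : Part β :=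
  Nat.rfindOpt fun m => (Encodable.decode (α := β) m).bind fun b =>
    bif check a b then some b else none

section Search

variable {α β : Type*} [Primcodable β] {check : α → β → Bool}

theorem partrec_search [Primcodable α] (h : Primrec₂ check) : Partrec (search check) := by
  refine Partrec.rfindOpt (Primrec.to_comp (α := α × ℕ) ?_)
  refine Primrec.option_bind (Primrec.decode.comp Primrec.snd) ?_
  have hb : Primrec fun q : (α × ℕ) × β => q.2 := Primrec.snd
  exact Primrec.cond (h.comp (Primrec.fst.comp Primrec.fst) hb) (Primrec.option_some.comp hb)
    (Primrec.const none)

theorem check_of_mem_search {a : α} {b : β} (h : b ∈ search check a) : check a b = true := by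
  obtain ⟨m, hm⟩ := Nat.rfindOpt_spec h
  rw [Option.mem_def, Option.bind_eq_some_iff] at hm
  obtain ⟨b', -, hb'⟩ := hm
  cases hc : check a b' with
  | true =>
    rw [hc, cond_true, Option.some.injEq] at hb'
    rw [← hb', hc]
  | false => simp [hc] at hb'

theorem exists_mem_search {a : α} {b : β} (h : check a b = true) : ∃ b', b' ∈ search check a := by
  refine Part.dom_iff_mem.1 (Nat.rfindOpt_dom.2 ⟨Encodable.encode b, b, ?_⟩)
  rw [Encodable.encodek]
  simp [h]

end Search

/-! ### Descriptions of star-free `ℕ`-polyregular functions -/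

namespace PolyCode

/-- The number of the `n`-th power of the element with number `x`. -/
def powIdx (c : PolyCode) (x n : ℕ) : ℕ := (fun m => c.mulIdx m x)^[n] c.unitIdx

/-- Whether the multiplication table is associative and has all its entries. -/
def mulTest (c : PolyCode) : Bool :=
  (List.range c.size).all fun i => (List.range c.size).all fun j =>
    -- The default `size` makes a missing entry fail the test.
    decide (c.mulTable.getD (i * c.size + j) c.size < c.size) &&
      (List.range c.size).all fun l =>
        decide (c.mulIdx (c.mulIdx i j) l = c.mulIdx i (c.mulIdx j l))

/-- Whether there is a unit. -/
def unitTest (c : PolyCode) : Bool :=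
  decide (c.unitIdx < c.size) &&
    (List.range c.size).all fun i => decide (c.mulIdx i c.unitIdx = i)

/-- Whether all letters below `k` have an image. -/
def lettersTest (k : ℕ) (c : PolyCode) : Bool :=
  (List.range k).all fun a => decide (c.letters.getD a c.size < c.size)

/-- Whether the table of the production function is complete and nonnegative. -/
def productionTest (c : PolyCode) : Bool :=
  (List.range (c.size ^ (c.deg + 1))).all fun i =>
    -- The default `-1` makes a missing entry fail together with the negative ones.
    decide ((-(c.prodTable.getD i (-1))).toNat = 0)

/-- Whether `x ^ (n + 1) = x ^ n` for all `x`. -/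
def aperiodicTest (c : PolyCode) (n : ℕ) : Bool :=
  (List.range c.size).all fun x => decide (c.powIdx x (n + 1) = c.powIdx x n)

/-- Whether `c` describes a nonnegative production function on a monoid that satisfies
`x ^ (n + 1) = x ^ n`. -/
def validTest (k : ℕ) (c : PolyCode) (n : ℕ) : Bool :=
  c.mulTest && (c.unitTest && (c.lettersTest k && (c.productionTest && c.aperiodicTest n)))

/-- Whether two descriptions have the same values on short words. -/
def sameValuesTest (k : ℕ) (c c' : PolyCode) : Bool :=
  (shortWords k (c.size * (c.size + 1) ^ c.deg + c'.size * (c'.size + 1) ^ c'.deg)).all fun w =>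
    decide (c.value w = c'.value w)

/-- The test for the output of the conversion. -/
def convertTest (p : ℕ × PolyCode) (b : PolyCode × ℕ) : Bool :=
  b.1.validTest p.1 b.2 && p.2.sameValuesTest p.1 b.1

section Primrec

variable {α : Type*} [Primcodable α] {c : α → PolyCode} (hc : Primrec c)

include hc

theorem primrec_powIdx {x n : α → ℕ} (hx : Primrec x) (hn : Primrec n) :
    Primrec fun a => (c a).powIdx (x a) (n a) :=
  Primrec.nat_iterate hn (primrec_unitIdx hc)
    (primrec_mulIdx (hc.comp Primrec.fst) Primrec.snd (hx.comp Primrec.fst))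

theorem primrec_mulTest : Primrec fun a => (c a).mulTest := by
  have hc1 := hc.comp (Primrec.fst (α := α) (β := ℕ))
  have hc2 := hc1.comp (Primrec.fst (α := α × ℕ) (β := ℕ))
  have hc3 := hc2.comp (Primrec.fst (α := (α × ℕ) × ℕ) (β := ℕ))
  refine Primrec.list_range_all (primrec_size hc) (Primrec.list_range_all (primrec_size hc1) ?_)
  refine Primrec.and.comp (Primrec.decide_lt ?_ (primrec_size hc2))
    (Primrec.list_range_all (primrec_size hc2) ?_)
  · exact Primrec.option_getD.comp (Primrec.list_getElem?.comp (primrec_mulTable hc2)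
      (Primrec.nat_add.comp (Primrec.nat_mul.comp (Primrec.snd.comp Primrec.fst)
        (primrec_size hc2)) Primrec.snd)) (primrec_size hc2) |>.of_eq
        fun a => List.getD_eq_getElem?_getD.symm
  · have hi : Primrec fun q : ((α × ℕ) × ℕ) × ℕ => q.1.1.2 :=
      Primrec.snd.comp (Primrec.fst.comp Primrec.fst)
    have hj : Primrec fun q : ((α × ℕ) × ℕ) × ℕ => q.1.2 := Primrec.snd.comp Primrec.fst
    exact Primrec.decide_eq (primrec_mulIdx hc3 (primrec_mulIdx hc3 hi hj) Primrec.snd)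
      (primrec_mulIdx hc3 hi (primrec_mulIdx hc3 hj Primrec.snd))

theorem primrec_unitTest : Primrec fun a => (c a).unitTest := by
  have hc1 := hc.comp (Primrec.fst (α := α) (β := ℕ))
  refine Primrec.and.comp (Primrec.decide_lt (primrec_unitIdx hc) (primrec_size hc))
    (Primrec.list_range_all (primrec_size hc) ?_)
  exact Primrec.decide_eq (primrec_mulIdx hc1 Primrec.snd (primrec_unitIdx hc1)) Primrec.snd

theorem primrec_lettersTest {k : α → ℕ} (hk : Primrec k) :
    Primrec fun a => (c a).lettersTest (k a) := by
  have hc1 := hc.comp (Primrec.fst (α := α) (β := ℕ))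
  refine Primrec.list_range_all hk (Primrec.decide_lt ?_ (primrec_size hc1))
  exact Primrec.option_getD.comp (Primrec.list_getElem?.comp (primrec_letters hc1) Primrec.snd)
    (primrec_size hc1) |>.of_eq fun a => List.getD_eq_getElem?_getD.symm

theorem primrec_productionTest : Primrec fun a => (c a).productionTest := by
  have hc1 := hc.comp (Primrec.fst (α := α) (β := ℕ))
  refine Primrec.list_range_all
    (Primrec.nat_pow' (primrec_size hc) (Primrec.succ.comp (primrec_deg hc))) ?_
  exact Primrec.decide_eq (Primrec.int_neg_toNat.comp
    (Primrec.list_getD' (-1) (primrec_prodTable hc1) Primrec.snd)) (Primrec.const 0)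

theorem primrec_aperiodicTest {n : α → ℕ} (hn : Primrec n) :
    Primrec fun a => (c a).aperiodicTest (n a) := by
  have hc1 := hc.comp (Primrec.fst (α := α) (β := ℕ))
  have hn1 := hn.comp (Primrec.fst (α := α) (β := ℕ))
  refine Primrec.list_range_all (primrec_size hc) ?_
  exact Primrec.decide_eq (primrec_powIdx hc1 Primrec.snd (Primrec.succ.comp hn1))
    (primrec_powIdx hc1 Primrec.snd hn1)

theorem primrec_sameValuesTest {k : α → ℕ} {c' : α → PolyCode} (hk : Primrec k)
    (hc' : Primrec c') : Primrec fun a => (c a).sameValuesTest (k a) (c' a) := by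
  have hB : ∀ {c : α → PolyCode}, Primrec c →
      Primrec fun a => (c a).size * ((c a).size + 1) ^ (c a).deg := fun hc =>
    Primrec.nat_mul.comp (primrec_size hc)
      (Primrec.nat_pow' (Primrec.succ.comp (primrec_size hc)) (primrec_deg hc))
  refine Primrec.list_all' (primrec_shortWords hk (Primrec.nat_add.comp (hB hc) (hB hc'))) ?_
  exact Primrec.decide_eq (primrec_value (hc.comp Primrec.fst) Primrec.snd)
    (primrec_value (hc'.comp Primrec.fst) Primrec.snd)

end Primrec

theorem primrec_convertTest : Primrec₂ convertTest := by
  have hk : Primrec fun q : (ℕ × PolyCode) × PolyCode × ℕ => q.1.1 := Primrec.fst.comp Primrec.fst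
  have hc : Primrec fun q : (ℕ × PolyCode) × PolyCode × ℕ => q.1.2 := Primrec.snd.comp Primrec.fst
  have hc' : Primrec fun q : (ℕ × PolyCode) × PolyCode × ℕ => q.2.1 := Primrec.fst.comp Primrec.snd
  have hn : Primrec fun q : (ℕ × PolyCode) × PolyCode × ℕ => q.2.2 := Primrec.snd.comp Primrec.snd
  exact Primrec.and.comp (Primrec.and.comp (primrec_mulTest hc')
    (Primrec.and.comp (primrec_unitTest hc') (Primrec.and.comp (primrec_lettersTest hc' hk)
      (Primrec.and.comp (primrec_productionTest hc') (primrec_aperiodicTest hc' hn)))))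
    (primrec_sameValuesTest hc hk hc')

/-! ### Soundness and completeness of the conversion test -/

/-- `c` describes `f` by a nonnegative production function on a monoid that satisfies
`x ^ (n + 1) = x ^ n`. -/
def EncodesAperiodic {k : ℕ} (c : PolyCode) (n : ℕ) (f : FreeMonoid (Fin k) → ℤ) : Prop :=
  ∃ (M : Type) (_ : Monoid M) (e : M ≃ Fin c.size) (μ : FreeMonoid (Fin k) →* M)
    (π : (Fin (c.deg + 1) → M) → ℤ),
    c.Describes e μ π ∧ (∀ m : M, m ^ (n + 1) = m ^ n) ∧ (∀ m, 0 ≤ π m) ∧ f = polySum μ π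

theorem EncodesAperiodic.encodesNSF {k : ℕ} {c : PolyCode} {n : ℕ} {f : FreeMonoid (Fin k) → ℤ}
    (h : c.EncodesAperiodic n f) : c.EncodesNSF f := by
  obtain ⟨M, i, e, μ, π, h1, h2, h3, h4⟩ := h
  exact ⟨M, i, e, μ, π, h1, fun x => ⟨n, h2 x⟩, h3, h4⟩

theorem EncodesAperiodic.encodes {k : ℕ} {c : PolyCode} {n : ℕ} {f : FreeMonoid (Fin k) → ℤ}
    (h : c.EncodesAperiodic n f) : c.Encodes f := by
  obtain ⟨M, i, e, μ, π, h1, h2, h3, h4⟩ := h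
  exact ⟨M, i, e, μ, π, h1, h4⟩

theorem Describes.powIdx_eq {k : ℕ} {M : Type} [Monoid M] {c : PolyCode} {e : M ≃ Fin c.size}
    {μ : FreeMonoid (Fin k) →* M} {π : (Fin (c.deg + 1) → M) → ℤ} (h : c.Describes e μ π) (x : M)
    (n : ℕ) : c.powIdx (e x) n = e (x ^ n) := by
  induction n with
  | zero => rw [powIdx, Function.iterate_zero, id, h.unitIdx_eq, pow_zero]
  | succ n ih =>
    rw [powIdx, Function.iterate_succ_apply']
    change c.mulIdx (c.powIdx (e x) n) (e x) = _
    rw [ih, h.mulIdx_eq, pow_succ]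

theorem getElem?_of_getD_lt {l : List ℕ} {i s : ℕ} (h : l.getD i s < s) (d : ℕ) :
    l[i]? = some (l.getD i d) := by
  rw [List.getD_eq_getElem?_getD] at h ⊢
  cases hl : l[i]? with
  | none => rw [hl] at h; simp at h
  | some x => rfl

theorem exists_describes_of_validTest {k : ℕ} {c : PolyCode} {n : ℕ}
    (h : c.validTest k n = true) : ∃ f : FreeMonoid (Fin k) → ℤ, c.EncodesAperiodic n f := by
  simp only [validTest, mulTest, unitTest, lettersTest, productionTest, aperiodicTest,
    Bool.and_eq_true, List.all_eq_true, List.mem_range, decide_eq_true_eq] at h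
  obtain ⟨hmul, ⟨hunit, hunit'⟩, hlet, hprod, hap⟩ := h
  have hmulD : ∀ i < c.size, ∀ j < c.size, c.mulTable[i * c.size + j]? = some (c.mulIdx i j) :=
    fun i hi j hj => getElem?_of_getD_lt (hmul i hi j hj).1 0
  have hlt : ∀ i < c.size, ∀ j < c.size, c.mulIdx i j < c.size := fun i hi j hj => by
    have := (hmul i hi j hj).1
    rwa [getD_of_getElem? (hmulD i hi j hj)] at this
  have hletD : ∀ a < k, c.letters[a]? = some (c.letters.getD a 0) :=
    fun a ha => getElem?_of_getD_lt (hlet a ha) 0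
  have hletlt : ∀ a < k, c.letters.getD a 0 < c.size := fun a ha => by
    have := hlet a ha
    rwa [getD_of_getElem? (hletD a ha)] at this
  -- An index below `size` means that `findIdx` succeeded, so its predicate, being a left unit,
  -- holds there.
  have hleft : ∀ j < c.size, c.mulIdx c.unitIdx j = j := by
    intro j hj
    have h1 : c.unitIdx < (List.range c.size).length := by rwa [List.length_range]
    have h2 := List.findIdx_getElem (w := h1)
    have h3 := List.all_eq_true.1 h2 j (List.mem_range.2 hj)
    rw [decide_eq_true_eq] at h3
    have h4 : (List.range c.size)[c.unitIdx]'h1 = c.unitIdx := List.getElem_range _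
    exact (congrArg (fun i => c.mulIdx i j) h4).symm.trans h3
  let inst : Monoid (Fin c.size) :=
    { mul := fun i j => ⟨c.mulIdx i j, hlt i i.2 j j.2⟩
      one := ⟨c.unitIdx, hunit⟩
      mul_assoc := fun i j l => Fin.ext ((hmul i i.2 j j.2).2 l l.2)
      one_mul := fun i => Fin.ext (hleft i i.2)
      mul_one := fun i => Fin.ext (hunit' i i.2) }
  let μ : FreeMonoid (Fin k) →* Fin c.size :=
    FreeMonoid.lift fun a => ⟨c.letters.getD a 0, hletlt a a.2⟩
  let π : (Fin (c.deg + 1) → Fin c.size) → ℤ := fun m =>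
    c.prodTable.getD (finFunctionFinEquiv m : ℕ) 0
  have hd : c.Describes (Equiv.refl _) μ π := by
    refine ⟨fun i j => hmulD i i.2 j j.2, fun a => ?_, fun m => ?_⟩
    · rw [hletD a a.2]
      simp [μ]
    · have h1 := hprod _ (finFunctionFinEquiv m).2
      simp only [π, Equiv.refl_apply]
      rw [List.getD_eq_getElem?_getD] at h1 ⊢
      cases hl : c.prodTable[(finFunctionFinEquiv m : ℕ)]? with
      | none => rw [hl] at h1; simp at h1
      | some x => rfl
  refine ⟨_, Fin c.size, inst, Equiv.refl _, μ, π, hd, fun m => Fin.ext ?_, fun m => ?_, rfl⟩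
  · have h1 := hap m m.2
    have h2 := hd.powIdx_eq m (n + 1)
    have h3 := hd.powIdx_eq m n
    simp only [Equiv.refl_apply] at h2 h3
    rw [← h2, ← h3, h1]
  · have h1 := hprod _ (finFunctionFinEquiv m).2
    have h2 := hd.production m
    simp only [Equiv.refl_apply] at h2
    rw [getD_of_getElem? h2] at h1
    omega

theorem EncodesAperiodic.validTest {k : ℕ} {c : PolyCode} {n : ℕ} {f : FreeMonoid (Fin k) → ℤ}
    (h : c.EncodesAperiodic n f) : c.validTest k n = true := by
  obtain ⟨M, _, e, μ, π, hd, hn, hπ, -⟩ := h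
  have hsurj : ∀ i < c.size, ∃ x, (e x : ℕ) = i := fun i hi => by
    obtain ⟨x, hx⟩ := e.surjective ⟨i, hi⟩
    exact ⟨x, by rw [hx]⟩
  simp only [PolyCode.validTest, mulTest, unitTest, lettersTest, productionTest, aperiodicTest,
    Bool.and_eq_true, List.all_eq_true, List.mem_range, decide_eq_true_eq]
  refine ⟨fun i hi j hj => ?_, ⟨?_, fun i hi => ?_⟩, fun a ha => ?_, fun i hi => ?_,
    fun x hx => ?_⟩
  · obtain ⟨x, rfl⟩ := hsurj i hi
    obtain ⟨y, rfl⟩ := hsurj j hj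
    rw [getD_of_getElem? (hd.mul x y)]
    refine ⟨(e _).2, fun l hl => ?_⟩
    obtain ⟨z, rfl⟩ := hsurj l hl
    simp only [hd.mulIdx_eq, mul_assoc]
  · rw [hd.unitIdx_eq]
    exact (e 1).2
  · obtain ⟨x, rfl⟩ := hsurj i hi
    rw [hd.unitIdx_eq, hd.mulIdx_eq, mul_one]
  · rw [getD_of_getElem? (hd.letter ⟨a, ha⟩)]
    exact (e _).2
  · have h1 := hd.production fun j => e.symm (finFunctionFinEquiv.symm ⟨i, hi⟩ j)
    simp only [Equiv.apply_symm_apply] at h1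
    rw [getD_of_getElem? h1]
    have := hπ fun j => e.symm (finFunctionFinEquiv.symm ⟨i, hi⟩ j)
    omega
  · obtain ⟨x, rfl⟩ := hsurj x hx
    rw [hd.powIdx_eq, hd.powIdx_eq, hn]

theorem getElem?_ofFn_of_eq {α : Type*} {n : ℕ} (g : Fin n → α) {i : ℕ} (t : Fin n)
    (h : (t : ℕ) = i) : (List.ofFn g)[i]? = some (g t) := by
  subst h
  simp

theorem exists_encodesAperiodic {k : ℕ} {f : FreeMonoid (Fin k) → ℤ} (h : IsNSF f) :
    ∃ (c : PolyCode) (n : ℕ), c.EncodesAperiodic n f := by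
  obtain ⟨d, M, _, _, μ, π, hM, hπ, rfl⟩ := h
  obtain ⟨n, hn⟩ := exists_aperiodic_index hM
  let e : M ≃ Fin (Nat.card M) := Finite.equivFin M
  refine ⟨⟨d, Nat.card M, List.ofFn fun t : Fin (Nat.card M * Nat.card M) =>
    (e (e.symm (finProdFinEquiv.symm t).1 * e.symm (finProdFinEquiv.symm t).2) : ℕ),
    List.ofFn fun a : Fin k => (e (μ (FreeMonoid.of a)) : ℕ),
    List.ofFn fun t : Fin (Nat.card M ^ (d + 1)) =>
      π fun i => e.symm (finFunctionFinEquiv.symm t i)⟩, n, M, inferInstance, e, μ, π,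
      ⟨fun x y => ?_, fun a => ?_, fun m => ?_⟩, hn, hπ, rfl⟩
  · refine (getElem?_ofFn_of_eq _ (finProdFinEquiv (e x, e y)) ?_).trans ?_
    · simp [finProdFinEquiv]
      ring
    · simp
  · exact getElem?_ofFn_of_eq _ a rfl
  · refine (getElem?_ofFn_of_eq _ (finFunctionFinEquiv fun i => e (m i)) rfl).trans ?_
    simp

/-- The test covers all words shorter than the sum of the two dimension bounds, which is what
`eq_of_short_words` needs. -/
theorem eq_of_sameValuesTest {k : ℕ} {c c' : PolyCode} {f f' : FreeMonoid (Fin k) → ℤ}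
    (hf : c.Encodes f) (hf' : c'.Encodes f') (h : c.sameValuesTest k c' = true) : f = f' := by
  simp only [sameValuesTest, List.all_eq_true, decide_eq_true_eq] at h
  have h1 := forall_mem_shortWords.1 h
  simp only [hf.value_eq, hf'.value_eq] at h1
  obtain ⟨M, _, e, μ, π, -, rfl⟩ := hf
  obtain ⟨M', _, e', μ', π', -, rfl⟩ := hf'
  have : Finite M := Finite.of_equiv _ e.symm
  have : Finite M' := Finite.of_equiv _ e'.symm
  have h2 := eq_of_short_words (cast_polySum_mem_polySpace μ π) (cast_polySum_mem_polySpace μ' π')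
    fun w hw => by
      rw [Nat.card_congr e, Nat.card_congr e', Nat.card_fin, Nat.card_fin] at hw
      exact congrArg _ (h1 w hw)
  funext w
  exact_mod_cast congrFun h2 w

theorem encodesAperiodic_of_convertTest {k : ℕ} {c c' : PolyCode} {n : ℕ}
    {f : FreeMonoid (Fin k) → ℤ} (hf : c.Encodes f) (h : convertTest (k, c) (c', n) = true) :
    c'.EncodesAperiodic n f := by
  rw [convertTest, Bool.and_eq_true] at h
  obtain ⟨f', hf'⟩ := exists_describes_of_validTest h.1
  rw [eq_of_sameValuesTest hf hf'.encodes h.2]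
  exact hf'

/-- A suitable description together with an aperiodicity exponent exists, so the search halts; any
candidate that passes is correct, not only the one known to exist. -/
theorem exists_mem_search_convertTest {k : ℕ} {c : PolyCode} {f : FreeMonoid (Fin k) → ℤ}
    (hf : c.Encodes f) (h : IsNSF f) :
    ∃ b ∈ search convertTest (k, c), b.1.EncodesAperiodic b.2 f := by
  obtain ⟨c', n, h'⟩ := exists_encodesAperiodic h
  obtain ⟨b, hb⟩ := exists_mem_search (check := convertTest) (a := (k, c)) (b := (c', n)) (by
    rw [convertTest, Bool.and_eq_true]
    refine ⟨h'.validTest, ?_⟩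
    simp only [sameValuesTest, List.all_eq_true, decide_eq_true_eq]
    exact forall_mem_shortWords.2 fun w _ => by rw [hf.value_eq, h'.encodes.value_eq])
  exact ⟨b, hb, encodesAperiodic_of_convertTest hf (check_of_mem_search hb)⟩

end PolyCode

/-! ### Computing the polynomials -/

/-- The value at `y` of the pattern with code `q`. -/
def patternWord (q : List ℕ × List (List ℕ × List ℕ)) (y : List ℕ) : List ℕ :=
  q.1 ++ (List.range q.2.length).flatMap fun i =>
    (List.replicate (y.getD i 0) (q.2.getD i ([], [])).1).flatten ++ (q.2.getD i ([], [])).2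

theorem wordCode_pow {k : ℕ} (u : FreeMonoid (Fin k)) (x : ℕ) :
    wordCode (u ^ x) = (List.replicate x (wordCode u)).flatten := by
  induction x with
  | zero => rfl
  | succ x ih => rw [pow_succ', wordCode_mul, ih, List.replicate_succ, List.flatten_cons]

theorem wordCode_list_prod {k : ℕ} (l : List (FreeMonoid (Fin k))) :
    wordCode l.prod = (l.map wordCode).flatten := by
  induction l with
  | nil => rfl
  | cons u l ih => rw [List.prod_cons, wordCode_mul, ih, List.map_cons, List.flatten_cons]

theorem List.map_range_eq_ofFn {α : Type*} (n : ℕ) (g : ℕ → α) :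
    (List.range n).map g = List.ofFn fun i : Fin n => g i :=
  List.ext_getElem (by simp) fun i _ _ => by simp

theorem List.getD_ofFn {α : Type*} {n : ℕ} (g : Fin n → α) (i : Fin n) (d : α) :
    (List.ofFn g).getD i d = g i := by
  simp [List.getD_eq_getElem?_getD]

theorem patternWord_code {k p : ℕ} (q : PumpingPattern (Fin k) p) (x : Fin p → ℕ) :
    patternWord q.code (List.ofFn x) = wordCode (q.eval x) := by
  rw [patternWord, PumpingPattern.eval, wordCode_mul, wordCode_list_prod]
  simp only [PumpingPattern.code, List.length_ofFn]
  rw [List.flatMap_def, List.map_range_eq_ofFn, List.map_ofFn]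
  congr 3
  funext i
  simp only [List.getD_ofFn, Function.comp_apply, wordCode_mul, wordCode_pow]

/-- The value at `y` of the monomial with the exponents `e`, in `p` variables. -/
def monomialValue (p : ℕ) (y e : List ℕ) : ℕ :=
  ((List.range p).map fun i => y.getD i 0 ^ e.getD i 0).prod

/-- Whether the polynomial `1 / b.1 * ∑ t.1 * X ^ t.2` has degree at most `deg` in each variable
and agrees with the pumped function on a grid. -/
def polynomialTest (a : (PolyCode × ℕ) × List ℕ × List (List ℕ × List ℕ))
    (b : ℕ × List (ℤ × List ℕ)) : Bool :=
  decide (0 < b.1) &&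
    ((b.2.all fun t => (List.range a.2.2.length).all fun i => decide (t.2.getD i 0 ≤ a.1.1.deg)) &&
      (wordsOfLength (a.1.1.deg + 1) a.2.2.length).all fun x =>
        -- Multiplying by the common denominator `b.1` keeps the comparison within the integers. The
        -- grid starts at `n * (deg + 1)`, where pumping is already polynomial.
        decide ((b.2.map fun t => (monomialValue a.2.2.length
            (x.map fun j => a.1.2 * (a.1.1.deg + 1) + j) t.2 : ℤ) * t.1).sum =
          b.1 * a.1.1.value (patternWord a.2 (x.map fun j => a.1.2 * (a.1.1.deg + 1) + j))))

section Primrec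

variable {α : Type*} [Primcodable α]

theorem primrec_patternWord {q : α → List ℕ × List (List ℕ × List ℕ)} {y : α → List ℕ}
    (hq : Primrec q) (hy : Primrec y) : Primrec fun a => patternWord (q a) (y a) := by
  refine Primrec.list_append.comp (Primrec.fst.comp hq) (Primrec.list_flatMap
    (Primrec.list_range.comp (Primrec.list_length.comp (Primrec.snd.comp hq))) ?_)
  have hp : Primrec fun b : α × ℕ => (q b.1).2.getD b.2 ([], []) :=
    Primrec.list_getD' _ (Primrec.snd.comp (hq.comp Primrec.fst)) Primrec.snd
  exact Primrec.list_append.comp (Primrec.list_flatten.comp (Primrec.list_replicate'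
    (Primrec.list_getD' 0 (hy.comp Primrec.fst) Primrec.snd) (Primrec.fst.comp hp)))
    (Primrec.snd.comp hp)

theorem primrec_monomialValue {p : α → ℕ} {y e : α → List ℕ} (hp : Primrec p) (hy : Primrec y)
    (he : Primrec e) : Primrec fun a => monomialValue (p a) (y a) (e a) :=
  Primrec.nat_prod_map (Primrec.list_range.comp hp) (Primrec.nat_pow'
    (Primrec.list_getD' 0 (hy.comp Primrec.fst) Primrec.snd)
    (Primrec.list_getD' 0 (he.comp Primrec.fst) Primrec.snd))

theorem primrec_polynomialTest : Primrec₂ polynomialTest := by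
  let Γ := ((PolyCode × ℕ) × List ℕ × List (List ℕ × List ℕ)) × ℕ × List (ℤ × List ℕ)
  have ha : Primrec fun s : Γ => s.1 := Primrec.fst
  have hc : Primrec fun s : Γ => s.1.1.1 := Primrec.fst.comp (Primrec.fst.comp ha)
  have hn : Primrec fun s : Γ => s.1.1.2 := Primrec.snd.comp (Primrec.fst.comp ha)
  have hq : Primrec fun s : Γ => s.1.2 := Primrec.snd.comp ha
  have hp : Primrec fun s : Γ => s.1.2.2.length := Primrec.list_length.comp (Primrec.snd.comp hq)
  have hm : Primrec fun s : Γ => s.2.1 := Primrec.fst.comp Primrec.snd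
  have hL : Primrec fun s : Γ => s.2.2 := Primrec.snd.comp Primrec.snd
  have hd := PolyCode.primrec_deg hc
  refine Primrec.and.comp (Primrec.decide_lt (Primrec.const 0) hm) (Primrec.and.comp ?_ ?_)
  · refine Primrec.list_all' hL (Primrec.list_range_all (hp.comp Primrec.fst) ?_)
    exact Primrec.decide_le (Primrec.list_getD' 0
      (Primrec.snd.comp (Primrec.snd.comp Primrec.fst)) Primrec.snd)
      (hd.comp (Primrec.fst.comp Primrec.fst))
  · refine Primrec.list_all' (primrec_wordsOfLength (Primrec.succ.comp hd) hp) ?_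
    have hy : Primrec fun s : Γ × List ℕ =>
        s.2.map fun j => s.1.1.1.2 * (s.1.1.1.1.deg + 1) + j := by
      refine Primrec.list_map Primrec.snd ?_
      have hf : Primrec fun s : (Γ × List ℕ) × ℕ => s.1.1 := Primrec.fst.comp Primrec.fst
      exact Primrec.nat_add.comp (Primrec.nat_mul.comp (hn.comp hf)
        (Primrec.succ.comp (hd.comp hf))) Primrec.snd
    refine Primrec.decide_eq (Primrec.int_sum_map (hL.comp Primrec.fst) ?_) ?_
    · have hf : Primrec fun s : (Γ × List ℕ) × ℤ × List ℕ => s.1.1 := Primrec.fst.comp Primrec.fst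
      exact Primrec.int_natCast_mul' (primrec_monomialValue (hp.comp hf) (hy.comp Primrec.fst)
        (Primrec.snd.comp Primrec.snd)) (Primrec.fst.comp Primrec.snd)
    · exact Primrec.int_natCast_mul' (hm.comp Primrec.fst)
        (PolyCode.primrec_value (hc.comp Primrec.fst) (primrec_patternWord (hq.comp Primrec.fst) hy))

end Primrec

/-- The code of the polynomial `1 / b.1 * ∑ t.1 * X ^ t.2`. -/
def polynomialOutput (b : ℕ × List (ℤ × List ℕ)) : List (ℤ × ℕ × List ℕ) :=
  b.2.map fun t => (t.1, b.1, t.2)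

theorem primrec_polynomialOutput : Primrec polynomialOutput := by
  refine Primrec.list_map Primrec.snd ?_
  exact Primrec.pair (Primrec.fst.comp Primrec.snd) (Primrec.pair
    (Primrec.fst.comp Primrec.fst) (Primrec.snd.comp Primrec.snd))

theorem eval_decodePolynomial_output {p : ℕ} (b : ℕ × List (ℤ × List ℕ)) (y : Fin p → ℕ) :
    MvPolynomial.eval (fun i => (y i : ℚ)) (decodePolynomial p (polynomialOutput b)) =
      ((b.2.map fun t => (monomialValue p (List.ofFn y) t.2 : ℤ) * t.1).sum : ℤ) / (b.1 : ℚ) := by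
  obtain ⟨m, L⟩ := b
  simp only [decodePolynomial, polynomialOutput, List.map_map]
  induction L with
  | nil => simp
  | cons t L ih =>
    rw [List.map_cons, List.sum_cons, map_add, ih, List.map_cons, List.sum_cons, Int.cast_add,
      add_div]
    congr 1
    simp only [Function.comp_apply, map_mul, map_prod, map_pow, MvPolynomial.eval_C,
      MvPolynomial.eval_X, monomialValue, List.map_range_eq_ofFn, List.prod_ofFn, List.getD_ofFn]
    push_cast
    ring

theorem degreeOf_decodePolynomial_output_le {p d : ℕ} (b : ℕ × List (ℤ × List ℕ))
    (h : ∀ t ∈ b.2, ∀ i < p, t.2.getD i 0 ≤ d) (i : Fin p) :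
    (decodePolynomial p (polynomialOutput b)).degreeOf i ≤ d := by
  obtain ⟨m, L⟩ := b
  simp only [decodePolynomial, polynomialOutput, List.map_map]
  induction L with
  | nil => simp
  | cons t L ih =>
    rw [List.map_cons, List.sum_cons]
    refine (MvPolynomial.degreeOf_add_le _ _ _).trans (max_le ?_
      (ih fun t ht => h t (List.mem_cons_of_mem _ ht)))
    refine (MvPolynomial.degreeOf_mul_le _ _ _).trans ?_
    rw [MvPolynomial.degreeOf_C, zero_add]
    refine (MvPolynomial.degreeOf_prod_le _ _ _).trans ?_
    rw [Finset.sum_eq_single_of_mem i (Finset.mem_univ i)]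
    · refine (MvPolynomial.degreeOf_pow_le _ _ _).trans ?_
      rw [MvPolynomial.degreeOf_X, if_pos rfl, mul_one]
      exact h t List.mem_cons_self i i.2
    · intro j _ hj
      refine Nat.le_zero.1 ((MvPolynomial.degreeOf_pow_le _ _ _).trans ?_)
      rw [MvPolynomial.degreeOf_X, if_neg hj.symm, mul_zero]

/-- The product of the denominators of the coefficients serves as common denominator, so the search
space contains every polynomial of the required degrees. -/
theorem exists_decodePolynomial_eq {p d : ℕ} (P : MvPolynomial (Fin p) ℚ)
    (hP : ∀ i, P.degreeOf i ≤ d) : ∃ b : ℕ × List (ℤ × List ℕ), 0 < b.1 ∧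
      (∀ t ∈ b.2, ∀ i < p, t.2.getD i 0 ≤ d) ∧ decodePolynomial p (polynomialOutput b) = P := by
  set m := ∏ v ∈ P.support, (P.coeff v).den with hm
  have hm0 : 0 < m := Finset.prod_pos fun v _ => (P.coeff v).pos
  have hz : ∀ v, ∃ z : ℤ, v ∈ P.support → (z : ℚ) / m = P.coeff v := by
    intro v
    by_cases hv : v ∈ P.support
    · obtain ⟨r, hr⟩ := Finset.dvd_prod_of_mem (fun v => (P.coeff v).den) hv
      refine ⟨(P.coeff v).num * r, fun _ => ?_⟩
      have hr' : (m : ℚ) = (P.coeff v).den * r := by rw [hm, hr]; push_cast; rfl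
      have hr0 : (r : ℚ) ≠ 0 := by
        rintro h0
        rw [h0, mul_zero] at hr'
        exact hm0.ne' (by exact_mod_cast hr')
      rw [hr']
      push_cast
      rw [mul_div_mul_right _ _ hr0, Rat.num_div_den]
    · exact ⟨0, fun h => absurd h hv⟩
  choose z hz using hz
  refine ⟨(m, P.support.toList.map fun v => (z v, List.ofFn fun i => v i)), hm0, ?_, ?_⟩
  · intro t ht i hi
    obtain ⟨v, hv, rfl⟩ := List.mem_map.1 ht
    have := List.getD_ofFn (fun i => v i) ⟨i, hi⟩ 0
    simp only at this
    rw [this]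
    refine le_trans ?_ (hP ⟨i, hi⟩)
    rw [MvPolynomial.degreeOf_eq_sup]
    exact Finset.le_sup (f := fun v : Fin p →₀ ℕ => v ⟨i, hi⟩) (Finset.mem_toList.1 hv)
  · simp only [decodePolynomial, polynomialOutput, List.map_map]
    rw [Finset.sum_map_toList]
    conv_rhs => rw [P.as_sum]
    refine Finset.sum_congr rfl fun v hv => ?_
    simp only [Function.comp_apply, List.getD_ofFn]
    rw [hz v hv, MvPolynomial.monomial_eq, Finsupp.prod_fintype _ _ fun i => pow_zero _]

/-- The true polynomial has degree at most `deg` in each variable, so it passes the test for some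
code. Conversely, a candidate with this degree bound is determined by its values on a grid with `deg
+ 1` points per coordinate. -/
theorem agreesFrom_of_polynomialTest {k p : ℕ} {c : PolyCode} {n : ℕ}
    {f : FreeMonoid (Fin k) → ℤ} (hf : c.EncodesAperiodic n f) (q : PumpingPattern (Fin k) p) :
    (∃ b, polynomialTest ((c, n), q.code) b = true) ∧
      ∀ b, polynomialTest ((c, n), q.code) b = true →
        AgreesFrom f q (n * (c.deg + 1)) (decodePolynomial p (polynomialOutput b)) := by
  have hval := hf.encodes.value_eq
  obtain ⟨M, _, e, μ, π, -, hn, -, rfl⟩ := hf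
  have : Finite M := Finite.of_equiv _ e.symm
  obtain ⟨P, hPd, hP⟩ := exists_polynomial_of_aperiodic hn p _ (cast_polySum_mem_polySpace μ π) q
  have hlen : q.code.2.length = p := by simp [PumpingPattern.code]
  have htest : ∀ b, polynomialTest ((c, n), q.code) b = true ↔ 0 < b.1 ∧
      (∀ t ∈ b.2, ∀ i < p, t.2.getD i 0 ≤ c.deg) ∧ ∀ x : Fin p → ℕ, (∀ i, x i < c.deg + 1) →
        MvPolynomial.eval (fun i => ((n * (c.deg + 1) + x i : ℕ) : ℚ))
          (decodePolynomial p (polynomialOutput b)) =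
        polySum μ π (q.eval fun i => n * (c.deg + 1) + x i) := by
    intro b
    simp only [polynomialTest, Bool.and_eq_true, List.all_eq_true, List.mem_range,
      decide_eq_true_eq, hlen]
    refine and_congr_right fun hb => and_congr_right fun _ => ?_
    have hb' : (b.1 : ℚ) ≠ 0 := by exact_mod_cast hb.ne'
    have hx : ∀ x : Fin p → ℕ, (MvPolynomial.eval (fun i => ((n * (c.deg + 1) + x i : ℕ) : ℚ))
          (decodePolynomial p (polynomialOutput b)) =
        polySum μ π (q.eval fun i => n * (c.deg + 1) + x i)) ↔
        (b.2.map fun t => (monomialValue p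
            ((List.ofFn x).map fun j => n * (c.deg + 1) + j) t.2 : ℤ) * t.1).sum =
          b.1 * c.value (patternWord q.code
            ((List.ofFn x).map fun j => n * (c.deg + 1) + j)) := by
      intro x
      rw [List.map_ofFn, show ((fun j => n * (c.deg + 1) + j) ∘ x) =
        fun i => n * (c.deg + 1) + x i from rfl, patternWord_code, hval,
        eval_decodePolynomial_output b fun i => n * (c.deg + 1) + x i, div_eq_iff hb', mul_comm _ (b.1 : ℚ)]
      exact_mod_cast Iff.rfl
    constructor
    · intro h x hxd
      rw [hx]
      refine h _ (mem_wordsOfLength.2 ⟨List.length_ofFn, fun a ha => ?_⟩)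
      obtain ⟨i, rfl⟩ := List.mem_ofFn.1 ha
      exact hxd i
    · intro h l hl
      obtain ⟨hl1, hl2⟩ := mem_wordsOfLength.1 hl
      subst hl1
      have h1 := (hx l.get).1 (h l.get fun i => hl2 _ (List.get_mem l i))
      rwa [List.ofFn_get] at h1
  constructor
  · obtain ⟨b, hb, hbd, hbP⟩ := exists_decodePolynomial_eq P hPd
    refine ⟨b, (htest b).2 ⟨hb, hbd, fun x _ => ?_⟩⟩
    rw [hbP]
    exact (hP _ fun i => Nat.le_add_right _ _).symm
  · intro b hb
    obtain ⟨-, hbd, hbx⟩ := (htest b).1 hb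
    have hPQ : decodePolynomial p (polynomialOutput b) - P = 0 := by
      refine MvPolynomial.eq_zero_of_eval_zero_at_prod_finset _ (fun _ =>
        (Finset.range (c.deg + 1)).image fun j => ((n * (c.deg + 1) + j : ℕ) : ℚ)) ?_ ?_
      · intro i
        rw [Finset.card_image_of_injective _ fun j j' h => by
          have : n * (c.deg + 1) + j = n * (c.deg + 1) + j' := by exact_mod_cast h
          omega, Finset.card_range]
        exact Nat.lt_succ_of_le ((MvPolynomial.degreeOf_sub_le _ _ _).trans
          (max_le (degreeOf_decodePolynomial_output_le b hbd i) (hPd i)))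
      · intro y hy
        simp only [Finset.mem_image, Finset.mem_range] at hy
        choose x hxd hxy using hy
        obtain rfl : (fun i => ((n * (c.deg + 1) + x i : ℕ) : ℚ)) = y := funext hxy
        rw [map_sub, hbx x hxd, sub_eq_zero]
        exact hP _ fun i => Nat.le_add_right _ _
    rw [sub_eq_zero] at hPQ
    intro x hx
    rw [hPQ]
    exact hP x hx

/-! ### The main theorem -/

theorem mainTheorem6 :
    -- the three conditions are equivalent
    (∀ (A : Type*) [Finite A] (f : FreeMonoid A → ℤ), IsCommutative f → IsNPoly f →
      [IsUltimatelyPolynomial f, IsZSF f, IsNSF f].TFAE) ∧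
    -- the intersection of `ℕ`-polyregular and star-free `ℤ`-polyregular, for commutative functions
    (∀ (A : Type*) [Finite A] (f : FreeMonoid A → ℤ), IsCommutative f →
      (IsNPoly f ∧ IsZSF f ↔ IsNSF f)) ∧
    -- membership is decidable
    (∃ decider : ℕ × PolyCode →. Bool, Partrec decider ∧
      ∀ (k : ℕ) (c : PolyCode) (f : FreeMonoid (Fin k) → ℤ),
        IsCommutative f → IsNPoly f → c.Encodes f →
          ∃ b ∈ decider (k, c), (b = true ↔ IsNSF f)) ∧
    -- effective conversion of any description into a star-free `ℕ`-polyregular one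
    (∃ convert : ℕ × PolyCode →. PolyCode, Partrec convert ∧
      ∀ (k : ℕ) (c : PolyCode) (f : FreeMonoid (Fin k) → ℤ),
        IsCommutative f → IsNPoly f → c.Encodes f → IsUltimatelyPolynomial f →
          ∃ c' ∈ convert (k, c), c'.EncodesNSF f) ∧
    -- effective computation of the threshold and of the polynomials
    (∃ (threshold : ℕ × PolyCode →. ℕ)
        (polynomial : (ℕ × PolyCode) × (List ℕ × List (List ℕ × List ℕ)) →.
          List (ℤ × ℕ × List ℕ)),
      Partrec threshold ∧ Partrec polynomial ∧
      ∀ (k : ℕ) (c : PolyCode) (f : FreeMonoid (Fin k) → ℤ),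
        IsCommutative f → IsNPoly f → c.Encodes f → IsZSF f →
          ∃ N₀ ∈ threshold (k, c), ∀ (p : ℕ) (q : PumpingPattern (Fin k) p),
            ∃ l ∈ polynomial ((k, c), q.code), AgreesFrom f q N₀ (decodePolynomial p l)) := by
  have hsearch : Partrec (search PolyCode.convertTest) :=
    partrec_search PolyCode.primrec_convertTest
  refine ⟨fun A _ f hc hf => tfae_of_isCommutative hc hf, fun A _ f hc => ?_, ?_, ?_, ?_⟩
  · exact ⟨fun h => ((tfae_of_isCommutative hc h.1).out 1 2).1 h.2, fun h => ⟨h.isNPoly, h.isZSF⟩⟩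
  · exact ⟨fun p => Part.some (isNSFTest p.1 p.2), primrec_isNSFTest.to_comp, fun k c f hc hf he =>
      ⟨_, Part.mem_some _, isNSFTest_eq_true_iff_isNSF hc hf he⟩⟩
  · refine ⟨fun p => (search PolyCode.convertTest p).map Prod.fst,
      hsearch.map (Primrec.fst.comp Primrec.snd).to_comp, fun k c f hc hf he hu => ?_⟩
    obtain ⟨b, hb, hbf⟩ := PolyCode.exists_mem_search_convertTest he (hu.isNSF hc hf)
    exact ⟨b.1, Part.mem_map _ hb, hbf.encodesNSF⟩
  -- Both algorithms run the same deterministic conversion search and obtain the same aperiodic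
  -- presentation. Hence the threshold is shared by all patterns.
  · refine ⟨fun p => (search PolyCode.convertTest p).map fun b => b.2 * (b.1.deg + 1),
      fun a => (search PolyCode.convertTest a.1).bind fun b =>
        (search polynomialTest (b, a.2)).map polynomialOutput, ?_, ?_, ?_⟩
    · refine hsearch.map (Primrec.to_comp ?_)
      exact Primrec.nat_mul.comp (Primrec.snd.comp Primrec.snd)
        (Primrec.succ.comp (PolyCode.primrec_deg (Primrec.fst.comp Primrec.snd)))
    · refine (hsearch.comp Computable.fst).bind ?_
      refine ((partrec_search primrec_polynomialTest).comp (Primrec.to_comp ?_)).map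
        (primrec_polynomialOutput.comp Primrec.snd).to_comp
      exact Primrec.pair Primrec.snd (Primrec.snd.comp Primrec.fst)
    · intro k c f hc hf he hz
      obtain ⟨b, hb, hbf⟩ := PolyCode.exists_mem_search_convertTest he
        (hz.isUltimatelyPolynomial.isNSF hc hf)
      refine ⟨_, Part.mem_map _ hb, fun p q => ?_⟩
      obtain ⟨⟨r, hr⟩, hall⟩ := agreesFrom_of_polynomialTest hbf q
      obtain ⟨s, hs⟩ := exists_mem_search hr
      exact ⟨_, Part.mem_bind hb (Part.mem_map _ hs), hall s (check_of_mem_search hs)⟩
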